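/- **Setting.** An instance consists of agents $N=\{1,\dots,n\}$, items $M=\{1,\dots,m\}$, additive valuations $v_i:2^M\to\mathbb R_{\ge 0}$ ($i\in N$) and a conflict graph $G$ with vertex set $M$ and maximum degree $\Delta=\Delta(G)$. An allocation is a partition $A=\langle A_1,\dots,A_n\rangle$ of $M$ into (possibly empty) bundles; it is feasible if each $A_i$ is independent in $G$. The maximin share of $i$ is $\mu_i=\max_A\min_j v_i(A_j)$, the maximum being over all feasible allocations; $A$ is $\alpha$-approximate MMS if it is feasible and $v_i(A_i)\ge\alpha\mu_i$ for all $i$. **Bag filling.** Given agents $N'$, limits $x_i$ and disjoint independent sets $A_1,\dots,A_\ell$, repeat as long as some $v_i(A_k)\ge x_i$ with $i\in N'$: choose such an $A_k$; starting with $B=\emptyset$, add items of $A_k$ to $B$ one at a time until $v_i(B)\ge x_i$ for some $i\in N'$; give $B$ to such an $i$ and remove $i$ from $N'$ and $B$ from $A_k$. **The algorithm** (with parameter $\alpha$). Let $N',M'$ always denote the remaining agents and items (initially $N,M$). "Worth at least $\alpha$ to $i$ under the scaling $v_i(X)=c$" means value at least $\alpha v_i(X)/c$. 1. As long as some remaining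 item is worth at least $\alpha$ to some remaining agent $i$ under the scaling $v_i(M')=|N'|$, give such an item to such an agent and remove both. 2. If no agent remains, go to 3. Otherwise, with the scaling $v_i(M')=|N'|$ for all $i \in N'$: * (a) If $|N'|=1$, give the remaining agent $i$ an independent set $S$ of $G[M']$ with $v_i(S)\ge\alpha\, v_i(T)$ for all independent sets $T$ of $G[M']$. * (b) If $|N'|\ge2$ and $G[M']$ is $\Delta$-colourable, perform bag filling with all limits $\alpha$ on the classes of a $\Delta$-colouring of $G[M']$. * (c) If $2\le|N'|\le\Delta$ and $G[M']$ is not $\Delta$-colourable, select $i\in N'$ and let $B$ consist of one item of least value to $i$ from each non-$\Delta$-colourable component of $G[M']$. Rescale $v_i$ so that $v_i(M'\setminus B)=|N'|$, or, if that makes $v_i(M')>|N'|+1$, so that $v_i(M')=|N'|+1$. If some item of $M'$ is now worth at least $\alpha$ to $i$, give one such item to $i$, remove both and return to 1. Otherwise perform bag filling with all limits $\alpha$ on $B$ and the classes of a $\Delta$-colouring of $G[M'\setminus B]$, giving a bag to $i$ only if no other remaining agent values it at least $\alpha$. * (d) If $|N'|\ge 2$, $|N'|>\Delta$ and $G[M']$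 is not $\Delta$-colourable, perform bag filling with all limits $\alpha$ on the classes of a $(\Delta+1)$-colouring of $G[M']$. 3. Distribute the leftover items so that the result is a feasible allocation. **Theorem.** For $\Delta\ge1$ let $$\alpha=\begin{cases}1/2&\text{if }\Delta=1,\\ 3/7&\text{if }\Delta=2,\\ 2/(\Delta+2)&\text{if }\Delta>2,\end{cases}$$ so that $\alpha>1/\Delta$ when $\Delta>2$. For every instance with $n>\Delta(G)\ge1$, every output of the algorithm with this $\alpha$, whatever choices it makes, is an $\alpha$-approximate MMS allocation. Moreover, the algorithm can be carried out in polynomial time in the number of agents and items: there are a single program and a polynomial $p$ such that, on every instance with $n>\Delta(G)\ge1$, the program halts after at most $p(n+m)$ steps with an output of the algorithm. (Programs are WHILE programs on binary trees with leaves $\mathrm{nil}$ or real numbers; the elementary operations, one step each, are pairing, taking the two parts of a pair, testing for $\mathrm{nil}$, and addition, subtraction and comparison of reals, with $0$ as only real constant. The input is the matrix of the values $v_i(\{j\})$ and the adjacency matrix of $G$, as lists of rows; the output lists, for each item, the index in unary of the agent that receives it.) -/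

import Mathlib

namespace ConflictAlloc

/-! ### Problem instances, feasible allocations and maximin shares -/

/-- An instance with agents `Fin n`, items `Fin m`, additive valuations (given by the values of
the single items) and a conflict graph on the items. -/
structure Problem (n m : ℕ) where
  val : Fin n → Fin m → ℝ
  val_nonneg : ∀ i j, 0 ≤ val i j
  graph : SimpleGraph (Fin m)

namespace Problem

variable {n m : ℕ}

/-- The value `v_i(S)` of a set of items. -/
noncomputable def value (I : Problem n m) (i : Fin n) (S : Finset (Fin m)) : ℝ :=
  ∑ j ∈ S, I.val i j

open Classical in
/-- The maximum degree of the conflict graph. -/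
noncomputable def maxDeg (I : Problem n m) : ℕ := I.graph.maxDegree

end Problem

/-- An allocation assigns every item to an agent; `bundle A i` is the set given to `i`. -/
def bundle {n m : ℕ} (A : Fin m → Fin n) (i : Fin n) : Finset (Fin m) :=
  Finset.univ.filter fun j => A j = i

namespace Problem

variable {n m : ℕ}

/-- No bundle contains two conflicting items. -/
def Feasible (I : Problem n m) (A : Fin m → Fin n) : Prop :=
  ∀ i, I.graph.IsIndepSet (bundle A i : Set (Fin m))

/-- The maximin share of agent `i`: the maximum over the (finitely many) feasible allocations of
the minimum value of a bundle. -/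
noncomputable def mms (I : Problem n m) (i : Fin n) : ℝ :=
  ⨆ A : {A : Fin m → Fin n // I.Feasible A}, ⨅ k : Fin n, I.value i (bundle A.1 k)

/-- `A` is an `α`-approximate MMS allocation. -/
def IsApproxMMS (I : Problem n m) (α : ℝ) (A : Fin m → Fin n) : Prop :=
  I.Feasible A ∧ ∀ i, α * I.mms i ≤ I.value i (bundle A i)

end Problem

/-! ### Bag filling -/

/-- `FillBag S sat B`: the bag `B` arises from the empty bag by adding items of `S` one at a time,
where an item is added only as long as the bag does not satisfy `sat`. -/
inductive FillBag {m : ℕ} (S : Finset (Fin m)) (sat : Finset (Fin m) → Prop) :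
    Finset (Fin m) → Prop
  | empty : FillBag S sat ∅
  | add {B : Finset (Fin m)} {j : Fin m} :
      FillBag S sat B → ¬ sat B → j ∈ S → j ∉ B → FillBag S sat (insert j B)

/-- `BagFill I x last A N P Q`: bag filling with limits `x`, the source sets `A`, the remaining
agents `N` and the bundles `P` given so far can end with the bundles `Q`. An agent in `last`
receives a bag only if no agent of `N` outside `last` would accept it. -/
inductive BagFill {n m : ℕ} (I : Problem n m) (x : Fin n → ℝ) (last : Finset (Fin n)) {l : ℕ} :
    (Fin l → Finset (Fin m)) → Finset (Fin n) →
      (Fin n → Finset (Fin m)) → (Fin n → Finset (Fin m)) → Prop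
  | finish {A : Fin l → Finset (Fin m)} {N : Finset (Fin n)} {P : Fin n → Finset (Fin m)} :
      (∀ k, ∀ i ∈ N, I.value i (A k) < x i) → BagFill I x last A N P P
  | give {A : Fin l → Finset (Fin m)} {N : Finset (Fin n)} {P Q : Fin n → Finset (Fin m)}
      (k : Fin l) (B : Finset (Fin m)) (i : Fin n) :
      (∃ a ∈ N, x a ≤ I.value a (A k)) →
      FillBag (A k) (fun B' => ∃ a ∈ N, x a ≤ I.value a B') B →
      i ∈ N → x i ≤ I.value i B →
      (i ∈ last → ∀ a ∈ N, x a ≤ I.value a B → a ∈ last) →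
      BagFill I x last (Function.update A k (A k \ B)) (N.erase i) (Function.update P i B) Q →
      BagFill I x last A N P Q

/-! ### The approximation algorithm -/

/-- `G[S]` is `l`-colourable. -/
def ColorableOn {m : ℕ} (G : SimpleGraph (Fin m)) (S : Finset (Fin m)) (l : ℕ) : Prop :=
  (G.induce (S : Set (Fin m))).Colorable l

/-- The sets `A 0, …, A (l - 1)` are the colour classes (possibly empty) of a colouring of `G[S]`
with `l` colours. -/
def IsColoringOf {m l : ℕ} (G : SimpleGraph (Fin m)) (S : Finset (Fin m))
    (A : Fin l → Finset (Fin m)) : Prop :=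
  (∀ k, G.IsIndepSet (A k : Set (Fin m))) ∧
    (∀ k k', k ≠ k' → Disjoint (A k) (A k')) ∧ Finset.univ.biUnion A = S

/-- `C` is the vertex set of a connected component of `G[S]`. -/
def IsComponentOf {m : ℕ} (G : SimpleGraph (Fin m)) (S C : Finset (Fin m)) : Prop :=
  ∃ c : (G.induce (S : Set (Fin m))).ConnectedComponent,
    (C : Set (Fin m)) = Subtype.val '' c.supp

namespace Problem

variable {n m : ℕ}

/-- The limit of agent `i` when agents `N` and items `M` remain. Being worth at least this much is
the same as being worth at least `α` once `v_i` is scaled to `v_i(M) = |N|`. -/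
noncomputable def limit (I : Problem n m) (α : ℝ) (N : Finset (Fin n)) (M : Finset (Fin m))
    (i : Fin n) : ℝ :=
  α * (I.value i M / N.card)

/-- The limit of the selected agent `i` when the bundle `B` was split off. The valuation is scaled
to `v_i(M \ B) = |N|`, or to `v_i(M) = |N| + 1` if the former makes `v_i(M)` exceed `|N| + 1`; that
is, the smaller of the two scaling factors is used, and so the larger of the two limits. -/
noncomputable def splitLimit (I : Problem n m) (α : ℝ) (N : Finset (Fin n)) (M B : Finset (Fin m))
    (i : Fin n) : ℝ :=
  α * max (I.value i (M \ B) / N.card) (I.value i M / (N.card + 1))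

/-- No remaining item is worth its limit to a remaining agent. -/
def Reduced (I : Problem n m) (α : ℝ) (N : Finset (Fin n)) (M : Finset (Fin m)) : Prop :=
  ∀ i ∈ N, ∀ j ∈ M, I.val i j < I.limit α N M i

/-- `B` consists of one item of least value for `i` from each component of `G[M]` that is not
`l`-colourable. -/
def IsLeastTransversal (I : Problem n m) (l : ℕ) (i : Fin n) (M B : Finset (Fin m)) : Prop :=
  (∀ j ∈ B, ∃ C, IsComponentOf I.graph M C ∧ ¬ ColorableOn I.graph C l ∧ j ∈ C) ∧
    ∀ C, IsComponentOf I.graph M C → ¬ ColorableOn I.graph C l →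
      ∃ j ∈ C, B ∩ C = {j} ∧ ∀ j' ∈ C, I.val i j ≤ I.val i j'

/-- `Run I α N M P Q`: with remaining agents `N`, remaining items `M` and bundles `P` given so far,
the algorithm (before the distribution of the leftover items) can end with the bundles `Q`. -/
inductive Run (I : Problem n m) (α : ℝ) :
    Finset (Fin n) → Finset (Fin m) →
      (Fin n → Finset (Fin m)) → (Fin n → Finset (Fin m)) → Prop
  /-- An item worth its limit to a remaining agent is given to this agent. -/
  | reduce {N : Finset (Fin n)} {M : Finset (Fin m)} {P Q : Fin n → Finset (Fin m)}
      (i : Fin n) (j : Fin m) :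
      i ∈ N → j ∈ M → I.limit α N M i ≤ I.val i j →
      Run I α (N.erase i) (M.erase j) (Function.update P i {j}) Q →
      Run I α N M P Q
  /-- No agent remains. -/
  | done {M : Finset (Fin m)} {P : Fin n → Finset (Fin m)} : Run I α ∅ M P P
  /-- One agent remains: it gets an approximately heaviest independent set. -/
  | single {M : Finset (Fin m)} {P : Fin n → Finset (Fin m)} (i : Fin n) (S : Finset (Fin m)) :
      I.Reduced α {i} M →
      S ⊆ M → I.graph.IsIndepSet (S : Set (Fin m)) →
      (∀ T ⊆ M, I.graph.IsIndepSet (T : Set (Fin m)) → α * I.value i T ≤ I.value i S) →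
      Run I α {i} M P (Function.update P i S)
  /-- `G[M]` is `Δ`-colourable: bag filling on a `Δ`-colouring. -/
  | colorable {N : Finset (Fin n)} {M : Finset (Fin m)} {P Q : Fin n → Finset (Fin m)}
      (A : Fin I.maxDeg → Finset (Fin m)) :
      I.Reduced α N M → 2 ≤ N.card →
      ColorableOn I.graph M I.maxDeg →
      IsColoringOf I.graph M A →
      BagFill I (I.limit α N M) ∅ A N P Q →
      Run I α N M P Q
  /-- `G[M]` is not `Δ`-colourable and at most `Δ` agents remain. For a selected agent `i` a
  bundle `B` is split off and `v_i` is rescaled; an item that is now worth the limit to `i` is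
  given to `i`, and the reduction is resumed. -/
  | splitReduce {N : Finset (Fin n)} {M : Finset (Fin m)} {P Q : Fin n → Finset (Fin m)}
      (i : Fin n) (B : Finset (Fin m)) (j : Fin m) :
      I.Reduced α N M → 2 ≤ N.card → N.card ≤ I.maxDeg →
      ¬ ColorableOn I.graph M I.maxDeg →
      i ∈ N → I.IsLeastTransversal I.maxDeg i M B →
      j ∈ M → I.splitLimit α N M B i ≤ I.val i j →
      Run I α (N.erase i) (M.erase j) (Function.update P i {j}) Q →
      Run I α N M P Q
  /-- As before, but no item is worth the new limit to `i`: bag filling on `B` and a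
  `Δ`-colouring of `G[M \ B]`, where `i` has the lowest priority. -/
  | splitFill {N : Finset (Fin n)} {M : Finset (Fin m)} {P Q : Fin n → Finset (Fin m)}
      (i : Fin n) (B : Finset (Fin m)) (A : Fin I.maxDeg → Finset (Fin m)) :
      I.Reduced α N M → 2 ≤ N.card → N.card ≤ I.maxDeg →
      ¬ ColorableOn I.graph M I.maxDeg →
      i ∈ N → I.IsLeastTransversal I.maxDeg i M B →
      (∀ j ∈ M, I.val i j < I.splitLimit α N M B i) →
      IsColoringOf I.graph (M \ B) A →
      BagFill I (Function.update (I.limit α N M) i (I.splitLimit α N M B i)) {i}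
        (Fin.cons B A : Fin (I.maxDeg + 1) → Finset (Fin m)) N P Q →
      Run I α N M P Q
  /-- `G[M]` is not `Δ`-colourable and more than `Δ` agents remain: bag filling on a
  `(Δ + 1)`-colouring. -/
  | many {N : Finset (Fin n)} {M : Finset (Fin m)} {P Q : Fin n → Finset (Fin m)}
      (A : Fin (I.maxDeg + 1) → Finset (Fin m)) :
      I.Reduced α N M → 2 ≤ N.card → I.maxDeg < N.card →
      ¬ ColorableOn I.graph M I.maxDeg →
      IsColoringOf I.graph M A →
      BagFill I (I.limit α N M) ∅ A N P Q →
      Run I α N M P Q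

/-- `A` is a possible output of the algorithm: the bundles of a run, to which the leftover items
have been added without conflicts. -/
def Output (I : Problem n m) (α : ℝ) (A : Fin m → Fin n) : Prop :=
  ∃ Q : Fin n → Finset (Fin m),
    Run I α Finset.univ Finset.univ (fun _ => ∅) Q ∧ I.Feasible A ∧ ∀ i, Q i ⊆ bundle A i

end Problem

/-- The approximation factor for maximum degree `Δ ≥ 1`. -/
noncomputable def factor (Δ : ℕ) : ℝ :=
  if Δ = 1 then 1 / 2 else if Δ = 2 then 3 / 7 else 2 / ((Δ : ℝ) + 2)

/-! ### Machine model

Programs over binary trees whose leaves are `nil` or real numbers (Jones' WHILE programs, with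
real atoms). The only operations on real numbers are addition, subtraction and comparison, and the
only real constant is `0`. Each elementary operation takes one step; data are shared, never
copied. -/

inductive Val : Type
  | nil : Val
  | num : ℝ → Val
  | cons : Val → Val → Val

namespace Val

def head : Val → Val
  | cons a _ => a
  | _ => nil

def tail : Val → Val
  | cons _ b => b
  | _ => nil

noncomputable def add : Val → Val
  | cons (num x) (num y) => num (x + y)
  | _ => nil

noncomputable def sub : Val → Val
  | cons (num x) (num y) => num (x - y)
  | _ => nil

/-- Booleans: `nil` is false, `cons nil nil` is true. -/
def bool : Bool → Val
  | true => cons nil nil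
  | false => nil

open Classical in
noncomputable def le : Val → Val
  | cons (num x) (num y) => bool (decide (x ≤ y))
  | _ => nil

def list : List Val → Val
  | [] => nil
  | a :: l => cons a (list l)

/-- Natural numbers in unary. -/
def nat (k : ℕ) : Val := list (List.replicate k nil)

end Val

inductive Prog : Type
  /-- return the input -/
  | input : Prog
  /-- the constant `nil` -/
  | nil : Prog
  /-- the real constant `0` -/
  | zero : Prog
  | head : Prog
  | tail : Prog
  | add : Prog
  | sub : Prog
  | le : Prog
  /-- run both programs on the input and pair the results -/
  | cons : Prog → Prog → Prog
  /-- run the first program, then the second one on its result -/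
  | seq : Prog → Prog → Prog
  /-- run the second program on the input if the first one does not return `nil` on it, otherwise
  the third one -/
  | branch : Prog → Prog → Prog → Prog
  /-- as long as the first program does not return `nil` on the current value, replace this value
  by the result of the second program -/
  | loop : Prog → Prog → Prog

/-- `Eval p v w t`: on input `v` the program `p` halts with result `w` after `t` steps. -/
inductive Eval : Prog → Val → Val → ℕ → Prop
  | input (v : Val) : Eval .input v v 1
  | nil (v : Val) : Eval .nil v .nil 1
  | zero (v : Val) : Eval .zero v (.num 0) 1
  | head (v : Val) : Eval .head v v.head 1
  | tail (v : Val) : Eval .tail v v.tail 1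
  | add (v : Val) : Eval .add v v.add 1
  | sub (v : Val) : Eval .sub v v.sub 1
  | le (v : Val) : Eval .le v v.le 1
  | cons {p q : Prog} {v a b : Val} {s t : ℕ} :
      Eval p v a s → Eval q v b t → Eval (.cons p q) v (.cons a b) (s + t + 1)
  | seq {p q : Prog} {u v w : Val} {s t : ℕ} :
      Eval p u v s → Eval q v w t → Eval (.seq p q) u w (s + t + 1)
  | branchTrue {c p q : Prog} {v b w : Val} {s t : ℕ} :
      Eval c v b s → b ≠ .nil → Eval p v w t → Eval (.branch c p q) v w (s + t + 1)
  | branchFalse {c p q : Prog} {v w : Val} {s t : ℕ} :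
      Eval c v .nil s → Eval q v w t → Eval (.branch c p q) v w (s + t + 1)
  | loopStop {c p : Prog} {v : Val} {s : ℕ} :
      Eval c v .nil s → Eval (.loop c p) v v (s + 1)
  | loopStep {c p : Prog} {u b v w : Val} {r s t : ℕ} :
      Eval c u b r → b ≠ .nil → Eval p u v s → Eval (.loop c p) v w t →
      Eval (.loop c p) u w (r + s + t + 1)

open Classical in
/-- An instance is given by the `n × m` matrix of the values and the `m × m` adjacency matrix of
the conflict graph, each as the list of its rows. -/
noncomputable def Problem.encode {n m : ℕ} (I : Problem n m) : Val :=
  .cons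
    (.list (List.ofFn fun i : Fin n => .list (List.ofFn fun j : Fin m => .num (I.val i j))))
    (.list (List.ofFn fun j : Fin m =>
      .list (List.ofFn fun k : Fin m => .bool (decide (I.graph.Adj j k)))))

/-- An allocation is given by the list of the (unary) indices of the agents receiving the items. -/
def encodeAllocation {n m : ℕ} (A : Fin m → Fin n) : Val :=
  .list (List.ofFn fun j => .nat (A j))

end ConflictAlloc

/-! Approximation. Fix an agent `i` and a feasible allocation whose bundles are all worth at least
`μ` to `i`. As long as `i` remains, at least as many of these bundles lie inside the remaining items
as there are remaining agents (`Packed`), because an item that is given away spoils at most one of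
them. With `r` agents left, the remaining items are therefore worth at least `r * μ` to `i`, and the
limit of `i` is at least `α * μ` (`Packed.le_limit`).

When no item reaches the limit of `i`, a bag given to another agent costs `i` at most two limits:
all but the last item were not enough, and the last item alone is not enough. If `i` received
nothing from `l` sources, then the `r - 1` bags and the `l` leftovers, each below one limit, would
exhaust the total with less than `2 * r - 2 + l` limits (`BagFill.value_lt`). This is impossible if
`α * (2 * r - 2 + l) ≤ r`. The cases `l = Δ`, `2 ≤ r` and `l = Δ + 1`, `Δ < r` determine `α`
(`factor_mul_le`, `factor_mul_le'`).

What remains is a graph that is not `Δ`-colourable, with `r ≤ Δ`. Here `r` independent sets cannot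
cover a component that is not `Δ`-colourable. They miss an item in each of them, so removing a least
item from each costs no more than what is missed anyway (`Problem.IsLeastTransversal.value_le`).
Hence the selected agent may be measured on the `Δ` classes outside `B`. For every other agent there
is one source more, but the selected agent only gets a bag that nobody else accepts, and so this bag
costs one limit instead of two.

Polynomial time. One output is defined as an explicit function (`allocate`), which is shown to
follow the rules (`output_allocate`) and is compiled into a program by closure properties of `PT`.
Two subproblems need an idea.

Colouring with `Δ` colours is Brooks' theorem in algorithmic form. Vertices are coloured one by one;
where no colour is free, a maximal path through the vertex is repainted (`PartialColoring.reroute`).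
This succeeds whenever a colouring exists, so checking the result also decides colourability
(`colorableOn_iff_validOn`).

For a single agent, local search splits the items into `Δ / 2 + 1` classes with inner degree at most
one. A heaviest independent set inside a class is then obvious, and the best class is good enough
(`factor_mul_value_le_heavySet`).

Finally, leftover items can be placed because `n > Δ` leaves an agent without a conflicting item
(`distribute_spec`). -/

namespace ConflictAlloc

open Classical Polynomial

/-! ### Polynomial-time functions of an instance and encoded data -/

/-- Instances whose number of agents exceeds the positive maximum degree. -/
structure Inst where
  n : ℕ
  m : ℕ
  I : Problem n m
  deg_pos : 1 ≤ I.maxDeg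
  deg_lt : I.maxDeg < n

/-- Types whose elements are represented by trees. -/
class Enc (α : Type) where
  enc : α → Val

open Enc

instance : Enc Val := ⟨id⟩
instance : Enc Unit := ⟨fun _ => .nil⟩
instance : Enc Bool := ⟨Val.bool⟩
instance : Enc ℕ := ⟨Val.nat⟩
instance : Enc ℝ := ⟨Val.num⟩
-- Indices are unary numbers, and sets below are arrays of truth values. Passing between an index
-- and its value, or between a set and its indicator function, leaves the tree unchanged.
instance {k : ℕ} : Enc (Fin k) := ⟨fun i => .nat i⟩
instance {α β : Type} [Enc α] [Enc β] : Enc (α × β) := ⟨fun p => .cons (enc p.1) (enc p.2)⟩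
instance {α : Type} [Enc α] : Enc (List α) := ⟨fun l => .list (l.map enc)⟩
instance {α : Type} [Enc α] : Enc (Option α) := ⟨fun o => o.elim .nil fun a => .cons (enc a) .nil⟩
instance {α : Type} [Enc α] {k : ℕ} : Enc (Fin k → α) := ⟨fun f => .list (List.ofFn fun i => enc (f i))⟩
noncomputable instance {k : ℕ} : Enc (Finset (Fin k)) :=
  ⟨fun S => .list (List.ofFn fun i => .bool (decide (i ∈ S)))⟩

/-- A single program computes `f` on all instances in polynomial time. -/
def PT {X Y : Inst → Type} [∀ c, Enc (X c)] [∀ c, Enc (Y c)] (f : ∀ c, X c → Y c) : Prop :=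
  ∃ (p : Prog) (q : Polynomial ℕ), ∀ c x, ∃ t,
    Eval p (.cons c.I.encode (enc x)) (enc (f c x)) t ∧ t ≤ q.eval (c.n + c.m)

/-- A single program decides `p` on all instances in polynomial time. -/
def PTp {X : Inst → Type} [∀ c, Enc (X c)] (p : ∀ c, X c → Prop) : Prop :=
  PT (Y := fun _ => Bool) fun c x => @decide (p c x) (propDecidable _)

/-- The quantity is polynomially bounded. -/
def PBound {X : Inst → Type} (k : ∀ c, X c → ℕ) : Prop :=
  ∃ q : Polynomial ℕ, ∀ c x, k c x ≤ q.eval (c.n + c.m)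

section bound

variable {X Y : Inst → Type}

theorem PBound.mono {k l : ∀ c, X c → ℕ} (h : PBound l) (hk : ∀ c x, k c x ≤ l c x) : PBound k := by
  obtain ⟨q, hq⟩ := h
  exact ⟨q, fun c x => (hk c x).trans (hq c x)⟩

theorem PBound.n : PBound (fun c (_ : X c) => c.n) := ⟨.X, fun c x => by simp⟩
theorem PBound.m : PBound (fun c (_ : X c) => c.m) := ⟨.X, fun c x => by simp⟩
theorem PBound.const (k : ℕ) : PBound (fun c (_ : X c) => k) := ⟨C k, fun c x => by simp⟩
theorem PBound.mul {k l : ∀ c, X c → ℕ} (hk : PBound k) (hl : PBound l) :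
    PBound (fun c x => k c x * l c x) := by
  obtain ⟨q, hq⟩ := hk
  obtain ⟨q', hq'⟩ := hl
  exact ⟨q * q', fun c x => by simpa using Nat.mul_le_mul (hq c x) (hq' c x)⟩
theorem PBound.add {k l : ∀ c, X c → ℕ} (hk : PBound k) (hl : PBound l) :
    PBound (fun c x => k c x + l c x) := by
  obtain ⟨q, hq⟩ := hk
  obtain ⟨q', hq'⟩ := hl
  exact ⟨q + q', fun c x => by simpa using Nat.add_le_add (hq c x) (hq' c x)⟩
theorem PBound.comp {k : ∀ c, Y c → ℕ} (hk : PBound k) (f : ∀ c, X c → Y c) :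
    PBound (fun c x => k c (f c x)) := by
  obtain ⟨q, hq⟩ := hk
  exact ⟨q, fun c x => hq c _⟩

end bound

/-! ### Closure properties of polynomial-time functions: control flow, options, lists -/

section basic

variable {X Y Z W : Inst → Type} [∀ c, Enc (X c)] [∀ c, Enc (Y c)] [∀ c, Enc (Z c)] [∀ c, Enc (W c)]

/-- Programs only see trees, so a function may be replaced by one with values in another type as
long as the encodings agree. Conversions between representations are free in this way. -/
theorem PT.congr_enc {f : ∀ c, X c → Y c} {g : ∀ c, X c → Z c} (h : PT f)
    (e : ∀ c x, enc (f c x) = enc (g c x)) : PT g := by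
  obtain ⟨p, q, hp⟩ := h
  exact ⟨p, q, fun c x => e c x ▸ hp c x⟩

theorem PT.congr {f g : ∀ c, X c → Y c} (h : PT f) (e : ∀ c x, f c x = g c x) : PT g :=
  h.congr_enc fun c x => by rw [e]

theorem PTp.congr {f g : ∀ c, X c → Prop} (h : PTp f) (e : ∀ c x, f c x ↔ g c x) : PTp g :=
  PT.congr_enc h fun c x => by simp only [e c x]

theorem PT.id : PT (fun c (x : X c) => x) :=
  ⟨.tail, 1, fun _ _ => ⟨1, Eval.tail _, by simp⟩⟩

/-- A program applied to the environment of a polynomial-time function. -/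
theorem PT.of_env {f : ∀ c, X c → Y c} (p : Prog) (k : ℕ)
    (h : ∀ c x, ∃ t ≤ k, Eval p (.cons c.I.encode (enc x)) (enc (f c x)) t) : PT f :=
  ⟨p, C k, fun c x => by obtain ⟨t, ht, h⟩ := h c x; exact ⟨t, h, by simpa using ht⟩⟩

theorem PT.seq {f : ∀ c, X c → Y c} {g : ∀ c, X c → Z c} (hf : PT f) (p : Prog) (k : ℕ)
    (h : ∀ c x, ∃ t ≤ k, Eval p (enc (f c x)) (enc (g c x)) t) : PT g := by
  obtain ⟨pf, q, hp⟩ := hf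
  refine ⟨.seq pf p, q + C (k + 1), fun c x => ?_⟩
  obtain ⟨t, ht, hq⟩ := hp c x
  obtain ⟨s, hs, he⟩ := h c x
  exact ⟨_, .seq ht he, by simp only [eval_add, eval_C]; omega⟩

/-- The time bound in `PT` depends on the instance only and holds for every argument, so bounds
simply add up and no size of an intermediate result has to be controlled. The instance is passed on
next to the argument; this is cheap because data are shared. -/
theorem PT.comp {g : ∀ c, Y c → Z c} {f : ∀ c, X c → Y c} (hg : PT g) (hf : PT f) :
    PT (fun c x => g c (f c x)) := by
  obtain ⟨p, q, hp⟩ := hg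
  obtain ⟨p', q', hp'⟩ := hf
  refine ⟨.seq (.cons .head p') p, q + q' + 3, fun c x => ?_⟩
  obtain ⟨t, ht, hq⟩ := hp c (f c x)
  obtain ⟨t', ht', hq'⟩ := hp' c x
  refine ⟨_, .seq (.cons (.head _) ht') ht, ?_⟩
  simp only [eval_add, eval_ofNat]; omega

theorem PTp.comp {g : ∀ c, Y c → Prop} {f : ∀ c, X c → Y c} (hg : PTp g) (hf : PT f) :
    PTp (fun c x => g c (f c x)) := PT.comp hg hf

theorem PT.pair {f : ∀ c, X c → Y c} {g : ∀ c, X c → Z c} (hf : PT f) (hg : PT g) :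
    PT (fun c x => (f c x, g c x)) := by
  obtain ⟨p, q, hp⟩ := hf
  obtain ⟨p', q', hp'⟩ := hg
  refine ⟨.cons p p', q + q' + 1, fun c x => ?_⟩
  obtain ⟨t, ht, hq⟩ := hp c x
  obtain ⟨t', ht', hq'⟩ := hp' c x
  refine ⟨_, .cons ht ht', ?_⟩
  simp only [eval_add, eval_one]; omega

theorem PT.fst {f : ∀ c, X c → Y c × Z c} (hf : PT f) : PT (fun c x => (f c x).1) :=
  hf.seq .head 1 fun _ _ => ⟨1, le_rfl, .head _⟩

theorem PT.snd {f : ∀ c, X c → Y c × Z c} (hf : PT f) : PT (fun c x => (f c x).2) :=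
  hf.seq .tail 1 fun _ _ => ⟨1, le_rfl, .tail _⟩

theorem PT.ite {p : ∀ c, X c → Prop} [∀ c x, Decidable (p c x)] {f g : ∀ c, X c → Y c}
    (hp : PTp p) (hf : PT f) (hg : PT g) : PT (fun c x => if p c x then f c x else g c x) := by
  obtain ⟨r, q, hr⟩ := hp
  obtain ⟨r₁, q₁, h₁⟩ := hf
  obtain ⟨r₂, q₂, h₂⟩ := hg
  refine ⟨.branch r r₁ r₂, q + q₁ + q₂ + 1, fun c x => ?_⟩
  obtain ⟨t, ht, hq⟩ := hr c x
  obtain ⟨t₁, ht₁, hq₁⟩ := h₁ c x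
  obtain ⟨t₂, ht₂, hq₂⟩ := h₂ c x
  by_cases h : p c x
  · simp only [h, if_true]
    refine ⟨_, .branchTrue ht ?_ ht₁, ?_⟩
    · simp [h, enc, Val.bool]
    · simp only [eval_add, eval_one]; omega
  · simp only [h, if_false]
    have : enc (@decide (p c x) (propDecidable _)) = Val.nil := by simp [h, enc, Val.bool]
    rw [this] at ht
    refine ⟨_, .branchFalse ht ht₂, ?_⟩
    simp only [eval_add, eval_one]; omega

theorem PT.mkTrue : PT (Y := fun _ => Bool) (fun c (_ : X c) => true) :=
  PT.of_env (.cons .nil .nil) 3 fun _ _ => ⟨3, le_rfl, .cons (.nil _) (.nil _)⟩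

theorem PT.mkFalse : PT (Y := fun _ => Bool) (fun c (_ : X c) => false) :=
  PT.of_env .nil 1 fun _ _ => ⟨1, le_rfl, .nil _⟩

theorem PTp.toBool {p : ∀ c, X c → Prop} [∀ c x, Decidable (p c x)] (h : PTp p) :
    PT (Y := fun _ => Bool) (fun c x => Decidable.decide (p c x)) :=
  PT.congr h fun c x => by simp

theorem PTp.of_decide {p : ∀ c, X c → Prop} [∀ c x, Decidable (p c x)]
    (h : PT (Y := fun _ => Bool) (fun c x => Decidable.decide (p c x))) : PTp p :=
  PT.congr h fun c x => by simp

theorem PTp.of_bool {f : ∀ c, X c → Bool} (h : PT f) : PTp (fun c x => f c x = Bool.true) :=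
  PT.congr h fun c x => by simp

theorem PTp.ite {p f g : ∀ c, X c → Prop} [∀ c x, Decidable (p c x)]
    (hp : PTp p) (hf : PTp f) (hg : PTp g) : PTp (fun c x => if p c x then f c x else g c x) :=
  PT.congr (PT.ite hp hf hg) fun c x => by split_ifs <;> simp_all

theorem PTp.trivial : PTp (fun c (_ : X c) => True) := PT.mkTrue.congr fun c x => by simp
theorem PTp.absurd : PTp (fun c (_ : X c) => False) := PT.mkFalse.congr fun c x => by simp

theorem PTp.not {p : ∀ c, X c → Prop} (hp : PTp p) : PTp (fun c x => ¬ p c x) :=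
  (PTp.ite hp PTp.absurd PTp.trivial).congr fun c x => by split_ifs <;> simp_all

theorem PTp.and {p q : ∀ c, X c → Prop} (hp : PTp p) (hq : PTp q) :
    PTp (fun c x => p c x ∧ q c x) :=
  (PTp.ite hp hq PTp.absurd).congr fun c x => by split_ifs <;> simp_all

theorem PTp.or {p q : ∀ c, X c → Prop} (hp : PTp p) (hq : PTp q) :
    PTp (fun c x => p c x ∨ q c x) :=
  (PTp.ite hp PTp.trivial hq).congr fun c x => by split_ifs <;> simp_all

theorem PTp.imp {p q : ∀ c, X c → Prop} (hp : PTp p) (hq : PTp q) :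
    PTp (fun c x => p c x → q c x) :=
  (PTp.ite hp hq PTp.trivial).congr fun c x => by split_ifs <;> simp_all

theorem PT.mkNone : PT (fun c (_ : X c) => (none : Option (Y c))) :=
  PT.of_env .nil 1 fun _ _ => ⟨1, le_rfl, .nil _⟩

theorem PT.mkSome {f : ∀ c, X c → Y c} (h : PT f) : PT (fun c x => some (f c x)) :=
  h.seq (.cons .input .nil) 3 fun _ _ => ⟨3, le_rfl, .cons (.input _) (.nil _)⟩

theorem PTp.isNone {f : ∀ c, X c → Option (Y c)} (h : PT f) : PTp (fun c x => f c x = Option.none) := by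
  refine PT.seq h (.branch .input .nil (.cons .nil .nil)) 5 fun c x => ?_
  rcases hx : f c x with _ | y
  · exact ⟨1 + 3 + 1, by norm_num, by
      simpa [enc, hx, Val.bool] using
        Eval.branchFalse (c := .input) (p := .nil) (.input .nil) (.cons (.nil .nil) (.nil .nil))⟩
  · exact ⟨1 + 1 + 1, by norm_num, by
      simpa [enc, hx, Val.bool] using
        Eval.branchTrue (c := .input) (q := .cons .nil .nil) (v := .cons (enc y) .nil)
          (.input _) (by simp) (.nil _)⟩

theorem PT.elim {f : ∀ c, X c → Option (Y c)} {g : ∀ c, X c → Z c} {h : ∀ c, X c → Y c → Z c}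
    (hf : PT f) (hg : PT g) (hh : PT fun c (p : X c × Y c) => h c p.1 p.2) :
    PT (fun c x => (f c x).elim (g c x) (h c x)) := by
  obtain ⟨r, q, hr⟩ := hf
  obtain ⟨r₁, q₁, h₁⟩ := hg
  obtain ⟨r₂, q₂, h₂⟩ := hh
  -- A branch discards the value it tests. In the case of `some y`, `r` is run again to obtain `y`,
  -- which is why `q` appears twice.
  refine ⟨.branch r (.seq (.cons .head (.cons .tail (.seq r .head))) r₂) r₁, q + q₁ + q₂ + q + 10,
    fun c x => ?_⟩
  obtain ⟨t, ht, hq⟩ := hr c x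
  obtain ⟨t₁, ht₁, hq₁⟩ := h₁ c x
  rcases hx : f c x with _ | y <;> simp only [hx, Option.elim]
  · rw [hx] at ht
    refine ⟨_, .branchFalse ht ht₁, ?_⟩
    simp only [eval_add, eval_ofNat]; omega
  · rw [hx] at ht
    obtain ⟨t₂, ht₂, hq₂⟩ := h₂ c (x, y)
    refine ⟨_, .branchTrue ht (by simp [enc])
      (.seq (.cons (.head _) (.cons (.tail _) (.seq ht (.head (.cons _ _))))) ht₂), ?_⟩
    simp only [eval_add, eval_ofNat]; omega

theorem PT.getD {f : ∀ c, X c → Option (Y c)} {g : ∀ c, X c → Y c} (hf : PT f) (hg : PT g) :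
    PT (fun c x => (f c x).getD (g c x)) :=
  (PT.elim hf hg (h := fun c _ y => y) PT.id.snd).congr fun c x => by cases f c x <;> rfl

theorem PT.nil : PT (fun c (_ : X c) => ([] : List (Y c))) :=
  PT.of_env .nil 1 fun _ _ => ⟨1, le_rfl, .nil _⟩

theorem PT.cons {f : ∀ c, X c → Y c} {g : ∀ c, X c → List (Y c)} (hf : PT f) (hg : PT g) :
    PT (fun c x => f c x :: g c x) :=
  (hf.pair hg).congr_enc fun c x => by simp [enc, Val.list]

theorem PT.list_tail {f : ∀ c, X c → List (Y c)} (hf : PT f) : PT (fun c x => (f c x).tail) := by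
  refine hf.seq .tail 1 fun c x => ⟨1, le_rfl, ?_⟩
  cases f c x <;> exact Eval.tail _

theorem PT.list_headD {f : ∀ c, X c → List (Y c)} {g : ∀ c, X c → Y c} (hf : PT f) (hg : PT g) :
    PT (fun c x => (f c x).headD (g c x)) := by
  obtain ⟨r, q, hr⟩ := hf
  obtain ⟨r₁, q₁, h₁⟩ := hg
  refine ⟨.branch r (.seq r .head) r₁, q + q₁ + q + 10, fun c x => ?_⟩
  obtain ⟨t, ht, hq⟩ := hr c x
  obtain ⟨t₁, ht₁, hq₁⟩ := h₁ c x
  rcases hx : f c x with _ | ⟨y, l⟩ <;> simp only [hx, List.headD]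
  · rw [hx] at ht
    refine ⟨_, .branchFalse ht ht₁, ?_⟩
    simp only [eval_add, eval_ofNat]; omega
  · rw [hx] at ht
    refine ⟨_, .branchTrue ht (by simp [enc, Val.list]) (.seq ht (.head (.cons _ _))), ?_⟩
    simp only [eval_add, eval_ofNat]; omega

/-- The only use of a machine loop; every other iteration is reduced to it. The length of the list
has to be bounded separately, since the type does not bound it. -/
theorem PT.foldl {f : ∀ c, X c → List (Y c)} {b : ∀ c, X c → Z c} {g : ∀ c, X c → Z c → Y c → Z c}
    (hf : PT f) (hb : PT b) (hg : PT fun c (p : X c × Y c × Z c) => g c p.1 p.2.2 p.2.1)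
    (hl : PBound fun c x => (f c x).length) :
    PT (fun c x => (f c x).foldl (g c x) (b c x)) := by
  obtain ⟨pf, qf, hpf⟩ := hf
  obtain ⟨pb, qb, hpb⟩ := hb
  obtain ⟨pg, qg, hpg⟩ := hg
  obtain ⟨ql, hql⟩ := hl
  -- The loop state is `((instance, x), (rest, z))`. One pass drops the head `y` of `rest` and runs
  -- `pg` on `(instance, (x, (y, z)))`. The rearrangement is covered by the constant `40` in the
  -- bound below.
  let body : Prog := .cons .head (.cons (.seq (.seq .tail .head) .tail)
    (.seq (.cons (.seq .head .head) (.cons (.seq .head .tail)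
      (.cons (.seq (.seq .tail .head) .head) (.seq .tail .tail)))) pg))
  have key : ∀ (c : Inst) (x : X c) (l : List (Y c)) (z : Z c), ∃ t,
      Eval (.loop (.seq .tail .head) body)
        (.cons (.cons c.I.encode (enc x)) (.cons (enc l) (enc z)))
        (.cons (.cons c.I.encode (enc x)) (.cons .nil (enc (l.foldl (g c x) z)))) t ∧
      t ≤ l.length * (qg.eval (c.n + c.m) + 40) + 4 := by
    intro c x l
    induction l with
    | nil => exact fun z => ⟨3 + 1, .loopStop (.seq (.tail _) (.head _)), by simp⟩
    | cons y l ih =>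
      intro z
      obtain ⟨t, ht, hq⟩ := ih (g c x z y)
      obtain ⟨s, hs, hq'⟩ := hpg c (x, y, z)
      have hcond : Eval (.seq .tail .head) (.cons (.cons c.I.encode (enc x)) (.cons (enc (y :: l)) (enc z)))
          (.cons (enc y) (enc l)) 3 := .seq (.tail _) (.head _)
      refine ⟨_, .loopStep hcond (by simp) (.cons (.head _) (.cons (.seq (.seq (.tail _) (.head _)) (.tail _))
        (.seq (.cons (.seq (.head _) (.head _)) (.cons (.seq (.head _) (.tail _))
          (.cons (.seq (.seq (.tail _) (.head _)) (.head _)) (.seq (.tail _) (.tail _))))) hs))) ht, ?_⟩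
      simp only [List.length_cons, Nat.add_mul]
      omega
  refine ⟨.seq (.cons .input (.cons pf pb)) (.seq (.loop (.seq .tail .head) body) (.seq .tail .tail)),
    qf + qb + ql * (qg + 40) + 20, fun c x => ?_⟩
  obtain ⟨t, ht, hq⟩ := hpf c x
  obtain ⟨t₁, ht₁, hq₁⟩ := hpb c x
  obtain ⟨t₂, ht₂, hq₂⟩ := key c x (f c x) (b c x)
  refine ⟨_, .seq (.cons (.input _) (.cons ht ht₁)) (.seq ht₂ (.seq (.tail _) (.tail _))), ?_⟩
  have := Nat.mul_le_mul_right (qg.eval (c.n + c.m) + 40) (hql c x)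
  simp only [eval_add, eval_mul, eval_ofNat] at this ⊢
  omega

theorem PT.reverse {f : ∀ c, X c → List (Y c)} (hf : PT f) (hl : PBound fun c x => (f c x).length) :
    PT (fun c x => (f c x).reverse) :=
  (PT.foldl hf PT.nil (g := fun c _ l y => y :: l) (PT.cons PT.id.snd.fst PT.id.snd.snd) hl).congr
    fun c x => by rw [List.foldl_flip_cons_eq_append']; simp

theorem PT.foldr {f : ∀ c, X c → List (Y c)} {b : ∀ c, X c → Z c} {g : ∀ c, X c → Y c → Z c → Z c}
    (hf : PT f) (hb : PT b) (hg : PT fun c (p : X c × Y c × Z c) => g c p.1 p.2.1 p.2.2)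
    (hl : PBound fun c x => (f c x).length) :
    PT (fun c x => (f c x).foldr (g c x) (b c x)) :=
  (PT.foldl (g := fun c x z y => g c x y z) (hf.reverse hl) hb hg
    (hl.mono fun c x => by simp)).congr fun c x => by rw [List.foldl_reverse]

theorem PT.append {f g : ∀ c, X c → List (Y c)} (hf : PT f) (hg : PT g)
    (hl : PBound fun c x => (f c x).length) : PT (fun c x => f c x ++ g c x) :=
  (PT.foldr hf hg (g := fun c _ y l => y :: l) (PT.cons PT.id.snd.fst PT.id.snd.snd) hl).congr
    fun c x => by simp

theorem PT.map {f : ∀ c, X c → List (Y c)} {g : ∀ c, X c → Y c → Z c} (hf : PT f)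
    (hg : PT fun c (p : X c × Y c) => g c p.1 p.2) (hl : PBound fun c x => (f c x).length) :
    PT (fun c x => (f c x).map (g c x)) :=
  (PT.foldr hf PT.nil (g := fun c x y l => g c x y :: l)
    (PT.cons (hg.comp (PT.id.fst.pair PT.id.snd.fst)) PT.id.snd.snd) hl).congr
    fun c x => by rw [List.map_eq_foldr]

theorem List.takeWhile_eq_foldr {α : Type*} (p : α → Bool) (l : List α) :
    l.takeWhile p = l.foldr (fun a r => if p a then a :: r else []) [] := by
  induction l with
  | nil => rfl
  | cons a l ih => simp only [List.foldr_cons, ← ih, List.takeWhile_cons]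

/-- The list itself is carried along, because at an element that fails the test the answer is the
whole suffix, which the answer for the tail does not determine. -/
theorem List.dropWhile_eq_foldr {α : Type*} (p : α → Bool) (l : List α) :
    (l, l.dropWhile p) = l.foldr (fun a r => (a :: r.1, if p a then r.2 else a :: r.1)) ([], []) := by
  induction l with
  | nil => rfl
  | cons a l ih => simp only [List.foldr_cons, ← ih, List.dropWhile_cons]

theorem PT.takeWhile {f : ∀ c, X c → List (Y c)} {p : ∀ c, X c → Y c → Prop}
    [∀ c x y, Decidable (p c x y)] (hf : PT f)
    (hp : PTp fun c (q : X c × Y c) => p c q.1 q.2) (hl : PBound fun c x => (f c x).length) :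
    PT (fun c x => (f c x).takeWhile fun y => decide (p c x y)) :=
  (PT.foldr hf PT.nil (g := fun c x y l => if p c x y then y :: l else [])
    (PT.ite (hp.comp (PT.id.fst.pair PT.id.snd.fst)) (PT.cons PT.id.snd.fst PT.id.snd.snd) PT.nil) hl).congr
    fun c x => by rw [List.takeWhile_eq_foldr]; simp

theorem PT.dropWhile {f : ∀ c, X c → List (Y c)} {p : ∀ c, X c → Y c → Prop}
    [∀ c x y, Decidable (p c x y)] (hf : PT f)
    (hp : PTp fun c (q : X c × Y c) => p c q.1 q.2) (hl : PBound fun c x => (f c x).length) :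
    PT (fun c x => (f c x).dropWhile fun y => decide (p c x y)) :=
  (PT.foldr (Z := fun c => List (Y c) × List (Y c)) hf (PT.nil.pair PT.nil)
    (g := fun c x y l => (y :: l.1, if p c x y then l.2 else y :: l.1))
    (PT.pair (PT.cons PT.id.snd.fst PT.id.snd.snd.fst)
      (PT.ite (hp.comp (PT.id.fst.pair PT.id.snd.fst)) PT.id.snd.snd.snd
        (PT.cons PT.id.snd.fst PT.id.snd.snd.fst))) hl).snd.congr
    fun c x => by
      have := List.dropWhile_eq_foldr (fun y => decide (p c x y)) (f c x)
      simp only [decide_eq_true_eq] at this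
      rw [← this]

end basic

end ConflictAlloc

namespace ConflictAlloc

open Classical Polynomial Enc

section basic

variable {X Y : Inst → Type} [∀ c, Enc (X c)] [∀ c, Enc (Y c)]

/-! ### Natural numbers, indices and arrays -/

theorem PT.natZero : PT (fun c (_ : X c) => 0) :=
  PT.of_env .nil 1 fun _ _ => ⟨1, le_rfl, .nil _⟩

theorem PT.natSucc {f : ∀ c, X c → ℕ} (hf : PT f) : PT (fun c x => f c x + 1) :=
  hf.seq (.cons .nil .input) 3 fun _ _ => ⟨3, le_rfl, .cons (.nil _) (.input _)⟩

theorem PT.natPred {f : ∀ c, X c → ℕ} (hf : PT f) : PT (fun c x => f c x - 1) := by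
  refine hf.seq .tail 1 fun c x => ⟨1, le_rfl, ?_⟩
  cases f c x <;> exact Eval.tail _

theorem PT.units {f : ∀ c, X c → ℕ} (hf : PT f) : PT (fun c x => List.replicate (f c x) ()) :=
  hf.congr_enc fun c x => by simp [enc, Val.nat]

theorem foldl_units {α : Type*} (f : α → α) (k : ℕ) (a : α) :
    (List.replicate k ()).foldl (fun a _ => f a) a = f^[k] a := by
  induction k generalizing a with
  | zero => rfl
  | succ k ih => rw [List.replicate_succ, List.foldl_cons, ih, Function.iterate_succ_apply]

theorem PT.iterate {k : ∀ c, X c → ℕ} {f : ∀ c, X c → Y c} {g : ∀ c, X c → Y c → Y c}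
    (hk : PT k) (hf : PT f) (hg : PT fun c (p : X c × Y c) => g c p.1 p.2) (hl : PBound k) :
    PT (fun c x => (g c x)^[k c x] (f c x)) :=
  (PT.foldl (PT.units hk) hf (g := fun c x y _ => g c x y)
    (hg.comp (PT.id.fst.pair PT.id.snd.snd)) (hl.mono fun c x => by simp)).congr
    fun c x => foldl_units _ _ _

theorem PT.natSub {f g : ∀ c, X c → ℕ} (hf : PT f) (hg : PT g) (hl : PBound g) :
    PT (fun c x => f c x - g c x) :=
  (PT.iterate hg hf (g := fun c x k => k - 1) (PT.natPred PT.id.snd) hl).congr fun c x => by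
    generalize g c x = k
    generalize f c x = l
    induction k generalizing l with
    | zero => rfl
    | succ k ih => rw [Function.iterate_succ_apply, ih]; omega

theorem PT.natAdd {f g : ∀ c, X c → ℕ} (hf : PT f) (hg : PT g) (hl : PBound g) :
    PT (fun c x => f c x + g c x) :=
  (PT.iterate hg hf (g := fun c x k => k + 1) (PT.natSucc PT.id.snd) hl).congr fun c x => by
    simp

theorem PTp.natEqZero {f : ∀ c, X c → ℕ} (hf : PT f) : PTp (fun c x => f c x = 0) := by
  refine PT.seq hf (.branch .input .nil (.cons .nil .nil)) 5 fun c x => ?_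
  rcases hx : f c x with _ | y
  · exact ⟨1 + 3 + 1, by norm_num, by
      simpa [enc, hx, Val.bool, Val.nat, Val.list] using
        Eval.branchFalse (c := .input) (p := .nil) (.input .nil) (.cons (.nil .nil) (.nil .nil))⟩
  · have h : Val.nat (y + 1) = Val.cons .nil (.nat y) := rfl
    exact ⟨1 + 1 + 1, by norm_num, by
      simpa [hx, h, enc, Val.bool] using
        Eval.branchTrue (c := .input) (q := .cons .nil .nil) (v := .cons .nil (.nat y))
          (.input _) (by simp) (.nil _)⟩

theorem PTp.natLe {f g : ∀ c, X c → ℕ} (hf : PT f) (hg : PT g) (hl : PBound g) :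
    PTp (fun c x => f c x ≤ g c x) :=
  (PTp.natEqZero (PT.natSub hf hg hl)).congr fun _ _ => Nat.sub_eq_zero_iff_le

theorem PTp.natLt {f g : ∀ c, X c → ℕ} (hf : PT f) (hg : PT g) (hl : PBound g) :
    PTp (fun c x => f c x < g c x) :=
  PTp.natLe (PT.natSucc hf) hg hl

theorem PT.valRows : PT (Y := fun _ => List Val) (fun c (_ : X c) =>
    List.ofFn fun i : Fin c.n => Val.list (List.ofFn fun j : Fin c.m => .num (c.I.val i j))) :=
  PT.of_env (.seq .head .head) 3 fun c x => ⟨3, le_rfl, by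
    simpa [enc, Problem.encode, Function.comp_def, Val.head, Val.tail] using Eval.seq (.head (.cons c.I.encode _)) (.head _)⟩

theorem PT.adjRows : PT (Y := fun _ => List Val) (fun c (_ : X c) =>
    List.ofFn fun j : Fin c.m =>
      Val.list (List.ofFn fun k : Fin c.m => .bool (decide (c.I.graph.Adj j k)))) :=
  PT.of_env (.seq .head .tail) 3 fun c x => ⟨3, le_rfl, by
    simpa [enc, Problem.encode, Function.comp_def, Val.head, Val.tail] using Eval.seq (.head (.cons c.I.encode _)) (.tail _)⟩

/-- The indices below the length of a computable list can be enumerated. -/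
theorem PT.finRange_length {k : Inst → ℕ} {f : ∀ c, X c → List (Y c)} (hf : PT f)
    (h : ∀ c x, (f c x).length = k c) (hb : PBound fun c (_ : X c) => k c) :
    PT (fun c (_ : X c) => List.finRange (k c)) := by
  -- The entries of the list are ignored; it only drives a counter whose successive values are
  -- pushed, so the indices come out in reverse order.
  have h1 : PT (Y := fun _ => ℕ × List ℕ) (fun c x => (f c x).foldl (fun s _ => (s.1 + 1, s.1 :: s.2)) (0, [])) :=
    PT.foldl hf (g := fun c _ s _ => (s.1 + 1, s.1 :: s.2)) (PT.natZero.pair PT.nil)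
      (PT.pair (PT.natSucc PT.id.snd.snd.fst) (PT.cons PT.id.snd.snd.fst PT.id.snd.snd.snd))
      (hb.mono fun c x => (h c x).le)
  have key : ∀ {α : Type} (l : List α) (s : ℕ × List ℕ),
      l.foldl (fun s _ => (s.1 + 1, s.1 :: s.2)) s =
        (s.1 + l.length, (List.range' s.1 l.length).reverse ++ s.2) := by
    intro α l
    induction l with
    | nil => simp
    | cons a l ih =>
      intro s
      rw [List.foldl_cons, ih]
      simp [List.range'_succ]
      omega
  refine (PT.reverse h1.snd ?_).congr_enc fun c x => ?_
  · exact hb.mono fun c x => by simp [key, h]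
  · simp only [key, h, List.append_nil, List.reverse_reverse, zero_add, ← List.range_eq_range']
    simp only [enc, ← List.map_coe_finRange_eq_range, List.map_map, Function.comp_def]

/-- Index families whose elements can be enumerated. -/
class Idx (k : Inst → ℕ) : Prop where
  pt : PT (X := fun _ => Unit) (fun c _ => List.finRange (k c))
  bound : PBound (X := fun _ => Unit) (fun c _ => k c)

instance : Idx Inst.n where
  pt := PT.finRange_length PT.valRows (fun c _ => by simp) PBound.n
  bound := PBound.n

instance : Idx Inst.m where
  pt := PT.finRange_length PT.adjRows (fun c _ => by simp) PBound.m
  bound := PBound.m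

theorem PT.unit : PT (fun c (_ : X c) => ()) :=
  PT.of_env .nil 1 fun _ _ => ⟨1, le_rfl, .nil _⟩

theorem PT.finVal {k : Inst → ℕ} {f : ∀ c, X c → Fin (k c)} (hf : PT f) : PT (fun c x => (f c x).val) :=
  hf.congr_enc fun _ _ => rfl

end basic

section bound

variable {X : Inst → Type} {k : Inst → ℕ} [Idx k]

theorem PBound.idx : PBound (fun c (_ : X c) => k c) := (Idx.bound (k := k)).comp fun _ _ => ()

theorem PBound.finRange : PBound (fun c (_ : X c) => (List.finRange (k c)).length) :=
  (PBound.idx (k := k)).mono fun c x => by simp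

theorem PBound.fin {f : ∀ c, X c → Fin (k c)} : PBound (fun c x => (f c x).val) :=
  PBound.idx.mono fun c x => (f c x).2.le

theorem PBound.card {S : ∀ c, X c → Finset (Fin (k c))} : PBound (fun c x => (S c x).card) :=
  PBound.idx.mono fun c x => by simpa using Finset.card_le_univ (S c x)

end bound

section arrays

variable {X Y : Inst → Type} [∀ c, Enc (X c)] [∀ c, Enc (Y c)] {k : Inst → ℕ} [Idx k]

theorem PT.finRange : PT (fun c (_ : X c) => List.finRange (k c)) := (Idx.pt (k := k)).comp PT.unit

theorem PTp.finLe {f g : ∀ c, X c → Fin (k c)} (hf : PT f) (hg : PT g) :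
    PTp (fun c x => f c x ≤ g c x) := PTp.natLe hf.finVal hg.finVal PBound.fin

theorem PTp.finEq {f g : ∀ c, X c → Fin (k c)} (hf : PT f) (hg : PT g) :
    PTp (fun c x => f c x = g c x) :=
  ((PTp.finLe hf hg).and (PTp.finLe hg hf)).congr fun _ _ => le_antisymm_iff.symm

/-- Bounded quantifiers are folds over the indices. The bound variable is appended to the
environment on the right, so in applications `PT.id.snd` is the innermost variable and each `.fst`
passes one binder. -/
theorem PTp.exists_fin {p : ∀ c, X c → Fin (k c) → Prop}
    (hp : PTp fun c (q : X c × Fin (k c)) => p c q.1 q.2) : PTp (fun c x => ∃ j, p c x j) := by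
  refine (PTp.of_bool (PT.foldr (Z := fun _ => Bool) PT.finRange PT.mkFalse
    (g := fun c x j b => decide (p c x j ∨ b = true))
    ((hp.comp (PT.id.fst.pair PT.id.snd.fst)).or (PTp.of_bool PT.id.snd.snd)).toBool
    PBound.finRange)).congr fun c x => ?_
  have : ∀ l : List (Fin (k c)), l.foldr (fun j b => decide (p c x j ∨ b = true)) false = true ↔
      ∃ j ∈ l, p c x j := by
    intro l
    induction l with
    | nil => simp
    | cons a l ih => simp only [List.foldr_cons, decide_eq_true_eq, ih]; simp
  rw [this]; simp

theorem PTp.forall_fin {p : ∀ c, X c → Fin (k c) → Prop}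
    (hp : PTp fun c (q : X c × Fin (k c)) => p c q.1 q.2) : PTp (fun c x => ∀ j, p c x j) :=
  (PTp.exists_fin (p := fun c x j => ¬ p c x j) hp.not).not.congr fun c x => by simp

/-- The first index with a property. -/
noncomputable def first {l : ℕ} (p : Fin l → Prop) : Option (Fin l) :=
  (List.finRange l).find? fun j => decide (p j)

theorem first_some {l : ℕ} {p : Fin l → Prop} {j : Fin l} (h : first p = some j) : p j := by
  simpa using List.find?_some h

theorem first_eq_none {l : ℕ} {p : Fin l → Prop} : first p = none ↔ ∀ j, ¬ p j := by
  simp [first]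

theorem exists_first {l : ℕ} {p : Fin l → Prop} (h : ∃ j, p j) : ∃ j, first p = some j ∧ p j := by
  rcases hj : first p with _ | j
  · exact absurd h (by simpa using first_eq_none.1 hj)
  · exact ⟨j, rfl, first_some hj⟩

theorem PT.firstFin {p : ∀ c, X c → Fin (k c) → Prop}
    (hp : PTp fun c (q : X c × Fin (k c)) => p c q.1 q.2) : PT (fun c x => first (p c x)) := by
  refine (PT.foldr PT.finRange PT.mkNone (g := fun c x j r => if p c x j then some j else r)
    (PT.ite (hp.comp (PT.id.fst.pair PT.id.snd.fst)) (PT.mkSome PT.id.snd.fst) PT.id.snd.snd)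
    PBound.finRange).congr fun c x => ?_
  unfold ConflictAlloc.first
  induction List.finRange (k c) with
  | nil => rfl
  | cons a l ih => rw [List.foldr_cons, ih, List.find?_cons]; split_ifs with h <;> simp [h]

theorem PTp.someEq {f : ∀ c, X c → Option (Fin (k c))} {g : ∀ c, X c → Fin (k c)} (hf : PT f) (hg : PT g) :
    PTp (fun c x => f c x = some (g c x)) :=
  PT.congr (PT.elim (Z := fun _ => Bool) hf PT.mkFalse (h := fun c x y => decide (y = g c x))
    (PTp.finEq PT.id.snd (hg.comp PT.id.fst)).toBool) fun c x => by
    rcases h : f c x <;> simp [h]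

theorem PT.tabulate {g : ∀ c, X c → Fin (k c) → Y c}
    (hg : PT fun c (q : X c × Fin (k c)) => g c q.1 q.2) : PT (fun c x => (fun j => g c x j)) :=
  (PT.map PT.finRange hg PBound.finRange).congr_enc fun c x => by
    simp [enc, List.ofFn_eq_map, Function.comp_def]

theorem list_drop_head (l : List Val) (i : ℕ) (h : i < l.length) :
    (Val.tail^[i] (Val.list l)).head = l[i] := by
  induction i generalizing l with
  | zero => cases l with
    | nil => simp at h
    | cons a l => rfl
  | succ i ih => cases l with
    | nil => simp at h
    | cons a l =>
      rw [Function.iterate_succ_apply]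
      simpa [Val.tail, Val.list] using ih l (by simpa using h)

/-- Random access by taking tails as often as the unary index says; this is affordable because the
index is polynomially bounded. -/
theorem PT.getElem {l : ∀ c, X c → List Val} {f : ∀ c, X c → Fin (k c)} {g : ∀ c, X c → Y c} (hl : PT l) (hf : PT f)
    (h : ∀ c x, (l c x)[(f c x).val]? = some (enc (g c x))) :
    PT g := by
  have h1 : PT (Y := fun _ => Val) (fun c x => Val.tail^[(f c x).val] (Val.list (l c x))) :=
    PT.iterate (g := fun c x v => Val.tail v) hf.finVal (hl.congr_enc fun c x => by simp [enc])
      (PT.id.snd.seq .tail 1 fun c x => ⟨1, le_rfl, .tail _⟩) PBound.fin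
  refine (h1.seq (g := fun c x => (Val.tail^[(f c x).val] (Val.list (l c x))).head) .head 1
    fun c x => ⟨1, le_rfl, .head _⟩).congr_enc fun c x => ?_
  obtain ⟨h2, h3⟩ := List.getElem?_eq_some_iff.1 (h c x)
  rw [list_drop_head _ _ h2, h3]
  rfl

theorem PT.app {F : ∀ c, X c → Fin (k c) → Y c} {f : ∀ c, X c → Fin (k c)} (hF : PT F) (hf : PT f) :
    PT (fun c x => F c x (f c x)) :=
  PT.getElem (l := fun c x => List.ofFn fun i => enc (F c x i))
    (hF.congr_enc fun c x => by simp [enc]) hf fun c x => by simp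

theorem PTp.mem {S : ∀ c, X c → Finset (Fin (k c))} {f : ∀ c, X c → Fin (k c)} (hS : PT S) (hf : PT f) :
    PTp (fun c x => f c x ∈ S c x) :=
  PTp.of_decide (PT.app (F := fun c x i => decide (i ∈ S c x)) (hS.congr_enc fun c x => by simp [enc]) hf)

theorem PT.filter {p : ∀ c, X c → Fin (k c) → Prop} [∀ c x, DecidablePred (p c x)]
    (hp : PTp fun c (q : X c × Fin (k c)) => p c q.1 q.2) :
    PT (fun c x => Finset.univ.filter (p c x)) :=
  (PT.tabulate (g := fun c x j => decide (p c x j)) hp.toBool).congr_enc fun c x => by simp [enc]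

/-- A set given by a decidable membership predicate. -/
theorem PT.finset {S : ∀ c, X c → Finset (Fin (k c))}
    (hp : PTp fun c (q : X c × Fin (k c)) => q.2 ∈ S c q.1) : PT S :=
  (PT.filter (p := fun c x j => j ∈ S c x) hp).congr fun c x => by ext; simp

theorem PT.update {F : ∀ c, X c → Fin (k c) → Y c} {f : ∀ c, X c → Fin (k c)} {g : ∀ c, X c → Y c}
    (hF : PT F) (hf : PT f) (hg : PT g) : PT (fun c x => Function.update (F c x) (f c x) (g c x)) :=
  (PT.tabulate (g := fun c x j => if j = f c x then g c x else F c x j)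
    (PT.ite (PTp.finEq PT.id.snd (hf.comp PT.id.fst)) (hg.comp PT.id.fst)
      ((hF.comp PT.id.fst).app PT.id.snd))).congr fun c x => by
    ext j; by_cases h : j = f c x
    · subst h; simp
    · simp [h]

theorem PT.erase {S : ∀ c, X c → Finset (Fin (k c))} {f : ∀ c, X c → Fin (k c)} (hS : PT S) (hf : PT f) :
    PT (fun c x => (S c x).erase (f c x)) :=
  PT.finset (((PTp.finEq PT.id.snd (hf.comp PT.id.fst)).not.and
    (PTp.mem (hS.comp PT.id.fst) PT.id.snd)).congr fun c x => by simp)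

theorem PT.insert {S : ∀ c, X c → Finset (Fin (k c))} {f : ∀ c, X c → Fin (k c)} (hS : PT S) (hf : PT f) :
    PT (fun c x => insert (f c x) (S c x)) :=
  PT.finset (((PTp.finEq PT.id.snd (hf.comp PT.id.fst)).or
    (PTp.mem (hS.comp PT.id.fst) PT.id.snd)).congr fun c x => by simp)

theorem PT.sdiff {S T : ∀ c, X c → Finset (Fin (k c))} (hS : PT S) (hT : PT T) :
    PT (fun c x => S c x \ T c x) :=
  PT.finset (((PTp.mem (hS.comp PT.id.fst) PT.id.snd).and
    (PTp.mem (hT.comp PT.id.fst) PT.id.snd).not).congr fun c x => by simp)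

theorem PT.empty : PT (fun c (_ : X c) => (∅ : Finset (Fin (k c)))) :=
  PT.finset (PTp.absurd.congr fun c x => by simp)

theorem PT.singleton {f : ∀ c, X c → Fin (k c)} (hf : PT f) : PT (fun c x => ({f c x} : Finset _)) :=
  PT.finset ((PTp.finEq PT.id.snd (hf.comp PT.id.fst)).congr fun c x => by simp)

theorem PT.univ : PT (fun c (_ : X c) => (Finset.univ : Finset (Fin (k c)))) :=
  PT.finset (PTp.trivial.congr fun c x => by simp)

theorem PT.card {S : ∀ c, X c → Finset (Fin (k c))} (hS : PT S) : PT (fun c x => (S c x).card) := by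
  refine (PT.foldr (Z := fun _ => ℕ) PT.finRange PT.natZero
    (g := fun c x j r => if j ∈ S c x then r + 1 else r)
    (PT.ite (PTp.mem (hS.comp PT.id.fst) PT.id.snd.fst) (PT.natSucc PT.id.snd.snd) PT.id.snd.snd)
    PBound.finRange).congr fun c x => ?_
  have : ∀ l : List (Fin (k c)), l.Nodup →
      l.foldr (fun j r => if j ∈ S c x then r + 1 else r) 0 = (S c x ∩ l.toFinset).card := by
    intro l hl
    induction l with
    | nil => simp
    | cons a l ih =>
      rw [List.nodup_cons] at hl
      rw [List.foldr_cons, ih hl.2, List.toFinset_cons]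
      split_ifs with h
      · rw [Finset.inter_insert_of_mem h, Finset.card_insert_of_notMem (by simp [hl.1])]
      · rw [Finset.inter_insert_of_notMem h]
  rw [this _ (List.nodup_finRange _)]
  simp

/-! ### Real numbers -/

theorem PT.realZero : PT (fun c (_ : X c) => (0 : ℝ)) :=
  PT.of_env .zero 1 fun _ _ => ⟨1, le_rfl, .zero _⟩

theorem PT.realAdd {f g : ∀ c, X c → ℝ} (hf : PT f) (hg : PT g) : PT (fun c x => f c x + g c x) :=
  (hf.pair hg).seq .add 1 fun _ _ => ⟨1, le_rfl, .add _⟩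

theorem PTp.realLe {f g : ∀ c, X c → ℝ} (hf : PT f) (hg : PT g) : PTp (fun c x => f c x ≤ g c x) :=
  PT.congr ((hf.pair hg).seq (g := fun c x => decide (f c x ≤ g c x)) .le 1
    fun _ _ => ⟨1, le_rfl, .le _⟩) fun c x => by simp

/-- The machine cannot multiply reals. Multiples by bounded natural numbers are repeated sums, and
these suffice for all comparisons with limits. -/
theorem PT.natMulReal {f : ∀ c, X c → ℕ} {g : ∀ c, X c → ℝ} (hf : PT f) (hg : PT g) (hb : PBound f) :
    PT (fun c x => (f c x : ℝ) * g c x) :=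
  (PT.iterate hf PT.realZero (g := fun c x y => y + g c x)
    (PT.realAdd PT.id.snd (hg.comp PT.id.fst)) hb).congr fun c x => by
    rw [add_right_iterate]; simp

theorem PT.sum {S : ∀ c, X c → Finset (Fin (k c))} {f : ∀ c, X c → Fin (k c) → ℝ} (hS : PT S)
    (hf : PT fun c (q : X c × Fin (k c)) => f c q.1 q.2) : PT (fun c x => ∑ j ∈ S c x, f c x j) := by
  refine (PT.foldr (Z := fun _ => ℝ) PT.finRange PT.realZero
    (g := fun c x j r => if j ∈ S c x then f c x j + r else r)
    (PT.ite (PTp.mem (hS.comp PT.id.fst) PT.id.snd.fst)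
      (PT.realAdd (hf.comp (PT.id.fst.pair PT.id.snd.fst)) PT.id.snd.snd) PT.id.snd.snd)
    PBound.finRange).congr fun c x => ?_
  have : ∀ l : List (Fin (k c)), l.Nodup →
      l.foldr (fun j r => if j ∈ S c x then f c x j + r else r) 0 = ∑ j ∈ S c x ∩ l.toFinset, f c x j := by
    intro l hl
    induction l with
    | nil => simp
    | cons a l ih =>
      rw [List.nodup_cons] at hl
      rw [List.foldr_cons, ih hl.2, List.toFinset_cons]
      split_ifs with h
      · rw [Finset.inter_insert_of_mem h, Finset.sum_insert (by simp [hl.1])]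
      · rw [Finset.inter_insert_of_notMem h]
  rw [this _ (List.nodup_finRange _)]
  simp

/-! ### The instance -/

theorem PT.itemVal {f : ∀ c, X c → Fin c.n} {g : ∀ c, X c → Fin c.m} (hf : PT f) (hg : PT g) :
    PT (fun c x => c.I.val (f c x) (g c x)) := by
  refine PT.getElem (l := fun c x => List.ofFn fun j : Fin c.m => Val.num (c.I.val (f c x) j)) ?_ hg
    fun c x => by simp [enc]
  refine PT.congr_enc (f := fun c x => Val.list (List.ofFn fun j : Fin c.m => Val.num (c.I.val (f c x) j))) ?_
    fun c x => by simp [enc]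
  exact PT.getElem PT.valRows hf fun c x => by simp [enc]

theorem PTp.adj {f g : ∀ c, X c → Fin c.m} (hf : PT f) (hg : PT g) :
    PTp (fun c x => c.I.graph.Adj (f c x) (g c x)) := by
  refine PT.getElem (l := fun c x => List.ofFn fun j : Fin c.m =>
    Val.bool (decide (c.I.graph.Adj (f c x) j))) ?_ hg fun c x => by simp [enc]
  refine PT.congr_enc (f := fun c x => Val.list (List.ofFn fun j : Fin c.m =>
    Val.bool (decide (c.I.graph.Adj (f c x) j)))) ?_ fun c x => by simp [enc]
  exact PT.getElem PT.adjRows hf fun c x => by simp [enc]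

theorem PT.value {f : ∀ c, X c → Fin c.n} {S : ∀ c, X c → Finset (Fin c.m)} (hf : PT f) (hS : PT S) :
    PT (fun c x => c.I.value (f c x) (S c x)) :=
  PT.sum hS (PT.itemVal (hf.comp PT.id.fst) PT.id.snd)

end arrays

end ConflictAlloc

namespace ConflictAlloc

open Classical

/-! ### The approximation guarantee -/

section approx

variable {n m : ℕ} {I : Problem n m}

theorem value_nonneg (i : Fin n) (S : Finset (Fin m)) : 0 ≤ I.value i S :=
  Finset.sum_nonneg fun j _ => I.val_nonneg i j

theorem value_mono (i : Fin n) {S T : Finset (Fin m)} (h : S ⊆ T) : I.value i S ≤ I.value i T :=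
  Finset.sum_le_sum_of_subset_of_nonneg h fun j _ _ => I.val_nonneg i j

theorem value_sdiff (i : Fin n) {S T : Finset (Fin m)} (h : S ⊆ T) :
    I.value i (T \ S) = I.value i T - I.value i S := by
  unfold Problem.value
  rw [← Finset.sum_sdiff h]; ring

theorem value_biUnion {ι : Type*} (i : Fin n) {K : Finset ι} {S : ι → Finset (Fin m)}
    (h : ∀ k ∈ K, ∀ k' ∈ K, k ≠ k' → Disjoint (S k) (S k')) :
    I.value i (K.biUnion S) = ∑ k ∈ K, I.value i (S k) :=
  Finset.sum_biUnion fun k hk k' hk' hne => h k hk k' hk' hne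

theorem FillBag.subset {S B : Finset (Fin m)} {sat : Finset (Fin m) → Prop} (h : FillBag S sat B) :
    B ⊆ S := by
  induction h with
  | empty => simp
  | add _ _ hj _ ih => exact Finset.insert_subset hj ih

/-- A bag is worth less than twice the limit. -/
theorem FillBag.value_le {S B : Finset (Fin m)} {sat : Finset (Fin m) → Prop} {i : Fin n} {y : ℝ}
    (h : FillBag S sat B) (hsat : ∀ B, ¬ sat B → I.value i B ≤ y) (hS : ∀ j ∈ S, I.val i j ≤ y)
    (hy : 0 ≤ y) : I.value i B ≤ 2 * y := by
  -- Before its last item was added, the bag did not satisfy `sat`; both that smaller bag and the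
  -- last item are worth at most `y`.
  cases h with
  | empty => simp [Problem.value, hy]
  | add _ h1 h2 h3 =>
    have := hsat _ h1
    have := hS _ h2
    simp only [Problem.value, Finset.sum_insert h3] at *
    linarith

theorem BagFill.eq_of_notMem {x : Fin n → ℝ} {last N : Finset (Fin n)} {l : ℕ}
    {A : Fin l → Finset (Fin m)} {P Q : Fin n → Finset (Fin m)} (h : BagFill I x last A N P Q)
    {i : Fin n} (hi : i ∉ N) : Q i = P i := by
  induction h with
  | finish => rfl
  | give k B a _ _ ha _ _ _ ih =>
    rw [ih (by simp [hi]), Function.update_of_ne (by rintro rfl; exact hi ha)]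

/-- An agent that receives no bag values the sources little. -/
theorem BagFill.value_lt {x : Fin n → ℝ} {last N : Finset (Fin n)} {l : ℕ}
    {A : Fin l → Finset (Fin m)} {P Q : Fin n → Finset (Fin m)} (h : BagFill I x last A N P Q)
    {i : Fin n} (hi : i ∈ N) (hx : 0 ≤ x i) (hA : ∀ k, ∀ j ∈ A k, I.val i j ≤ x i)
    {T : Finset (Fin l)} (hT : T.Nonempty) :
    x i ≤ I.value i (Q i) ∨ ∑ k ∈ T, I.value i (A k) <
      (∑ a ∈ N.erase i, if a ∈ last ∧ i ∉ last then (1 : ℝ) else 2) * x i + T.card * x i := by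
  -- The set `T` of sources is arbitrary because the selected agent is later measured either on all
  -- sources or on all except the bundle `B`. A bag taken from a source outside `T` only helps.
  induction h with
  | @finish A N P hfin =>
    right
    have h1 : ∑ k ∈ T, I.value i (A k) < ∑ k ∈ T, x i :=
      Finset.sum_lt_sum_of_nonempty hT fun k _ => hfin k i hi
    have h2 : 0 ≤ ∑ a ∈ N.erase i, if a ∈ last ∧ i ∉ last then (1 : ℝ) else 2 :=
      Finset.sum_nonneg fun a _ => by split_ifs <;> norm_num
    rw [Finset.sum_const, nsmul_eq_mul] at h1
    nlinarith [mul_nonneg h2 hx]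
  | @give A N P Q k B a hk hB ha hxa hlast hQ ih =>
    by_cases hai : i = a
    · subst hai
      left
      rw [hQ.eq_of_notMem (by simp)]
      simpa using hxa
    have hsub : ∀ k', Function.update A k (A k \ B) k' ⊆ A k' := by
      intro k'
      by_cases hk' : k' = k
      · subst hk'; simp
      · simp [hk']
    rcases ih (by simp [hai, hi]) (fun k' j hj => hA k' j (hsub k' hj)) with h | h
    · exact .inl h
    right
    -- If the bag reached the limit of `i`, the priority rule would not have let an agent of `last`
    -- take it; so such a bag costs `i` less than one limit.
    have hw : I.value i B ≤ (if a ∈ last ∧ i ∉ last then (1 : ℝ) else 2) * x i := by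
      split_ifs with hl
      · by_contra! hc
        exact hl.2 (hlast hl.1 i hi (by linarith))
      · refine hB.value_le (fun B' hB' => ?_) (hA k) hx
        by_contra! hc
        exact hB' ⟨i, hi, hc.le⟩
    have hsum : ∑ k' ∈ T, I.value i (A k') ≤
        ∑ k' ∈ T, I.value i (Function.update A k (A k \ B) k') + I.value i B := by
      by_cases hkT : k ∈ T
      · rw [← Finset.add_sum_erase _ _ hkT, ← Finset.add_sum_erase _ _ hkT, Function.update_self,
          value_sdiff i hB.subset]
        have : ∑ k' ∈ T.erase k, I.value i (Function.update A k (A k \ B) k') =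
            ∑ k' ∈ T.erase k, I.value i (A k') :=
          Finset.sum_congr rfl fun k' hk' => by rw [Function.update_of_ne (Finset.ne_of_mem_erase hk')]
        linarith
      · have : ∑ k' ∈ T, I.value i (Function.update A k (A k \ B) k') =
            ∑ k' ∈ T, I.value i (A k') :=
          Finset.sum_congr rfl fun k' hk' => by
            rw [Function.update_of_ne (by rintro rfl; exact hkT hk')]
        linarith [value_nonneg (I := I) i B]
    rw [Finset.erase_right_comm] at h
    rw [← Finset.add_sum_erase (N.erase i) _ (show a ∈ N.erase i by simp [Ne.symm hai, ha]), add_mul]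
    linarith

theorem sum_erase_two {N : Finset (Fin n)} {i : Fin n} (hi : i ∈ N) :
    ∑ _a ∈ N.erase i, (2 : ℝ) = 2 * N.card - 2 := by
  rw [Finset.sum_const, Finset.card_erase_of_mem hi, nsmul_eq_mul,
    Nat.cast_sub (Finset.card_pos.2 ⟨i, hi⟩)]
  push_cast; ring

theorem factor_pos {Δ : ℕ} : 0 < factor Δ := by
  unfold factor; split_ifs <;> positivity

/-- The count for `Δ` sources. For `Δ > 2` it amounts to `0 ≤ (r - 2) * (Δ - 2)`, which is tight at
`r = 2` and yields the value `2 / (Δ + 2)`. -/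
theorem factor_mul_le {Δ r : ℕ} (hΔ : 1 ≤ Δ) (hr : 2 ≤ r) :
    factor Δ * (2 * r - 2 + Δ) ≤ r := by
  have hr' : (2 : ℝ) ≤ r := by exact_mod_cast hr
  unfold factor
  split_ifs with h1 h2
  · subst h1; push_cast; linarith
  · subst h2; push_cast; linarith
  · have h3 : (3 : ℝ) ≤ Δ := by exact_mod_cast (by omega : 3 ≤ Δ)
    rw [div_mul_eq_mul_div, div_le_iff₀ (by positivity)]
    nlinarith

/-- The count for `Δ + 1` sources, with worst case `r = Δ + 1`. It forces `1/2` for `Δ = 1` and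
`3/7` for `Δ = 2`; for `Δ > 2` the worst case amounts to `3 ≤ Δ`. -/
theorem factor_mul_le' {Δ r : ℕ} (hΔ : 1 ≤ Δ) (hr : Δ < r) :
    factor Δ * (2 * r - 2 + (Δ + 1)) ≤ r := by
  have hr' : (Δ : ℝ) + 1 ≤ r := by exact_mod_cast hr
  unfold factor
  split_ifs with h1 h2
  · subst h1; push_cast at *; linarith
  · subst h2; push_cast at *; linarith
  · have h3 : (3 : ℝ) ≤ Δ := by exact_mod_cast (by omega : 3 ≤ Δ)
    rw [div_mul_eq_mul_div, div_le_iff₀ (by positivity)]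
    nlinarith

theorem IsColoringOf.value_eq {l : ℕ} {S : Finset (Fin m)} {A : Fin l → Finset (Fin m)}
    (h : IsColoringOf I.graph S A) (i : Fin n) : ∑ k, I.value i (A k) = I.value i S := by
  rw [← h.2.2, value_biUnion]
  exact fun k _ k' _ => h.2.1 k k'

theorem IsColoringOf.subset {l : ℕ} {G : SimpleGraph (Fin m)} {S : Finset (Fin m)}
    {A : Fin l → Finset (Fin m)} (h : IsColoringOf G S A) (k : Fin l) : A k ⊆ S := by
  rw [← h.2.2]; exact Finset.subset_biUnion_of_mem A (Finset.mem_univ k)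

/-- A union of `r ≤ l` independent sets is `l`-colourable. -/
theorem colorableOn_of_subset_biUnion {ι : Type*} {G : SimpleGraph (Fin m)} {K : Finset ι} {l : ℕ}
    (hK : K.card ≤ l) {S : ι → Finset (Fin m)} (hS : ∀ k ∈ K, G.IsIndepSet (S k : Set (Fin m)))
    {C : Finset (Fin m)} (hC : C ⊆ K.biUnion S) : ColorableOn G C l := by
  have h : ∀ v : (C : Set (Fin m)), ∃ k : K, v.1 ∈ S k := fun v => by
    obtain ⟨k, hk, hv⟩ := Finset.mem_biUnion.1 (hC v.2)
    exact ⟨⟨k, hk⟩, hv⟩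
  choose f hf using h
  have : (G.induce (C : Set (Fin m))).Colorable (Fintype.card K) :=
    (SimpleGraph.Coloring.mk f (by
      intro v w hvw he
      refine hS _ (f v).2 (hf v) ?_ ?_ hvw
      · rw [he]; exact hf w
      · exact fun h => hvw.ne (Subtype.ext h))).colorable
  exact this.mono (by simpa using hK)

theorem IsComponentOf.disjoint {G : SimpleGraph (Fin m)} {S C D : Finset (Fin m)}
    (hC : IsComponentOf G S C) (hD : IsComponentOf G S D) {j : Fin m} (h : j ∈ C) (h' : j ∈ D) :
    C = D := by
  obtain ⟨c, hc⟩ := hC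
  obtain ⟨d, hd⟩ := hD
  rw [← Finset.mem_coe, hc] at h
  rw [← Finset.mem_coe, hd] at h'
  obtain ⟨a, ha, rfl⟩ := h
  obtain ⟨b, hb, hab⟩ := h'
  obtain rfl := Subtype.ext hab
  rw [SimpleGraph.ConnectedComponent.mem_supp_iff] at ha hb
  subst ha
  subst hb
  exact Finset.coe_injective (hc.trans hd.symm)

theorem IsComponentOf.subset {G : SimpleGraph (Fin m)} {S C : Finset (Fin m)}
    (hC : IsComponentOf G S C) : C ⊆ S := by
  obtain ⟨c, hc⟩ := hC
  intro j hj
  rw [← Finset.mem_coe, hc] at hj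
  obtain ⟨a, ha, rfl⟩ := hj
  exact a.2

theorem Problem.IsLeastTransversal.subset {l : ℕ} {i : Fin n} {M B : Finset (Fin m)}
    (h : I.IsLeastTransversal l i M B) : B ⊆ M := fun j hj => by
  obtain ⟨C, hC, _, hjC⟩ := h.1 j hj
  exact hC.subset hjC

/-- Removing a least transversal costs no more than what `r ≤ l` independent sets must miss. -/
theorem Problem.IsLeastTransversal.value_le {ι : Type*} {l : ℕ} {i : Fin n} {M B : Finset (Fin m)}
    (h : I.IsLeastTransversal l i M B) {K : Finset ι} (hK : K.card ≤ l) {S : ι → Finset (Fin m)}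
    (hS : ∀ k ∈ K, I.graph.IsIndepSet (S k : Set (Fin m))) (hM : K.biUnion S ⊆ M) :
    I.value i (K.biUnion S) ≤ I.value i (M \ B) := by
  -- Were the component of `j` covered by the independent sets, they would colour it with `l`
  -- colours. So they miss some `u` in it, and `j` has least value there.
  have hex : ∀ j ∈ B, ∃ u C, IsComponentOf I.graph M C ∧ ¬ ColorableOn I.graph C l ∧ j ∈ C ∧
      u ∈ C ∧ u ∉ K.biUnion S ∧ I.val i j ≤ I.val i u := by
    intro j hj
    obtain ⟨C, hC, hcol, hjC⟩ := h.1 j hj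
    obtain ⟨j₀, _, hB, hmin⟩ := h.2 C hC hcol
    have hj₀ : j ∈ ({j₀} : Finset _) := by rw [← hB]; simp [hj, hjC]
    obtain rfl := Finset.mem_singleton.1 hj₀
    have : ¬ C ⊆ K.biUnion S := fun hsub => hcol (colorableOn_of_subset_biUnion hK hS hsub)
    obtain ⟨u, hu, hu'⟩ := Finset.not_subset.1 this
    exact ⟨u, C, hC, hcol, hjC, hu, hu', hmin u hu⟩
  choose! u C hC hcol hjC hu hu' hle using hex
  -- Different items of `B` lie in different components, and hence so do the missed items chosen for
  -- them.
  have hinj : Set.InjOn u B := by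
    intro j hj j' hj' he
    have hCC : C j = C j' := (hC j hj).disjoint (hC j' hj') (hu j hj) (he ▸ hu j' hj')
    obtain ⟨j₀, _, hB, _⟩ := h.2 _ (hC j hj) (hcol j hj)
    have h1 : j ∈ ({j₀} : Finset _) := by rw [← hB]; simp [Finset.mem_coe.1 hj, hjC j hj]
    have h2 : j' ∈ ({j₀} : Finset _) := by rw [← hB, hCC]; simp [Finset.mem_coe.1 hj', hjC j' hj']
    rw [Finset.mem_singleton.1 h1, Finset.mem_singleton.1 h2]
  have h1 : I.value i B ≤ I.value i (M \ K.biUnion S) := by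
    calc I.value i B ≤ ∑ j ∈ B, I.val i (u j) := Finset.sum_le_sum fun j hj => hle j hj
      _ = I.value i (B.image u) := (Finset.sum_image hinj).symm
      _ ≤ _ := value_mono i fun v hv => by
        obtain ⟨j, hj, rfl⟩ := Finset.mem_image.1 hv
        exact Finset.mem_sdiff.2 ⟨(hC j hj).subset (hu j hj), hu' j hj⟩
  rw [value_sdiff i hM] at h1
  rw [value_sdiff i (Problem.IsLeastTransversal.subset h)]
  linarith

/-- At least `r` of the sets `S k` are contained in `M` and are worth at least `μ` to `i`. -/
def Packed (I : Problem n m) (S : Fin n → Finset (Fin m)) (i : Fin n) (μ : ℝ) (r : ℕ)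
    (M : Finset (Fin m)) : Prop :=
  ∃ K : Finset (Fin n), K.card = r ∧ ∀ k ∈ K, S k ⊆ M ∧ μ ≤ I.value i (S k)

variable {S : Fin n → Finset (Fin m)} {i : Fin n} {μ : ℝ}

/-- The bundles are disjoint, so the item `j` lies in at most one of them. Dropping that one, or an
arbitrary one if there is none, matches the loss of one agent. -/
theorem Packed.erase {N : Finset (Fin n)} {M : Finset (Fin m)} (h : Packed I S i μ N.card M)
    (hd : ∀ k k', k ≠ k' → Disjoint (S k) (S k')) {a : Fin n} (ha : a ∈ N) (j : Fin m) :
    Packed I S i μ (N.erase a).card (M.erase j) := by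
  obtain ⟨K, hK, h⟩ := h
  rw [Finset.card_erase_of_mem ha, ← hK]
  have hpos : 0 < K.card := hK ▸ Finset.card_pos.2 ⟨a, ha⟩
  have : ∃ k₀ ∈ K, ∀ k ∈ K, k ≠ k₀ → j ∉ S k := by
    by_cases hj : ∃ k₀ ∈ K, j ∈ S k₀
    · obtain ⟨k₀, hk₀, hj⟩ := hj
      exact ⟨k₀, hk₀, fun k _ hne hjk => Finset.disjoint_left.1 (hd k k₀ hne) hjk hj⟩
    · obtain ⟨k₀, hk₀⟩ := Finset.card_pos.1 hpos
      exact ⟨k₀, hk₀, fun k hk _ hjk => hj ⟨k, hk, hjk⟩⟩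
  obtain ⟨k₀, hk₀, hj⟩ := this
  refine ⟨K.erase k₀, Finset.card_erase_of_mem hk₀, fun k hk => ?_⟩
  obtain ⟨hne, hk⟩ := Finset.mem_erase.1 hk
  exact ⟨Finset.subset_erase.2 ⟨(h k hk).1, hj k hk hne⟩, (h k hk).2⟩

theorem Packed.mul_le {r : ℕ} {M : Finset (Fin m)} (h : Packed I S i μ r M)
    (hd : ∀ k k', k ≠ k' → Disjoint (S k) (S k')) : r * μ ≤ I.value i M := by
  obtain ⟨K, rfl, h⟩ := h
  calc (K.card : ℝ) * μ = ∑ _k ∈ K, μ := by simp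
    _ ≤ ∑ k ∈ K, I.value i (S k) := Finset.sum_le_sum fun k hk => (h k hk).2
    _ = I.value i (K.biUnion S) := (value_biUnion i fun k _ k' _ => hd k k').symm
    _ ≤ _ := value_mono i (Finset.biUnion_subset.2 fun k hk => (h k hk).1)

/-- The average `v_i(M) / |N|` is at least `μ`, since `M` contains `|N|` disjoint sets of this
value. Serving an agent up to the limit is therefore enough. -/
theorem Packed.le_limit {N : Finset (Fin n)} {M : Finset (Fin m)} {α : ℝ} (hα : 0 < α)
    (h : Packed I S i μ N.card M) (hd : ∀ k k', k ≠ k' → Disjoint (S k) (S k')) (hN : N.Nonempty) :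
    α * μ ≤ I.limit α N M i := by
  have hr : (0 : ℝ) < N.card := by exact_mod_cast Finset.card_pos.2 hN
  refine mul_le_mul_of_nonneg_left ?_ hα.le
  rw [le_div_iff₀ hr, mul_comm]
  exact h.mul_le hd

/-- With `|N| ≤ l`, the packed bundles are independent sets too few to cover a component that is not
`l`-colourable, so even `M \ B` is worth at least `|N| * μ`. -/
theorem Packed.le_splitLimit {N : Finset (Fin n)} {M B : Finset (Fin m)} {α : ℝ} {l : ℕ} (hα : 0 < α)
    (h : Packed I S i μ N.card M) (hd : ∀ k k', k ≠ k' → Disjoint (S k) (S k')) (hN : N.Nonempty)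
    (hind : ∀ k, I.graph.IsIndepSet (S k : Set (Fin m))) (hB : I.IsLeastTransversal l i M B)
    (hl : N.card ≤ l) : α * μ ≤ I.splitLimit α N M B i := by
  have hr : (0 : ℝ) < N.card := by exact_mod_cast Finset.card_pos.2 hN
  refine mul_le_mul_of_nonneg_left (le_max_of_le_left ?_) hα.le
  rw [le_div_iff₀ hr, mul_comm]
  obtain ⟨K, hK, h⟩ := h
  have h1 : Packed I S i μ N.card (K.biUnion S) :=
    ⟨K, hK, fun k hk => ⟨Finset.subset_biUnion_of_mem S hk, (h k hk).2⟩⟩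
  exact (h1.mul_le hd).trans (Problem.IsLeastTransversal.value_le hB (hK ▸ hl) (fun k _ => hind k)
    (Finset.biUnion_subset.2 fun k hk => (h k hk).1))

theorem limit_nonneg {α : ℝ} (hα : 0 < α) (N : Finset (Fin n)) (M : Finset (Fin m)) (i : Fin n) :
    0 ≤ I.limit α N M i :=
  mul_nonneg hα.le (div_nonneg (value_nonneg _ _) (Nat.cast_nonneg _))

theorem limit_mul_le {α y : ℝ} {N : Finset (Fin n)} {M : Finset (Fin m)} {i : Fin n}
    (hN : N.Nonempty) (h : α * y ≤ N.card) : y * I.limit α N M i ≤ I.value i M := by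
  have hr : (0 : ℝ) < N.card := by exact_mod_cast Finset.card_pos.2 hN
  unfold Problem.limit
  rw [show y * (α * (I.value i M / N.card)) = (α * y) * I.value i M / N.card by ring, div_le_iff₀ hr,
    mul_comm (I.value i M)]
  exact mul_le_mul_of_nonneg_right h (value_nonneg _ _)

/-- The term attaining the maximum decides how to count: with the sources outside `B`, or with `B`
as one more source. In the second case the extra limit is paid for by the `+ 1` in the denominator,
as `α ≤ 1`. -/
theorem splitLimit_mul_le {α y : ℝ} {N : Finset (Fin n)} {M B : Finset (Fin m)} {i : Fin n}
    (hN : N.Nonempty) (hα : α ≤ 1) (h : α * y ≤ N.card) :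
    y * I.splitLimit α N M B i ≤ I.value i (M \ B) ∨
      (y + 1) * I.splitLimit α N M B i ≤ I.value i M := by
  have hr : (0 : ℝ) < N.card := by exact_mod_cast Finset.card_pos.2 hN
  unfold Problem.splitLimit
  rcases max_choice (I.value i (M \ B) / N.card) (I.value i M / (N.card + 1)) with hm | hm <;> rw [hm]
  · left
    rw [show y * (α * (I.value i (M \ B) / N.card)) = (α * y) * I.value i (M \ B) / N.card by ring,
      div_le_iff₀ hr, mul_comm (I.value i (M \ B))]
    exact mul_le_mul_of_nonneg_right h (value_nonneg _ _)
  · right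
    rw [show (y + 1) * (α * (I.value i M / (N.card + 1))) =
      (α * y + α) * I.value i M / (N.card + 1) by ring,
      div_le_iff₀ (by positivity), mul_comm (I.value i M)]
    exact mul_le_mul_of_nonneg_right (by linarith) (value_nonneg _ _)

theorem factor_le_one {Δ : ℕ} : factor Δ ≤ 1 := by
  unfold factor
  split_ifs with h1 h2
  · norm_num
  · norm_num
  · rw [div_le_one (by positivity)]
    linarith [(Nat.cast_nonneg Δ : (0 : ℝ) ≤ Δ)]

theorem Problem.Run.eq_of_notMem {α : ℝ} {N : Finset (Fin n)} {M : Finset (Fin m)}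
    {P Q : Fin n → Finset (Fin m)} (h : Problem.Run I α N M P Q) {i : Fin n} (hi : i ∉ N) : Q i = P i := by
  induction h with
  | reduce a j ha hj hlim _ ih =>
    rw [ih (by simp [hi]), Function.update_of_ne (by rintro rfl; exact hi ha)]
  | done => rfl
  | single a => rw [Function.update_of_ne (by rintro rfl; simp at hi)]
  | colorable A _ _ _ _ hB => exact hB.eq_of_notMem hi
  | splitReduce a B j _ _ _ _ ha _ _ _ _ ih =>
    rw [ih (by simp [hi]), Function.update_of_ne (by rintro rfl; exact hi ha)]
  | splitFill a B A _ _ _ _ _ _ _ _ hB => exact hB.eq_of_notMem hi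
  | many A _ _ _ _ _ hB => exact hB.eq_of_notMem hi

theorem value_item_singleton (i : Fin n) (j : Fin m) : I.value i {j} = I.val i j := by
  simp [Problem.value]

/-- Bag filling that respects the reduced limits serves every agent, provided that there are not
too many sources. -/
theorem BagFill.limit_le {α : ℝ} (hα : 0 < α) {N last : Finset (Fin n)} {M : Finset (Fin m)}
    {l : ℕ} (hl : 0 < l) {A : Fin l → Finset (Fin m)} {x : Fin n → ℝ} {P Q : Fin n → Finset (Fin m)}
    (h : BagFill I x last A N P Q) {i : Fin n} (hi : i ∈ N) (hx : x i = I.limit α N M i)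
    (hred : I.Reduced α N M) (hsub : ∀ k, A k ⊆ M) (hsum : ∑ k, I.value i (A k) = I.value i M)
    (hineq : α * ((∑ a ∈ N.erase i, if a ∈ last ∧ i ∉ last then (1 : ℝ) else 2) + l) ≤ N.card) :
    I.limit α N M i ≤ I.value i (Q i) := by
  have := Fin.pos_iff_nonempty.1 hl
  rcases h.value_lt hi (hx ▸ limit_nonneg hα _ _ _) (fun k j hj => hx ▸ (hred i hi j (hsub k hj)).le)
    (T := Finset.univ) Finset.univ_nonempty with h | h
  · exact hx ▸ h
  · rw [hsum, ← add_mul, hx, Finset.card_univ, Fintype.card_fin] at h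
    exact absurd (limit_mul_le ⟨i, hi⟩ hineq) (not_le.2 h)

/-- Induction on the run with `Packed` as invariant. A single item handed out preserves it for the
others; whenever `i` is served, the limit in force is at least `α * μ`, or, as the only agent left,
`i` can compare with the one remaining packed bundle. The family `S` stays fixed while agents and
items disappear. -/
theorem Problem.Run.approx (hΔ : 1 ≤ I.maxDeg) {N : Finset (Fin n)} {M : Finset (Fin m)}
    {P Q : Fin n → Finset (Fin m)} (h : Problem.Run I (factor I.maxDeg) N M P Q) (hi : i ∈ N)
    (hd : ∀ k k', k ≠ k' → Disjoint (S k) (S k')) (hind : ∀ k, I.graph.IsIndepSet (S k : Set (Fin m)))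
    (hpack : Packed I S i μ N.card M) : factor I.maxDeg * μ ≤ I.value i (Q i) := by
  have hα := factor_pos (Δ := I.maxDeg)
  induction h with
  | done => simp at hi
  | @reduce N M P Q a j ha hj hlim hrun ih =>
    by_cases hia : i = a
    · subst hia
      rw [hrun.eq_of_notMem (by simp), Function.update_self, value_item_singleton]
      exact (hpack.le_limit hα hd ⟨i, hi⟩).trans hlim
    · exact ih (by simp [hia, hi]) (hpack.erase hd ha j)
  | @single M P a T hred hTM hT hbest =>
    obtain rfl : i = a := by simpa using hi
    rw [Function.update_self]
    obtain ⟨K, hK, h⟩ := hpack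
    obtain ⟨k, hk⟩ := Finset.card_pos.1 (by rw [hK]; simp : 0 < K.card)
    exact (mul_le_mul_of_nonneg_left (h k hk).2 hα.le).trans (hbest _ (h k hk).1 (hind k))
  | @colorable N M P Q A hred hN hcol hA hB =>
    refine (hpack.le_limit hα hd ⟨i, hi⟩).trans
      (hB.limit_le hα hΔ hi rfl hred hA.subset (hA.value_eq i) ?_)
    simp only [Finset.notMem_empty, false_and, if_false]
    rw [sum_erase_two hi]
    exact factor_mul_le hΔ hN
  | @many N M P Q A hred hN hN' hcol hA hB =>
    refine (hpack.le_limit hα hd ⟨i, hi⟩).trans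
      (hB.limit_le hα (Nat.succ_pos _) hi rfl hred hA.subset (hA.value_eq i) ?_)
    simp only [Finset.notMem_empty, false_and, if_false]
    rw [sum_erase_two hi]
    push_cast
    exact factor_mul_le' hΔ hN'
  | @splitReduce N M P Q a B j hred hN hN' hcol ha hB hj hlim hrun ih =>
    by_cases hia : i = a
    · subst hia
      rw [hrun.eq_of_notMem (by simp), Function.update_self, value_item_singleton]
      exact (hpack.le_splitLimit hα hd ⟨i, hi⟩ hind hB hN').trans hlim
    · exact ih (by simp [hia, hi]) (hpack.erase hd ha j)
  | @splitFill N M P Q a B A hred hN hN' hcol ha hB hlim hA hfill =>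
    have hBM := Problem.IsLeastTransversal.subset hB
    have hsub : ∀ k, (Fin.cons B A : Fin (I.maxDeg + 1) → Finset (Fin m)) k ⊆ M := by
      intro k
      refine Fin.cases hBM (fun k => ?_) k
      exact (hA.subset k).trans Finset.sdiff_subset
    have hsum : ∑ k, I.value i ((Fin.cons B A : Fin (I.maxDeg + 1) → Finset (Fin m)) k) = I.value i M := by
      rw [Fin.sum_univ_succ]
      simp only [Fin.cons_zero, Fin.cons_succ]
      rw [hA.value_eq, value_sdiff i hBM]; ring
    by_cases hia : i = a
    · subst hia
      refine (hpack.le_splitLimit hα hd ⟨i, hi⟩ hind hB hN').trans ?_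
      have hx : 0 ≤ I.splitLimit (factor I.maxDeg) N M B i :=
        mul_nonneg hα.le (le_max_of_le_left (div_nonneg (value_nonneg _ _) (Nat.cast_nonneg _)))
      have hw : ∑ b ∈ N.erase i, (if b ∈ ({i} : Finset _) ∧ i ∉ ({i} : Finset (Fin n)) then (1 : ℝ) else 2) =
          2 * N.card - 2 := by
        rw [← sum_erase_two hi]
        exact Finset.sum_congr rfl fun b _ => by simp
      -- For the selected agent every other bag counts twice, because `i` itself belongs to `last`.
      have key : ∀ T : Finset (Fin (I.maxDeg + 1)), T.Nonempty →
          (2 * N.card - 2 + T.card : ℝ) * I.splitLimit (factor I.maxDeg) N M B i ≤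
            ∑ k ∈ T, I.value i ((Fin.cons B A : Fin (I.maxDeg + 1) → Finset (Fin m)) k) →
          I.splitLimit (factor I.maxDeg) N M B i ≤ I.value i (Q i) := by
        intro T hT hle
        have := hfill.value_lt hi (by simpa using hx)
          (fun k j hj => by simpa using (hlim j (hsub k hj)).le) hT
        rw [hw, Function.update_self, ← add_mul] at this
        rcases this with h | h
        · exact h
        · exact absurd h (not_lt.2 hle)
      -- The first alternative is played on the `Δ` colour classes of `M \ B`, the second on all `Δ
      -- + 1` sources.
      rcases splitLimit_mul_le (M := M) (B := B) ⟨i, hi⟩ factor_le_one (factor_mul_le hΔ hN) (I := I) with h | h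
      · have : Nonempty (Fin I.maxDeg) := Fin.pos_iff_nonempty.1 hΔ
        refine key (Finset.univ.map (Fin.succEmb _)) (Finset.univ_nonempty.map) ?_
        simp only [Finset.card_map, Finset.card_univ, Fintype.card_fin, Finset.sum_map, Fin.coe_succEmb, Fin.cons_succ]
        rwa [hA.value_eq]
      · refine key Finset.univ Finset.univ_nonempty ?_
        rw [hsum]
        simp only [Finset.card_univ, Fintype.card_fin]
        push_cast
        rwa [← add_assoc]
    · refine (hpack.le_limit hα hd ⟨i, hi⟩).trans
        (hfill.limit_le hα (Nat.succ_pos _) hi (by simp [hia]) hred hsub hsum ?_)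
      -- For the other agents the bag of `a` counts once, so the total `1 + 2 * (|N| - 2) + (Δ + 1)`
      -- is the same as for `Δ` sources with all bags counted twice.
      have hai : a ∈ N.erase i := by simp [Ne.symm hia, ha]
      rw [← Finset.add_sum_erase _ _ hai, Finset.sum_congr rfl (g := fun _ => (2 : ℝ))
        (fun b hb => by simp [Finset.ne_of_mem_erase hb]), sum_erase_two hai]
      have := factor_mul_le hΔ hN
      rw [Finset.card_erase_of_mem hi, Nat.cast_sub (by omega)]
      simp only [Finset.mem_singleton, hia, not_false_eq_true, and_self, if_true]
      push_cast
      convert this using 2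
      ring

theorem Problem.Output.isApproxMMS (hΔ : 1 ≤ I.maxDeg) {A : Fin m → Fin n}
    (h : I.Output (factor I.maxDeg) A) : I.IsApproxMMS (factor I.maxDeg) A := by
  obtain ⟨Q, hrun, hfeas, hQ⟩ := h
  refine ⟨hfeas, fun i => ?_⟩
  have hα := factor_pos (Δ := I.maxDeg)
  have hv : 0 ≤ I.value i (bundle A i) := value_nonneg _ _
  rw [← le_div_iff₀' hα]
  -- The bound must also be nonnegative, since the supremum over an empty family of feasible
  -- allocations would be `0`.
  refine Real.iSup_le (fun F => ?_) (div_nonneg hv hα.le)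
  rw [le_div_iff₀' hα]
  refine (Problem.Run.approx (S := bundle F.1) hΔ hrun (Finset.mem_univ i) ?_ F.2 ?_).trans (value_mono i (hQ i))
  · intro k k' hk
    rw [Finset.disjoint_left]
    intro j hj hj'
    simp only [bundle, Finset.mem_filter, Finset.mem_univ, true_and] at hj hj'
    exact hk (hj.symm.trans hj')
  · exact ⟨Finset.univ, rfl, fun k _ => ⟨Finset.subset_univ _, ciInf_le (Set.finite_range _).bddBelow k⟩⟩

theorem one_div_lt_factor {Δ : ℕ} (h : 2 < Δ) : 1 / (Δ : ℝ) < factor Δ := by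
  have : (2 : ℝ) < Δ := by exact_mod_cast h
  rw [factor, if_neg (by omega), if_neg (by omega), div_lt_div_iff₀ (by positivity) (by positivity)]
  linarith

end approx

end ConflictAlloc

namespace ConflictAlloc

open Classical

/-! ### Colouring with as many colours as the maximum degree -/

section coloring

variable {m : ℕ} {G : SimpleGraph (Fin m)} {d : ℕ}

/-- A partial colouring with colours below `d` whose coloured vertices are those of `T`. -/
def PartialColoring (G : SimpleGraph (Fin m)) (d : ℕ) (T : Finset (Fin m))
    (col : Fin m → Option (Fin m)) : Prop :=
  (∀ v k, col v = some k → k.val < d ∧ ∀ w, G.Adj v w → col w ≠ some k) ∧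
    ∀ v, col v ≠ none ↔ v ∈ T

/-- The first colour below `d` that no neighbour has. -/
noncomputable def freeColor (G : SimpleGraph (Fin m)) (d : ℕ) (col : Fin m → Option (Fin m))
    (v : Fin m) : Option (Fin m) :=
  first fun k => k.val < d ∧ ∀ w, G.Adj v w → col w ≠ some k

/-- Colour a vertex greedily. -/
noncomputable def paint (G : SimpleGraph (Fin m)) (d : ℕ) (col : Fin m → Option (Fin m))
    (v : Fin m) : Fin m → Option (Fin m) :=
  Function.update col v (freeColor G d col v)

/-- Colour the vertices of a list greedily, one after the other. -/
noncomputable def paintAll (G : SimpleGraph (Fin m)) (d : ℕ) (col : Fin m → Option (Fin m))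
    (l : List (Fin m)) : Fin m → Option (Fin m) :=
  l.foldl (paint G d) col

theorem PartialColoring.eq_none {T : Finset (Fin m)} {col : Fin m → Option (Fin m)}
    (h : PartialColoring G d T col) {v : Fin m} (hv : v ∉ T) : col v = none := by
  by_contra hc
  exact hv ((h.2 v).1 hc)

theorem PartialColoring.update {T : Finset (Fin m)} {col : Fin m → Option (Fin m)}
    (h : PartialColoring G d T col) {v k : Fin m} (hk : k.val < d)
    (hfree : ∀ w, G.Adj v w → col w ≠ some k) :
    PartialColoring G d (insert v T) (Function.update col v (some k)) := by
  constructor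
  · intro u k' hu
    by_cases huv : u = v
    · subst huv
      rw [Function.update_self] at hu
      obtain rfl := Option.some.inj hu
      exact ⟨hk, fun w hw => by rw [Function.update_of_ne hw.ne']; exact hfree w hw⟩
    · rw [Function.update_of_ne huv] at hu
      refine ⟨(h.1 u k' hu).1, fun w hw => ?_⟩
      by_cases hwv : w = v
      · subst hwv
        rw [Function.update_self]
        rintro hkk
        exact hfree u hw.symm (by rw [hu, ← hkk])
      · rw [Function.update_of_ne hwv]
        exact (h.1 u k' hu).2 w hw
  · intro u
    by_cases huv : u = v
    · subst huv; simp
    · rw [Function.update_of_ne huv, h.2]; simp [huv]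

theorem PartialColoring.paint_of_isSome {T : Finset (Fin m)} {col : Fin m → Option (Fin m)}
    (h : PartialColoring G d T col) {v : Fin m} (hv : freeColor G d col v ≠ none) :
    PartialColoring G d (insert v T) (paint G d col v) := by
  obtain ⟨k, hk⟩ := Option.ne_none_iff_exists'.1 hv
  rw [paint, hk]
  exact h.update (first_some hk).1 (first_some hk).2

/-- If no colour is free, then all neighbours have different colours, and every colour occurs. -/
theorem freeColor_eq_none {col : Fin m → Option (Fin m)} {v : Fin m} (hd : d ≤ m)
    (hdeg : (Finset.univ.filter (G.Adj v)).card ≤ d) (h : freeColor G d col v = none) :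
    (∀ w, G.Adj v w → col w ≠ none) ∧
      (∀ w w', G.Adj v w → G.Adj v w' → col w = col w' → w = w') ∧
      (Finset.univ.filter (G.Adj v)).card = d := by
  set N := Finset.univ.filter (G.Adj v)
  -- All `d` colours occur on the at most `d` neighbours. Equality of the cardinalities then makes
  -- the colouring of the neighbours injective and leaves no room for an uncoloured one.
  let D : Finset (Option (Fin m)) := Finset.univ.image fun k : Fin d => some (Fin.castLE hd k)
  have hDcard : D.card = d := by
    rw [Finset.card_image_of_injective, Finset.card_univ, Fintype.card_fin]
    exact fun a b hab => Fin.castLE_injective hd (Option.some.inj hab)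
  have hsub : D ⊆ N.image col := by
    intro o ho
    obtain ⟨k, _, rfl⟩ := Finset.mem_image.1 ho
    have := first_eq_none.1 h (Fin.castLE hd k)
    push Not at this
    obtain ⟨w, hw, hc⟩ := this k.2
    exact Finset.mem_image.2 ⟨w, by simpa [N] using hw, hc⟩
  have h1 : (N.image col).card ≤ N.card := Finset.card_image_le
  have h2 := Finset.card_le_card hsub
  have h3 : D = N.image col := Finset.eq_of_subset_of_card_le hsub (by omega)
  have h4 : Set.InjOn col N := Finset.card_image_iff.1 (by omega)
  refine ⟨fun w hw hc => ?_, fun w w' hw hw' he => h4 (by simpa [N] using hw) (by simpa [N] using hw') he, by omega⟩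
  have : col w ∈ D := h3 ▸ Finset.mem_image_of_mem _ (by simpa [N] using hw)
  rw [hc] at this
  simp [D] at this

/-- Painting along a path whose end stays uncoloured. -/
theorem PartialColoring.paintAll (hd : d ≤ m) (hdeg : ∀ v, (Finset.univ.filter (G.Adj v)).card ≤ d)
    {o : List (Fin m)} {z : Fin m} : ∀ {T : Finset (Fin m)} {col : Fin m → Option (Fin m)},
    PartialColoring G d T col → (o ++ [z]).Nodup → (∀ v ∈ o ++ [z], v ∉ T) →
    (o ++ [z]).IsChain G.Adj →
    PartialColoring G d (T ∪ o.toFinset) (ConflictAlloc.paintAll G d col o) ∧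
      ∀ v ∉ o, ConflictAlloc.paintAll G d col o v = col v := by
  induction o with
  | nil => intro T col h _ _ _; simpa [ConflictAlloc.paintAll] using h
  | cons v o ih =>
    intro T col h hnd hT hch
    obtain ⟨w, hw, hvw⟩ : ∃ w ∈ o ++ [z], G.Adj v w := by
      cases o with
      | nil => exact ⟨z, by simp, by simpa using hch⟩
      | cons w o => exact ⟨w, by simp, by simp at hch; exact hch.1⟩
    -- The next vertex of the path is still uncoloured, so the neighbours of `v` use fewer than `d`
    -- colours.
    have hfree : freeColor G d col v ≠ none := fun hf =>
      (freeColor_eq_none hd (hdeg v) hf).1 w hvw (h.eq_none (hT w (List.mem_cons_of_mem _ hw)))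
    rw [List.cons_append, List.nodup_cons] at hnd
    obtain ⟨h1, h2⟩ := ih (h.paint_of_isSome hfree) hnd.2
      (fun u hu => by
        rw [Finset.mem_insert, not_or]
        exact ⟨by rintro rfl; exact hnd.1 hu, hT u (by simp at hu ⊢; tauto)⟩)
      (by rw [List.cons_append] at hch; exact hch.tail)
    constructor
    · have : T ∪ (v :: o).toFinset = insert v T ∪ o.toFinset := by ext; simp
      rw [this]; exact h1
    · intro u hu
      simp only [List.mem_cons, not_or] at hu
      exact (h2 u hu.2).trans (Function.update_of_ne hu.1 _ _)

/-- Painting a vertex with two neighbours of the same colour. -/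
theorem PartialColoring.paint_of_eq (hd : d ≤ m) (hdeg : ∀ v, (Finset.univ.filter (G.Adj v)).card ≤ d)
    {T : Finset (Fin m)} {col : Fin m → Option (Fin m)} (h : PartialColoring G d T col)
    {v w w' : Fin m} (hw : G.Adj v w) (hw' : G.Adj v w') (hne : w ≠ w') (he : col w = col w') :
    PartialColoring G d (insert v T) (paint G d col v) :=
  h.paint_of_isSome fun hf => hne ((freeColor_eq_none hd (hdeg v) hf).2.1 w w' hw hw' he)

/-- Recolouring a cycle (given by a path whose ends are adjacent) some vertex of which has a
neighbour outside of it: the predecessor of the first such vertex gets the colour of that neighbour,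
and the others are painted along the cycle. -/
noncomputable def paintCycle (G : SimpleGraph (Fin m)) (d : ℕ) (col : Fin m → Option (Fin m))
    (c : List (Fin m)) (out : Fin m → Fin m → Prop) (v : Fin m) : Fin m → Option (Fin m) :=
  let a := c.takeWhile fun w => decide ¬ ∃ u, out w u
  let b := c.dropWhile fun w => decide ¬ ∃ u, out w u
  let x := b.headD v
  let o := a.reverse ++ b.tail.reverse
  let y := o.headD v
  paint G d (paintAll G d (Function.update col y (col ((first (out x)).getD v))) o.tail) x

/-- Let `x` be the first vertex of the cycle with a coloured neighbour `u`, and `y` its predecessor.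
As `y` has no coloured neighbour, it may copy the colour of `u`. Going from `y` backwards around the
cycle, every vertex is painted while the next one is uncoloured. Finally `x` is reached, and it has
a free colour because its neighbours `u` and `y` agree. -/
theorem PartialColoring.paintCycle (hd : d ≤ m) (hdeg : ∀ v, (Finset.univ.filter (G.Adj v)).card ≤ d)
    {T : Finset (Fin m)} {col : Fin m → Option (Fin m)} (h : PartialColoring G d T col)
    {c : List (Fin m)} (hnd : c.Nodup) (hT : ∀ v ∈ c, v ∉ T) (hch : c.IsChain G.Adj)
    {hh z : Fin m} (hhead : c.head? = some hh) (hlast : c.getLast? = some z) (hzh : G.Adj hh z)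
    {out : Fin m → Fin m → Prop} (hout : ∀ w u, out w u ↔ G.Adj w u ∧ u ∈ T)
    (hno : ∀ u, ¬ out hh u) (hex : ∃ w ∈ c, ∃ u, out w u) (v : Fin m) :
    PartialColoring G d (T ∪ c.toFinset) (ConflictAlloc.paintCycle G d col c out v) := by
  obtain ⟨a, ha⟩ : ∃ a, a = c.takeWhile fun w => decide ¬ ∃ u, out w u := ⟨_, rfl⟩
  obtain ⟨b, hb⟩ : ∃ b, b = c.dropWhile fun w => decide ¬ ∃ u, out w u := ⟨_, rfl⟩
  have hab : c = a ++ b := by rw [ha, hb, List.takeWhile_append_dropWhile]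
  have hano : ∀ w ∈ a, ∀ u, ¬ out w u := by
    intro w hw
    have := List.mem_takeWhile_imp (ha ▸ hw)
    simpa using this
  rcases b with _ | ⟨x, b⟩
  · obtain ⟨w, hw, u, hu⟩ := hex
    rw [hab, List.append_nil] at hw
    exact absurd hu (hano w hw u)
  have hx : ∃ u, out x u := by
    have := List.head_dropWhile_not (p := fun w => decide ¬ ∃ u, out w u) (l := c) (by rw [← hb]; simp)
    simp only [← hb, List.head_cons] at this
    simpa using this
  -- The head of the cycle has no coloured neighbour, so it is not `x`, and `x` has a predecessor in
  -- the list.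
  have haout : a ≠ [] := by
    rintro rfl
    rw [hab] at hhead
    simp at hhead
    subst hhead
    obtain ⟨u, hu⟩ := hx
    exact hno u hu
  obtain ⟨a, y, rfl⟩ : ∃ a' y, a = a' ++ [y] := ⟨a.dropLast, a.getLast haout, (List.dropLast_append_getLast haout).symm⟩
  unfold ConflictAlloc.paintCycle
  rw [← ha, ← hb]
  simp only [List.reverse_append, List.reverse_cons, List.reverse_nil, List.nil_append,
    List.headD_cons, List.tail_cons, List.cons_append]
  obtain ⟨u, hu, hxu⟩ := exists_first hx
  rw [hu, Option.getD_some]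
  obtain ⟨hxu, huT⟩ := (hout _ _).1 hxu
  have hyx : G.Adj y x := by
    rw [hab] at hch
    have := List.isChain_append.1 hch
    simpa using this.2.2
  have hyc : y ∈ c := by rw [hab]; simp
  obtain ⟨k, hk⟩ := Option.ne_none_iff_exists'.1 ((h.2 u).2 huT)
  rw [hk]
  have h1 := h.update (v := y) (h.1 u k hk).1 (fun w hw hc =>
    hano y (by simp) w ((hout _ _).2 ⟨hw, (h.2 w).1 (by simp [hc])⟩))
  -- The backward tour from `y` passes from the head of `c` to its last vertex; this is where the
  -- closing edge of the cycle is needed.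
  have hchain : (y :: (a.reverse ++ (x :: b).reverse)).IsChain G.Adj := by
    have e : y :: (a.reverse ++ (x :: b).reverse) = (a ++ [y]).reverse ++ (x :: b).reverse := by simp
    rw [e]
    rw [hab] at hch
    obtain ⟨h2, h3, -⟩ := List.isChain_append.1 hch
    refine List.isChain_append.2 ⟨?_, ?_, ?_⟩
    · rw [List.isChain_reverse]; exact h2.imp fun _ _ h => h.symm
    · rw [List.isChain_reverse]; exact h3.imp fun _ _ h => h.symm
    · intro p hp q hq
      rw [List.getLast?_reverse] at hp
      rw [List.head?_reverse] at hq
      have : c.head? = some p := by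
        rw [hab, List.head?_append]; rw [Option.mem_def] at hp; rw [hp]; rfl
      have hq' : c.getLast? = some q := by
        rw [hab, List.getLast?_append]; rw [Option.mem_def] at hq; rw [hq]; rfl
      rw [hhead] at this
      rw [hlast] at hq'
      obtain rfl := Option.some.inj this
      obtain rfl := Option.some.inj hq'
      exact hzh
  have hnd' : (y :: (a.reverse ++ b.reverse ++ [x])).Nodup := by
    refine (List.Perm.nodup_iff ?_).1 hnd
    rw [hab]
    refine (List.perm_iff_count).2 fun e => ?_
    simp [List.count_cons, List.count_append]; omega
  rw [List.nodup_cons] at hnd'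
  obtain ⟨h2, h3⟩ := h1.paintAll hd hdeg (o := a.reverse ++ b.reverse) (z := x) hnd'.2
    (fun w hw => by
      rw [Finset.mem_insert, not_or]
      refine ⟨by rintro rfl; exact hnd'.1 hw, hT w ?_⟩
      rw [hab]; simp at hw ⊢; tauto)
    (by simpa using hchain.tail)
  have hyu : u ≠ y := by rintro rfl; exact hT _ hyc huT
  have h4 := h2.paint_of_eq hd hdeg (v := x) (w := u) (w' := y) hxu hyx.symm hyu (by
    rw [h3 u, h3 y, Function.update_self, Function.update_of_ne hyu, hk]
    · intro hy; exact hnd'.1 (List.mem_append_left _ hy)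
    · intro hu'; exact hT u (by rw [hab]; simp at hu' ⊢; tauto) huT)
  convert h4 using 1
  rw [hab]
  ext; simp; tauto

end coloring

end ConflictAlloc

namespace ConflictAlloc

open Classical

/-! ### Brooks' theorem: recolouring along a maximal path -/

section coloring

variable {m : ℕ} {G : SimpleGraph (Fin m)} {d : ℕ}

/-- Painting a path `x, v, y, …` none of whose vertices has a coloured neighbour: the ends `x` and
`y` of the first two edges get the same colour, and `v` is painted last. -/
noncomputable def paintClosed (G : SimpleGraph (Fin m)) (d : ℕ) (col : Fin m → Option (Fin m))
    (l : List (Fin m)) (v x y : Fin m) : Fin m → Option (Fin m) :=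
  let col₁ := paint G d col x
  let col₂ := Function.update col₁ y (col₁ x)
  let q := l.takeWhile fun w => decide ¬ G.Adj v w
  let p := l.dropWhile fun w => decide ¬ G.Adj v w
  paint G d (paintAll G d (paintAll G d col₂ q) p.reverse) v

/-- Nothing coloured is adjacent to the path and `x`, `y` are not adjacent, so `y` may copy the
colour of `x`. Let `w` be the first vertex of `l` adjacent to `v`. The vertices before `w` are
painted forwards, with `w` still uncoloured; the others are painted from the far end back to `w`,
with `v` still uncoloured. At last `v` sees one colour on both `x` and `y`. -/
theorem PartialColoring.paintClosed (hd : d ≤ m) (hdeg : ∀ v, (Finset.univ.filter (G.Adj v)).card ≤ d)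
    {T : Finset (Fin m)} {col : Fin m → Option (Fin m)} (h : PartialColoring G d T col)
    {l : List (Fin m)} {v x y : Fin m} (hnd : (x :: v :: y :: l).Nodup)
    (hT : ∀ w ∈ x :: v :: y :: l, w ∉ T) (hch : (x :: v :: y :: l).IsChain G.Adj)
    (hclosed : ∀ w ∈ x :: v :: y :: l, ∀ u, G.Adj w u → u ∉ T) (hxy : ¬ G.Adj x y)
    (hex : ∃ w ∈ l, G.Adj v w) :
    PartialColoring G d (T ∪ (x :: v :: y :: l).toFinset) (ConflictAlloc.paintClosed G d col l v x y) := by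
  obtain ⟨q, hq⟩ : ∃ q, q = l.takeWhile fun w => decide ¬ G.Adj v w := ⟨_, rfl⟩
  obtain ⟨p, hp⟩ : ∃ p, p = l.dropWhile fun w => decide ¬ G.Adj v w := ⟨_, rfl⟩
  have hl : l = q ++ p := by rw [hq, hp, List.takeWhile_append_dropWhile]
  rcases p with _ | ⟨w, p⟩
  · obtain ⟨w, hw, hvw⟩ := hex
    rw [hl, List.append_nil, hq] at hw
    have := List.mem_takeWhile_imp hw
    simp [hvw] at this
  have hvw : G.Adj v w := by
    have := List.head_dropWhile_not (p := fun w => decide ¬ G.Adj v w) (l := l) (by rw [← hp]; simp)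
    simp only [← hp, List.head_cons] at this
    simpa using this
  unfold ConflictAlloc.paintClosed
  simp only [← hq, ← hp]
  simp only [List.isChain_cons_cons] at hch
  obtain ⟨hxv, hvy, hch⟩ := hch
  have hfree : freeColor G d col x ≠ none := fun hf =>
    (freeColor_eq_none hd (hdeg x) hf).1 v hxv (h.eq_none (hT v (by simp)))
  obtain ⟨k, hk⟩ := Option.ne_none_iff_exists'.1 hfree
  have h1 := h.paint_of_isSome hfree
  have hxk : paint G d col x x = some k := by rw [paint, Function.update_self, hk]
  have h2 := h1.update (v := y) (h1.1 x k hxk).1 (fun u hu hc => by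
    have := (h1.2 u).1 (by simp [hc])
    rcases Finset.mem_insert.1 this with rfl | hu'
    · exact hxy hu.symm
    · exact hclosed y (by simp) u hu hu')
  rw [← hxk] at h2
  rw [hl] at hnd hT hch
  simp only [List.nodup_cons, List.mem_cons, List.mem_append, not_or] at hnd
  obtain ⟨⟨hxv', hxy', hxq, hxw, hxp⟩, ⟨hvy', hvq, hvw', hvp⟩, ⟨hyq, hyw, hyp⟩, hnd⟩ := hnd
  have hnd₂ : (q ++ [w]).Nodup := hnd.sublist (by simp)
  have hnd₃ : ((w :: p).reverse ++ [v]).Nodup := by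
    have : (w :: p).Nodup := hnd.sublist (by simp)
    rw [List.nodup_append]
    refine ⟨List.nodup_reverse.2 this, by simp, ?_⟩
    rintro a ha b hb rfl
    simp at ha hb
    subst hb
    rcases ha with ha | rfl
    · exact hvp ha
    · exact hvw' rfl
  have hch' := hch.tail
  simp only [List.tail_cons] at hch'
  obtain ⟨h3, h3'⟩ := h2.paintAll hd hdeg (o := q) (z := w) hnd₂
    (fun u hu => by
      simp only [Finset.mem_insert, not_or]
      simp only [List.mem_append, List.mem_singleton] at hu
      refine ⟨?_, ?_, hT u (by simp; tauto)⟩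
      · rintro rfl; rcases hu with hu | rfl
        · exact hyq hu
        · exact hyw rfl
      · rintro rfl; rcases hu with hu | rfl
        · exact hxq hu
        · exact hxw rfl)
    (hch'.prefix ⟨p, by simp⟩)
  obtain ⟨h4, h4'⟩ := h3.paintAll hd hdeg (o := (w :: p).reverse) (z := v) hnd₃
    (fun u hu => by
      simp only [Finset.mem_insert, Finset.mem_union, List.mem_toFinset, not_or]
      simp only [List.reverse_cons, List.mem_append, List.mem_singleton, List.mem_reverse] at hu
      refine ⟨⟨?_, ?_, hT u (by simp; tauto)⟩, ?_⟩
      · rintro rfl; rcases hu with (hu | rfl) | rfl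
        · exact hyp hu
        · exact hyw rfl
        · exact hvy' rfl
      · rintro rfl; rcases hu with (hu | rfl) | rfl
        · exact hxp hu
        · exact hxw rfl
        · exact hxv' rfl
      · intro huq
        rw [List.nodup_append] at hnd
        rcases hu with (hu | rfl) | rfl
        · exact hnd.2.2 u huq u (by simp [hu]) rfl
        · exact hnd.2.2 u huq u (by simp) rfl
        · exact hvq huq)
    (by
      rw [← List.reverse_cons, List.isChain_reverse]
      exact (List.IsChain.cons hch'.right_of_append (by simpa using hvw)).imp fun _ _ h => SimpleGraph.Adj.symm h)
  have h5 := h4.paint_of_eq hd hdeg (v := v) (w := x) (w' := y) hxv.symm hvy hxy' (by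
    rw [h4' x (by simp; tauto), h4' y (by simp; tauto), h3' x hxq, h3' y hyq, Function.update_self,
      Function.update_of_ne hxy'])
  convert h5 using 1
  rw [hl]
  ext; simp; tauto

/-- One step of extending a path (given by its vertices, the last one first, and the set of its
vertices) inside `T`. -/
noncomputable def growStep (G : SimpleGraph (Fin m)) (T : Finset (Fin m)) (v : Fin m)
    (s : List (Fin m) × Finset (Fin m)) : List (Fin m) × Finset (Fin m) :=
  (first fun w => w ∈ T ∧ w ∉ s.2 ∧ G.Adj (s.1.headD v) w).elim s
    fun w => (w :: s.1, insert w s.2)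

/-- A maximal path in `T` beginning with `x, v, y`. -/
noncomputable def growPath (G : SimpleGraph (Fin m)) (T : Finset (Fin m)) (v x y : Fin m) :
    List (Fin m) × Finset (Fin m) :=
  (growStep G T v)^[m] ([y, v, x], {y, v, x})

/-- A path that grew in all `m` steps would have `m + 3` distinct vertices. So it got stuck, and
then every neighbour in `T` of its head, the vertex added last, lies on the path. -/
theorem growPath_spec {T : Finset (Fin m)} {v x y : Fin m} (hvT : v ∈ T) (hxT : x ∈ T) (hyT : y ∈ T)
    (hvx : G.Adj v x) (hvy : G.Adj v y) (hxy : x ≠ y) :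
    ∃ h l, (growPath G T v x y).1 = h :: l ∧ (growPath G T v x y).2 = (h :: l).toFinset ∧
      (h :: l).Nodup ∧ (h :: l).IsChain G.Adj ∧ (∀ w ∈ h :: l, w ∈ T) ∧ [y, v, x] <:+ h :: l ∧
      ∀ w ∈ T, G.Adj h w → w ∈ h :: l := by
  have inv : ∀ k, ∃ h l, (growStep G T v)^[k] ([y, v, x], {y, v, x}) = (h :: l, (h :: l).toFinset) ∧
      (h :: l).Nodup ∧ (h :: l).IsChain G.Adj ∧ (∀ w ∈ h :: l, w ∈ T) ∧ [y, v, x] <:+ h :: l ∧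
      ((∀ w ∈ T, G.Adj h w → w ∈ h :: l) ∨ (h :: l).length = k + 3) := by
    intro k
    induction k with
    | zero =>
      refine ⟨y, [v, x], ?_, ?_, ?_, ?_, List.suffix_refl _, .inr rfl⟩
      · simp
      · simp [hvy.ne', hvx.ne, hxy.symm]
      · simp [hvy.symm, hvx]
      · simp [hvT, hxT, hyT]
    | succ k ih =>
      obtain ⟨h, l, he, hnd, hch, hT, hsuf, hlen⟩ := ih
      rw [Function.iterate_succ_apply', he]
      rcases hf : first fun w => w ∈ T ∧ w ∉ (h :: l).toFinset ∧ G.Adj h w with _ | w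
      · refine ⟨h, l, ?_, hnd, hch, hT, hsuf, .inl ?_⟩
        · simp only [growStep, List.headD_cons, hf, Option.elim]
        · intro w hw hhw
          by_contra hc
          exact first_eq_none.1 hf w ⟨hw, by simpa using hc, hhw⟩
      · obtain ⟨h1, h2, h3⟩ := first_some hf
        refine ⟨w, h :: l, ?_, ?_, ?_, ?_, hsuf.trans (List.suffix_cons _ _), ?_⟩
        · simp only [growStep, List.headD_cons, hf, Option.elim, List.toFinset_cons (a := w)]
        · exact List.nodup_cons.2 ⟨by simpa using h2, hnd⟩
        · exact List.isChain_cons_cons.2 ⟨h3.symm, hch⟩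
        · rintro u hu
          rcases List.mem_cons.1 hu with rfl | hu
          · exact h1
          · exact hT u hu
        · rcases hlen with hlen | hlen
          · exact absurd (hlen w h1 h3) (by simpa using h2)
          · right; rw [List.length_cons, hlen]
  obtain ⟨h, l, he, hnd, hch, hT, hsuf, hlen⟩ := inv m
  refine ⟨h, l, by rw [growPath, he], by rw [growPath, he], hnd, hch, hT, hsuf, ?_⟩
  rcases hlen with hlen | hlen
  · exact hlen
  · have := hnd.length_le_card
    simp at this hlen
    omega

/-- Recolouring along a maximal path through the uncoloured vertex `v` and its nonadjacent
neighbours `x` and `y`. -/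
noncomputable def reroute (G : SimpleGraph (Fin m)) (d : ℕ) (col : Fin m → Option (Fin m))
    (v x y : Fin m) : Fin m → Option (Fin m) :=
  let s := growPath G (Finset.univ.filter fun w => w = v ∨ col w ≠ none) v x y
  let h := s.1.headD v
  let r := s.1.reverse
  let lead := r.takeWhile fun w => decide ¬ G.Adj h w
  let cyc := (r.dropWhile fun w => decide ¬ G.Adj h w).reverse
  let col₁ := fun w => if w ∈ s.2 then none else col w
  let col₂ := paintAll G d col₁ lead
  if ∃ w, w ∈ cyc ∧ ∃ u, G.Adj w u ∧ col₂ u ≠ none then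
    paintCycle G d col₂ cyc (fun w u => G.Adj w u ∧ col₂ u ≠ none) v
  else paintClosed G d col₁ r.tail.tail.tail v x y

theorem PartialColoring.erase {T : Finset (Fin m)} {col : Fin m → Option (Fin m)}
    (h : PartialColoring G d T col) (S : Finset (Fin m)) :
    PartialColoring G d (T \ S) (fun w => if w ∈ S then none else col w) := by
  constructor
  · intro v k hv
    dsimp only at hv
    split_ifs at hv
    refine ⟨(h.1 v k hv).1, fun w hw => ?_⟩
    dsimp only
    split_ifs
    · simp
    · exact (h.1 v k hv).2 w hw
  · intro v
    dsimp only
    split_ifs with hv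
    · simp [hv]
    · rw [h.2]; simp [hv]

/-- Two colourings of a path with two colours agree up to a permutation of the colours. -/
theorem PartialColoring.parity {T : Finset (Fin m)} {col : Fin m → Option (Fin m)}
    (h : PartialColoring G 2 T col) {f : Fin m → Fin 2}
    (hf : ∀ a ∈ T, ∀ b ∈ T, G.Adj a b → f a ≠ f b) {l : List (Fin m)} (hT : ∀ w ∈ l, w ∈ T)
    (hch : l.IsChain G.Adj) :
    ∃ e, ∀ w ∈ l, (∃ k, col w = some k ∧ k.val = 0) ↔ f w = e := by
  induction l with
  | nil => exact ⟨0, by simp⟩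
  | cons a l ih =>
    obtain ⟨ka, hka⟩ := Option.ne_none_iff_exists'.1 ((h.2 a).2 (hT a (by simp)))
    have hka2 := (h.1 a ka hka).1
    obtain _ | ⟨b, l⟩ := l
    · by_cases h0 : ka.val = 0
      · exact ⟨f a, by simp [hka, h0]⟩
      · refine ⟨f a + 1, ?_⟩
        simp only [List.mem_singleton, forall_eq, hka, Option.some.injEq, exists_eq_left', h0, false_iff]
        generalize f a = z
        revert z; decide
    · obtain ⟨e, he⟩ := ih (fun w hw => hT w (List.mem_cons_of_mem _ hw)) hch.tail
      refine ⟨e, ?_⟩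
      intro w hw
      rcases List.mem_cons.1 hw with rfl | hw
      · have hab : G.Adj w b := (List.isChain_cons_cons.1 hch).1
        have h1 := hf w (hT w (by simp)) b (hT b (by simp)) hab
        have h2 := he b (by simp)
        obtain ⟨kb, hkb⟩ := Option.ne_none_iff_exists'.1 ((h.2 b).2 (hT b (by simp)))
        have hkb2 := (h.1 b kb hkb).1
        have h3 : kb.val ≠ ka.val := fun hc => (h.1 w ka hka).2 b hab (by rw [hkb, Fin.ext hc])
        simp only [hkb, Option.some.injEq, exists_eq_left'] at h2
        simp only [hka, Option.some.injEq, exists_eq_left']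
        have h4 : ka.val = 0 ↔ ¬ kb.val = 0 := by omega
        rw [h4, h2]
        clear he h2 hch hT ih
        revert h1
        generalize f w = p
        generalize f b = q
        revert p q e; decide
      · exact he w hw

/-- The path `x, v, y, …, hh` is maximal at `hh`. Let `z` be the first of its vertices adjacent to
`hh`; then `z, …, hh` closes up to a cycle. The path is uncoloured and the part before `z` repainted
towards `z`. If some vertex of the cycle now has a coloured neighbour, `paintCycle` applies, since
`hh` has none by maximality. Otherwise the path is isolated from all coloured vertices and
`paintClosed` applies, provided that `v` has a third neighbour. If it had none, `d` would be `2` and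
the cycle would be odd, contradicting the colouring `f`. -/
theorem PartialColoring.reroute (hd : d ≤ m) (hdeg : ∀ v, (Finset.univ.filter (G.Adj v)).card ≤ d)
    {T : Finset (Fin m)} {col : Fin m → Option (Fin m)} (h : PartialColoring G d T col)
    {v x y : Fin m} (hv : v ∉ T) (hvx : G.Adj v x) (hvy : G.Adj v y) (hxy : x ≠ y) (hxy' : ¬ G.Adj x y)
    (hfree : freeColor G d col v = none)
    {f : Fin m → Fin d} (hf : ∀ a ∈ insert v T, ∀ b ∈ insert v T, G.Adj a b → f a ≠ f b) :
    PartialColoring G d (insert v T) (ConflictAlloc.reroute G d col v x y) := by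
  obtain ⟨hN, hinj, hcard⟩ := freeColor_eq_none hd (hdeg v) hfree
  have hT : (Finset.univ.filter fun w => w = v ∨ col w ≠ none) = insert v T := by
    ext w; simp [h.2, -ne_eq]
  have hxT := (h.2 x).1 (hN x hvx)
  have hyT := (h.2 y).1 (hN y hvy)
  obtain ⟨hh, l, hs1, hs2, hnd, hch, hLT, hsuf, hmax⟩ := growPath_spec (T := insert v T)
    (by simp) (by simp [hxT]) (by simp [hyT]) hvx hvy hxy
  unfold ConflictAlloc.reroute
  rw [hT]
  simp only [hs1, hs2, List.headD_cons]
  obtain ⟨lead, hlead⟩ : ∃ a, a = (hh :: l).reverse.takeWhile fun w => decide ¬ G.Adj hh w := ⟨_, rfl⟩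
  obtain ⟨cf, hcf⟩ : ∃ a, a = (hh :: l).reverse.dropWhile fun w => decide ¬ G.Adj hh w := ⟨_, rfl⟩
  rw [← hlead, ← hcf]
  have hr : (hh :: l).reverse = lead ++ cf := by rw [hlead, hcf, List.takeWhile_append_dropWhile]
  have hleadadj : ∀ w ∈ lead, ¬ G.Adj hh w := fun w hw => by
    have := List.mem_takeWhile_imp (hlead ▸ hw)
    simpa using this
  have hmem : ∀ w, w ∈ hh :: l ↔ w ∈ lead ∨ w ∈ cf := fun w => by
    rw [← List.mem_reverse, hr, List.mem_append]
  have hrch : (lead ++ cf).IsChain G.Adj := by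
    rw [← hr, List.isChain_reverse]; exact hch.imp fun _ _ h => h.symm
  have hrnd : (lead ++ cf).Nodup := by rw [← hr]; exact List.nodup_reverse.2 hnd
  obtain ⟨r0, hr0⟩ := hsuf
  have hr0' : (hh :: l).reverse = x :: v :: y :: r0.reverse := by rw [← hr0]; simp
  -- The path vertex before `hh` is adjacent to it, so the search for `z` succeeds.
  rcases cf with _ | ⟨z, cf⟩
  · obtain ⟨h2, l', rfl⟩ : ∃ h2 l', l = h2 :: l' := by
      cases l with
      | nil => have := congrArg List.length hr0; simp at this
      | cons a b => exact ⟨a, b, rfl⟩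
    have h3 : G.Adj hh h2 := (List.isChain_cons_cons.1 hch).1
    have h4 := (hmem h2).1 (by simp)
    simp only [List.not_mem_nil, or_false] at h4
    exact absurd h3 (hleadadj _ h4)
  have hz : G.Adj hh z := by
    have := List.head_dropWhile_not (p := fun w => decide ¬ G.Adj hh w) (l := (hh :: l).reverse) (by rw [← hcf]; simp)
    simp only [← hcf, List.head_cons] at this
    simpa using this
  set col₁ : Fin m → Option (Fin m) := fun w => if w ∈ (hh :: l).toFinset then none else col w
  have h1 : PartialColoring G d (T \ (hh :: l).toFinset) col₁ := h.erase _
  obtain ⟨h2, -⟩ := h1.paintAll hd hdeg (o := lead) (z := z) (hrnd.sublist (by simp))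
    (fun w hw => by
      have : w ∈ hh :: l := by rw [hmem]; simp at hw ⊢; tauto
      simp only [Finset.mem_sdiff, List.mem_toFinset, this, not_true, and_false, not_false_eq_true])
    (hrch.prefix ⟨cf, by simp⟩)
  have hvL : v ∈ hh :: l := by rw [← hr0]; simp
  have hset : ∀ w, w ∈ T \ (hh :: l).toFinset ∪ lead.toFinset ↔ w ∈ insert v T ∧ w ∉ z :: cf := by
    intro w
    simp only [Finset.mem_union, Finset.mem_sdiff, List.mem_toFinset, Finset.mem_insert]
    have h5 := hmem w
    have h6 : w ∈ lead → w ∉ z :: cf := fun h7 h8 => (List.nodup_append.1 hrnd).2.2 w h7 w h8 rfl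
    have h7 : w ∈ hh :: l → w = v ∨ w ∈ T := fun hw => by simpa using hLT w hw
    have h8 : w = v → w ∈ hh :: l := by rintro rfl; exact hvL
    tauto
  set col₂ := ConflictAlloc.paintAll G d col₁ lead
  have hcol₂ : ∀ w, col₂ w ≠ none ↔ w ∈ insert v T ∧ w ∉ z :: cf := fun w => by rw [h2.2, hset]
  split_ifs with hout
  · obtain ⟨w, hw, hwu⟩ := hout
    have hlast : (z :: cf).reverse.head? = some hh := by
      rw [List.head?_reverse]
      have : (hh :: l).reverse.getLast? = some hh := by simp
      rw [hr, List.getLast?_append_of_ne_nil _ (by simp)] at this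
      exact this
    have := h2.paintCycle hd hdeg (c := (z :: cf).reverse) (hh := hh) (z := z)
      (out := fun w u => G.Adj w u ∧ col₂ u ≠ none)
      (List.nodup_reverse.2 (hrnd.sublist (by simp)))
      (fun w hw => by rw [hset]; simp at hw ⊢; tauto)
      (by rw [List.isChain_reverse]; exact hrch.right_of_append.imp fun _ _ h => h.symm)
      hlast (by simp) hz (fun w u => by rw [h2.2]) (fun u hu => by
        obtain ⟨h3, h4⟩ := hu
        rw [hcol₂] at h4
        have h5 := (hmem u).1 (hmax u h4.1 h3)
        rcases h5 with h5 | h5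
        · exact hleadadj u h5 h3
        · exact h4.2 h5) ⟨w, hw, hwu⟩ v
    convert this using 1
    ext w
    rw [Finset.mem_union, hset]
    rw [List.mem_toFinset, List.mem_reverse]
    by_cases hw : w ∈ z :: cf
    · simp only [hw, not_true, and_false, or_true, iff_true]
      exact hLT w ((hmem w).2 (.inr hw))
    · simp only [hw, not_false_eq_true, and_true, or_false]
  · push Not at hout
    -- The last vertex of a nonempty initial part would be a coloured neighbour of `z`. So `z = x`,
    -- and the cycle is the whole path.
    obtain rfl : lead = [] := by
      by_contra hne
      have h3 : G.Adj (lead.getLast hne) z := by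
        have := (List.isChain_append.1 hrch).2.2
        exact this _ (List.getLast?_eq_getLast_of_ne_nil hne) _ (by simp)
      have h4 := hout z (by simp) _ h3.symm
      have h5 : lead.getLast hne ∈ T \ (hh :: l).toFinset ∪ lead.toFinset := by simp
      exact (h2.2 _).2 h5 h4
    rw [List.nil_append] at hr hrch hrnd
    have hcol21 : col₂ = col₁ := rfl
    have hmem' : ∀ w, w ∈ x :: v :: y :: r0.reverse ↔ w ∈ hh :: l := fun w => by
      rw [← hr0', List.mem_reverse]
    rw [hr0'] at hr ⊢
    rw [← hr] at hrch hrnd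
    have hNL : ∀ w, G.Adj v w → w ∈ hh :: l := by
      intro w hw
      by_contra hc
      have h3 := hout v (by rw [List.mem_reverse, ← hr]; simp) w hw
      rw [hcol21] at h3
      simp only [col₁, List.mem_toFinset, hc, if_false] at h3
      exact hN w hw h3
    -- All neighbours of `v` were coloured before the path was erased; as none outside may be
    -- coloured now, all of them lie on the path. Without a third one, `d = 2`.
    have key : ∃ w ∈ r0.reverse, G.Adj v w := by
      by_contra! hc
      have hsub : Finset.univ.filter (G.Adj v) = {x, y} := by
        ext w
        simp only [Finset.mem_filter, Finset.mem_univ, true_and, Finset.mem_insert, Finset.mem_singleton]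
        constructor
        · intro hw
          have h3 := (hmem' w).2 (hNL w hw)
          simp only [List.mem_cons] at h3
          rcases h3 with h3 | rfl | h3 | h3
          · exact .inl h3
          · exact absurd hw (G.loopless.irrefl _)
          · exact .inr h3
          · exact absurd hw (hc w h3)
        · rintro (rfl | rfl)
          · exact hvx
          · exact hvy
      rw [hsub, Finset.card_pair hxy] at hcard
      subst hcard
      -- The cycle without `v`, a path from `y` to `x`. The colouring `f` agrees at its ends, hence
      -- so does `col` by `parity`; but the neighbours of `v` have different colours.
      have hlist : (y :: r0.reverse ++ [x]).IsChain G.Adj := by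
        simp only [List.isChain_cons_cons] at hrch
        refine List.isChain_append.2 ⟨hrch.2.2, by simp, ?_⟩
        intro p hp q hq
        have h5 : (hh :: l).reverse.getLast? = some hh := by simp
        rw [hr0', List.getLast?_cons_cons, List.getLast?_cons_cons] at h5
        rw [Option.mem_def, h5] at hp
        obtain rfl := Option.some.inj hp
        obtain rfl : x = q := by simpa using hq
        rw [List.cons.injEq] at hr
        rw [hr.1]; exact hz
      have hvnot : ∀ w ∈ y :: r0.reverse ++ [x], w ∈ T := by
        intro w hw
        have h3 : w ∈ hh :: l := (hmem' w).1 (by simp at hw ⊢; tauto)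
        have h4 := hLT w h3
        refine (Finset.mem_insert.1 h4).resolve_left ?_
        rintro rfl
        simp only [List.nodup_cons, List.mem_cons, not_or] at hrnd
        simp only [List.cons_append, List.mem_cons, List.mem_append, List.not_mem_nil, or_false] at hw
        tauto
      obtain ⟨e, he⟩ := h.parity (fun a ha b hb => hf a (Finset.mem_insert_of_mem ha) b (Finset.mem_insert_of_mem hb)) hvnot hlist
      have hex := he x (by simp)
      have hey := he y (by simp)
      have hfx := hf v (by simp) x (by simp [hxT]) hvx
      have hfy := hf v (by simp) y (by simp [hyT]) hvy
      have hfxy : f x = f y := by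
        revert hfx hfy
        generalize f x = p
        generalize f y = q
        generalize f v = r
        revert p q r; decide
      obtain ⟨kx, hkx⟩ := Option.ne_none_iff_exists'.1 (hN x hvx)
      obtain ⟨ky, hky⟩ := Option.ne_none_iff_exists'.1 (hN y hvy)
      have h6 := (h.1 x kx hkx).1
      have h7 := (h.1 y ky hky).1
      simp only [hkx, hky, Option.some.injEq, exists_eq_left', hfxy] at hex hey
      have h8 : kx = ky := by
        apply Fin.ext
        have := hex.trans hey.symm
        omega
      exact hxy (hinj x y hvx hvy (by rw [hkx, hky, h8]))
    have := h1.paintClosed hd hdeg (l := r0.reverse) (v := v) (x := x) (y := y) hrnd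
      (fun w hw => by
        rw [hmem'] at hw
        simp only [Finset.mem_sdiff, List.mem_toFinset, hw, not_true, and_false, not_false_eq_true])
      hrch (fun w hw u hwu hu => by
        have h3 := hout w (by rw [List.mem_reverse, ← hr]; exact hw) u hwu
        rw [hcol21] at h3
        exact (h1.2 u).2 hu h3) hxy' key
    have hs : T \ (hh :: l).toFinset ∪ (x :: v :: y :: r0.reverse).toFinset = insert v T := by
      ext w
      rw [Finset.mem_union, List.mem_toFinset, hmem', Finset.mem_sdiff, List.mem_toFinset]
      by_cases hw : w ∈ hh :: l
      · simp only [hw, or_true, true_iff]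
        exact hLT w hw
      · simp only [hw, not_false_eq_true, and_true, or_false, Finset.mem_insert, iff_or_self]
        rintro rfl
        exact absurd hvL hw
    rw [hs] at this
    exact this

/-- Colour one more vertex. -/
noncomputable def extendColoring (G : SimpleGraph (Fin m)) (d : ℕ) (col : Fin m → Option (Fin m))
    (v : Fin m) : Fin m → Option (Fin m) :=
  let x := (first fun x => G.Adj v x ∧ ∃ y, G.Adj v y ∧ x ≠ y ∧ ¬ G.Adj x y).getD v
  let y := (first fun y => G.Adj v y ∧ x ≠ y ∧ ¬ G.Adj x y).getD v
  if freeColor G d col v = none then reroute G d col v x y else paint G d col v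

/-- Colour the vertices of `S` one after the other. -/
noncomputable def colorSet (G : SimpleGraph (Fin m)) (d : ℕ) (S : Finset (Fin m)) :
    Fin m → Option (Fin m) :=
  (List.finRange m).foldl (fun col v => if v ∈ S then extendColoring G d col v else col) fun _ => none

/-- If no colour is free, `v` has exactly `d` neighbours, all coloured. This excludes the first
alternative of `hf`. In the second, the neighbours cannot be pairwise adjacent, as `f` would need `d
+ 1` colours; so nonadjacent neighbours `x` and `y` exist for `reroute`. -/
theorem PartialColoring.extendColoring (hd : d ≤ m) (hdeg : ∀ v, (Finset.univ.filter (G.Adj v)).card ≤ d)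
    {T : Finset (Fin m)} {col : Fin m → Option (Fin m)} (h : PartialColoring G d T col)
    {v : Fin m} (hv : v ∉ T)
    (hf : (∀ v, (Finset.univ.filter (G.Adj v)).card < d) ∨
      ∃ f : Fin m → Fin d, ∀ a ∈ insert v T, ∀ b ∈ insert v T, G.Adj a b → f a ≠ f b) :
    PartialColoring G d (insert v T) (ConflictAlloc.extendColoring G d col v) := by
  unfold ConflictAlloc.extendColoring
  dsimp only
  split_ifs with hfree
  swap
  · exact h.paint_of_isSome hfree
  obtain ⟨hN, hinj, hcard⟩ := freeColor_eq_none hd (hdeg v) hfree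
  rcases hf with hf | ⟨f, hf⟩
  · exact absurd hcard (hf v).ne
  have hex : ∃ x, G.Adj v x ∧ ∃ y, G.Adj v y ∧ x ≠ y ∧ ¬ G.Adj x y := by
    by_contra! hc
    set N := Finset.univ.filter (G.Adj v)
    have hNmem : ∀ w, w ∈ N ↔ G.Adj v w := fun w => by simp [N]
    have hNT : ∀ w ∈ insert v N, w ∈ insert v T := by
      intro w hw
      rcases Finset.mem_insert.1 hw with rfl | hw
      · simp
      · exact Finset.mem_insert_of_mem ((h.2 w).1 (hN w ((hNmem w).1 hw)))
    have hinjf : Set.InjOn f (insert v N : Finset (Fin m)) := by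
      intro a ha b hb hab
      by_contra hne
      have ha' := Finset.mem_insert.1 (Finset.mem_coe.1 ha)
      have hb' := Finset.mem_insert.1 (Finset.mem_coe.1 hb)
      refine hf a (hNT a ha) b (hNT b hb) ?_ hab
      rcases ha' with rfl | ha' <;> rcases hb' with rfl | hb'
      · exact absurd rfl hne
      · exact (hNmem b).1 hb'
      · exact ((hNmem a).1 ha').symm
      · exact hc a ((hNmem a).1 ha') b ((hNmem b).1 hb') hne
    have h1 := Finset.card_image_of_injOn hinjf
    have h2 := Finset.card_le_univ ((insert v N).image f)
    rw [h1, Finset.card_insert_of_notMem (by rw [hNmem]; exact G.loopless.irrefl v), hcard, Fintype.card_fin] at h2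
    omega
  obtain ⟨x, hx, hvx, hy⟩ := exists_first hex
  rw [hx, Option.getD_some]
  obtain ⟨y, hy, hvy, hxy, hxy'⟩ := exists_first hy
  rw [hy, Option.getD_some]
  exact h.reroute hd hdeg hv hvx hvy hxy hxy' hfree hf

/-- The first alternative serves the colouring with `Δ + 1` colours, the second the one with `Δ`
colours. A colouring `f` of `S` restricts to each subset reached on the way. -/
theorem partialColoring_colorSet (hd : d ≤ m) (hdeg : ∀ v, (Finset.univ.filter (G.Adj v)).card ≤ d)
    {S : Finset (Fin m)}
    (hf : (∀ v, (Finset.univ.filter (G.Adj v)).card < d) ∨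
      ∃ f : Fin m → Fin d, ∀ a ∈ S, ∀ b ∈ S, G.Adj a b → f a ≠ f b) :
    PartialColoring G d S (colorSet G d S) := by
  have key : ∀ l : List (Fin m), ∀ T col, PartialColoring G d T col → T ⊆ S → l.Nodup →
      (∀ v ∈ l, v ∉ T) → PartialColoring G d (T ∪ l.toFinset ∩ S)
        (l.foldl (fun col v => if v ∈ S then extendColoring G d col v else col) col) := by
    intro l
    induction l with
    | nil => intro T col h _ _ _; simpa using h
    | cons v l ih =>
      intro T col h hTS hnd hl
      rw [List.nodup_cons] at hnd
      rw [List.foldl_cons]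
      split_ifs with hv
      · have hsub : insert v T ⊆ S := Finset.insert_subset hv hTS
        have := ih (insert v T) _ (h.extendColoring hd hdeg (hl v (by simp))
          (hf.imp id fun ⟨f, hf⟩ => ⟨f, fun a ha b hb => hf a (hsub ha) b (hsub hb)⟩)) hsub hnd.2
          (fun w hw => by
            rw [Finset.mem_insert, not_or]
            exact ⟨by rintro rfl; exact hnd.1 hw, hl w (by simp [hw])⟩)
        convert this using 1
        ext w; simp; constructor
        · rintro (h | ⟨rfl | h, h'⟩) <;> tauto
        · rintro (rfl | h | h) <;> tauto
      · have := ih T _ h hTS hnd.2 (fun w hw => hl w (by simp [hw]))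
        convert this using 1
        ext w; simp; constructor
        · rintro (h | ⟨rfl | h, h'⟩) <;> tauto
        · rintro (h | h) <;> tauto
  have := key (List.finRange m) ∅ (fun _ => none) ⟨by simp, by simp⟩ (by simp) (List.nodup_finRange m) (by simp)
  simpa [colorSet] using this

end coloring

end ConflictAlloc

namespace ConflictAlloc

open Classical

/-! ### Deciding colourability, components, least transversals -/

section components

variable {m : ℕ} {G : SimpleGraph (Fin m)} {d : ℕ}

theorem colorableOn_iff (hd : 0 < d) {S : Finset (Fin m)} :
    ColorableOn G S d ↔ ∃ f : Fin m → Fin d, ∀ a ∈ S, ∀ b ∈ S, G.Adj a b → f a ≠ f b := by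
  constructor
  · rintro ⟨c⟩
    refine ⟨fun v => if h : v ∈ S then c ⟨v, h⟩ else ⟨0, hd⟩, fun a ha b hb hab => ?_⟩
    simp only [ha, hb, dif_pos]
    exact c.valid (v := ⟨a, ha⟩) (w := ⟨b, hb⟩) hab
  · rintro ⟨f, hf⟩
    exact ⟨SimpleGraph.Coloring.mk (fun v => f v.1) fun {v w} h => hf v.1 v.2 w.1 w.2 h⟩

/-- All vertices of `S` are coloured, properly and with colours below `d`. -/
def ValidOn (G : SimpleGraph (Fin m)) (d : ℕ) (S : Finset (Fin m)) (col : Fin m → Option (Fin m)) : Prop :=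
  ∀ v ∈ S, ∃ k : Fin m, col v = some k ∧ k.val < d ∧ ∀ w ∈ S, G.Adj v w → col w ≠ some k

theorem PartialColoring.validOn {S : Finset (Fin m)} {col : Fin m → Option (Fin m)}
    (h : PartialColoring G d S col) : ValidOn G d S col := fun v hv => by
  obtain ⟨k, hk⟩ := Option.ne_none_iff_exists'.1 ((h.2 v).2 hv)
  exact ⟨k, hk, (h.1 v k hk).1, fun w _ hw => (h.1 v k hk).2 w hw⟩

theorem ValidOn.colorableOn (hd : 0 < d) {S : Finset (Fin m)} {col : Fin m → Option (Fin m)}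
    (h : ValidOn G d S col) : ColorableOn G S d := by
  choose! k hk hkd hw using h
  refine (colorableOn_iff hd).2 ⟨fun v => if h : v ∈ S then ⟨k v, hkd v h⟩ else ⟨0, hd⟩,
    fun a ha b hb hab he => ?_⟩
  simp only [ha, hb, dif_pos, Fin.mk.injEq] at he
  exact hw a ha b hb hab (by rw [hk b hb, Fin.ext he])

/-- The colouring procedure is also a decision procedure: it succeeds whenever a colouring exists,
and on other inputs no result can pass the check. -/
theorem colorableOn_iff_validOn (hd : 0 < d) (hdm : d ≤ m)
    (hdeg : ∀ v, (Finset.univ.filter (G.Adj v)).card ≤ d) {S : Finset (Fin m)} :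
    ColorableOn G S d ↔ ValidOn G d S (colorSet G d S) :=
  ⟨fun h => (partialColoring_colorSet hdm hdeg (.inr ((colorableOn_iff hd).1 h))).validOn,
    ValidOn.colorableOn hd⟩

/-- The vertices of `S` reachable from `v` in `G[S]`. -/
noncomputable def reach (G : SimpleGraph (Fin m)) (S : Finset (Fin m)) (v : Fin m) : Finset (Fin m) :=
  (fun R => S.filter fun w => w ∈ R ∨ ∃ u ∈ R, G.Adj u w)^[m] {v}

theorem reach_subset_of_closed {S P : Finset (Fin m)} {v : Fin m} (hv : v ∈ P)
    (hP : ∀ u ∈ P, ∀ w ∈ S, G.Adj u w → w ∈ P) : reach G S v ⊆ P := by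
  suffices h : ∀ k, (fun R => S.filter fun w => w ∈ R ∨ ∃ u ∈ R, G.Adj u w)^[k] {v} ⊆ P from h m
  intro k
  induction k with
  | zero => simpa using hv
  | succ k ih =>
    rw [Function.iterate_succ_apply']
    intro w hw
    obtain ⟨hwS, hw | ⟨u, hu, huw⟩⟩ := Finset.mem_filter.1 hw
    · exact ih hw
    · exact hP u (ih hu) w hwS huw

/-- Each round that is not stationary adds a vertex, so after `k` rounds the set is closed or has
more than `k` elements; for `k = m` only the former is possible. -/
theorem reach_spec {S : Finset (Fin m)} {v : Fin m} (hv : v ∈ S) :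
    v ∈ reach G S v ∧ reach G S v ⊆ S ∧ ∀ u ∈ reach G S v, ∀ w ∈ S, G.Adj u w → w ∈ reach G S v := by
  have key : ∀ k, ∀ R, R = (fun R => S.filter fun w => w ∈ R ∨ ∃ u ∈ R, G.Adj u w)^[k] {v} →
      v ∈ R ∧ R ⊆ S ∧ ((∀ u ∈ R, ∀ w ∈ S, G.Adj u w → w ∈ R) ∨ k + 1 ≤ R.card) := by
    intro k
    induction k with
    | zero => rintro R rfl; simp [hv]
    | succ k ih =>
      rintro R hR
      obtain ⟨h1, h2, h3⟩ := ih _ rfl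
      rw [Function.iterate_succ_apply'] at hR
      set R' := (fun R => S.filter fun w => w ∈ R ∨ ∃ u ∈ R, G.Adj u w)^[k] {v}
      have hsub : R' ⊆ R := fun w hw => by rw [hR]; simp [hw, h2 hw]
      refine ⟨hsub h1, by rw [hR]; exact Finset.filter_subset _ _, ?_⟩
      by_cases hc : ∀ u ∈ R', ∀ w ∈ S, G.Adj u w → w ∈ R'
      · left
        have : R = R' := by
          refine (Finset.Subset.antisymm hsub fun w hw => ?_).symm
          rw [hR] at hw
          obtain ⟨hwS, hw | ⟨u, hu, huw⟩⟩ := Finset.mem_filter.1 hw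
          · exact hw
          · exact hc u hu w hwS huw
        rwa [this]
      · right
        have h4 := h3.resolve_left hc
        push Not at hc
        obtain ⟨u, hu, w, hw, huw, hwR⟩ := hc
        have : R' ⊂ R := (Finset.ssubset_iff_of_subset hsub).2
          ⟨w, by rw [hR]; simp only [Finset.mem_filter]; exact ⟨hw, .inr ⟨u, hu, huw⟩⟩, hwR⟩
        have := Finset.card_lt_card this
        omega
  obtain ⟨h1, h2, h3⟩ := key m _ rfl
  refine ⟨h1, h2, h3.resolve_right fun h => ?_⟩
  have := Finset.card_le_univ ((fun R => S.filter fun w => w ∈ R ∨ ∃ u ∈ R, G.Adj u w)^[m] {v})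
  rw [Fintype.card_fin] at this
  omega

theorem isComponentOf_reach {S : Finset (Fin m)} {v : Fin m} (hv : v ∈ S) :
    IsComponentOf G S (reach G S v) := by
  obtain ⟨h1, h2, h3⟩ := reach_spec (G := G) hv
  refine ⟨(G.induce (S : Set (Fin m))).connectedComponentMk ⟨v, hv⟩, ?_⟩
  ext w
  simp only [Finset.mem_coe, Set.mem_image, SimpleGraph.ConnectedComponent.mem_supp_iff,
    SimpleGraph.ConnectedComponent.eq, Subtype.exists, exists_and_right, exists_eq_right]
  constructor
  · intro hw
    have := reach_subset_of_closed (G := G) (S := S) (v := v)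
      (P := Finset.univ.filter fun w => ∃ h : w ∈ (S : Set (Fin m)),
        (G.induce (S : Set (Fin m))).Reachable ⟨w, h⟩ ⟨v, hv⟩)
      (by simpa using hv)
      (fun u hu w hw huw => by
        simp only [Finset.mem_filter, Finset.mem_univ, true_and] at hu ⊢
        obtain ⟨hu, hr⟩ := hu
        refine ⟨hw, SimpleGraph.Reachable.trans (SimpleGraph.Adj.reachable ?_) hr⟩
        exact huw.symm)
    simpa using this hw
  · rintro ⟨hw, hr⟩
    obtain ⟨p⟩ := hr
    have : ∀ a b : (S : Set (Fin m)), (G.induce (S : Set (Fin m))).Walk a b →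
        b.1 ∈ reach G S v → a.1 ∈ reach G S v := by
      intro a b p hb
      induction p with
      | nil => exact hb
      | @cons a b c hab _ ih => exact h3 b.1 (ih hb) a.1 a.2 (SimpleGraph.Adj.symm hab)
    exact this _ _ p h1

theorem IsComponentOf.eq_reach {S C : Finset (Fin m)} (h : IsComponentOf G S C) {v : Fin m} (hv : v ∈ C) :
    C = reach G S v :=
  h.disjoint (isComponentOf_reach (h.subset hv)) hv (reach_spec (h.subset hv)).1

theorem reach_eq {S : Finset (Fin m)} {v w : Fin m} (hv : v ∈ S) (hw : w ∈ reach G S v) :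
    reach G S w = reach G S v :=
  ((isComponentOf_reach hv).eq_reach hw).symm

/-- Degenerate graphs can be coloured greedily. -/
theorem exists_coloring_of_degenerate (hd : 0 < d) (T : Finset (Fin m))
    (h : ∀ T' ⊆ T, T'.Nonempty → ∃ t ∈ T', (T'.filter (G.Adj t)).card < d) :
    ∃ f : Fin m → Fin d, ∀ a ∈ T, ∀ b ∈ T, G.Adj a b → f a ≠ f b := by
  induction hn : T.card generalizing T with
  | zero =>
    rw [Finset.card_eq_zero] at hn
    subst hn
    exact ⟨fun _ => ⟨0, hd⟩, by simp⟩
  | succ k ih =>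
    obtain ⟨t, ht, hlt⟩ := h T subset_rfl (Finset.card_pos.1 (by omega))
    obtain ⟨f, hf⟩ := ih (T.erase t) (fun T' hT' => h T' (hT'.trans (Finset.erase_subset _ _)))
      (by rw [Finset.card_erase_of_mem ht]; omega)
    obtain ⟨k, hk⟩ : ∃ k, k ∉ (T.filter (G.Adj t)).image f := by
      by_contra! hc
      have h1 := Finset.card_image_le (s := T.filter (G.Adj t)) (f := f)
      have h2 : (T.filter (G.Adj t)).image f = Finset.univ := Finset.eq_univ_iff_forall.2 hc
      rw [h2, Finset.card_univ, Fintype.card_fin] at h1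
      omega
    have hk' : ∀ a ∈ T, G.Adj t a → f a ≠ k := fun a ha hta he =>
      hk (Finset.mem_image.2 ⟨a, by simp [ha, hta], he⟩)
    refine ⟨Function.update f t k, fun a ha b hb hab => ?_⟩
    by_cases hat : a = t
    · subst hat
      rw [Function.update_self, Function.update_of_ne hab.ne']
      exact (hk' b hb hab).symm
    · by_cases hbt : b = t
      · subst hbt
        rw [Function.update_self, Function.update_of_ne hat]
        exact hk' a ha hab.symm
      · rw [Function.update_of_ne hat, Function.update_of_ne hbt]
        exact hf a (by simp [hat, ha]) b (by simp [hbt, hb]) hab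

variable {n : ℕ} {I : Problem n m}

/-- `j` precedes `j'` in the order of increasing values to `i`. -/
def Precedes (I : Problem n m) (i : Fin n) (j j' : Fin m) : Prop :=
  I.val i j ≤ I.val i j' ∧ (I.val i j' ≤ I.val i j → j ≤ j')

theorem Precedes.antisymm {i : Fin n} {j j' : Fin m} (h : Precedes I i j j') (h' : Precedes I i j' j) :
    j = j' :=
  le_antisymm (h.2 h'.1) (h'.2 h.1)

theorem precedes_total (i : Fin n) (j j' : Fin m) : Precedes I i j j' ∨ Precedes I i j' j := by
  unfold Precedes
  rcases lt_trichotomy (I.val i j) (I.val i j') with h | h | h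
  · exact .inl ⟨h.le, fun h' => absurd h (not_lt.2 h')⟩
  · rcases le_total j j' with h' | h'
    · exact .inl ⟨h.le, fun _ => h'⟩
    · exact .inr ⟨h.ge, fun _ => h'⟩
  · exact .inr ⟨h.le, fun h' => absurd h (not_lt.2 h')⟩

theorem exists_precedes (i : Fin n) {C : Finset (Fin m)} (hC : C.Nonempty) :
    ∃ j ∈ C, ∀ j' ∈ C, Precedes I i j j' := by
  obtain ⟨j, hj, h⟩ := C.exists_min_image (fun j => toLex (I.val i j, j)) hC
  refine ⟨j, hj, fun j' hj' => ?_⟩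
  have := h j' hj'
  rw [Prod.Lex.le_iff] at this
  simp only [ofLex_toLex] at this
  rcases this with h | ⟨h, h'⟩
  · exact ⟨h.le, fun h' => absurd h (not_lt.2 h')⟩
  · exact ⟨h.le, fun _ => h'⟩

/-- The first items of the components that cannot be coloured with `d` colours. -/
noncomputable def transversal (I : Problem n m) (d : ℕ) (i : Fin n) (M : Finset (Fin m)) : Finset (Fin m) :=
  M.filter fun j => ¬ ValidOn I.graph d (reach I.graph M j) (colorSet I.graph d (reach I.graph M j)) ∧
    ∀ j' ∈ reach I.graph M j, Precedes I i j j'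

/-- Ties in value are broken by the index, so the order is antisymmetric and exactly one item of
each bad component comes first. -/
theorem isLeastTransversal_transversal (hd : 0 < d) (hdm : d ≤ m)
    (hdeg : ∀ v, (Finset.univ.filter (I.graph.Adj v)).card ≤ d) (i : Fin n) (M : Finset (Fin m)) :
    I.IsLeastTransversal d i M (transversal I d i M) := by
  constructor
  · intro j hj
    obtain ⟨hjM, hbad, -⟩ := Finset.mem_filter.1 hj
    rw [← colorableOn_iff_validOn hd hdm hdeg] at hbad
    exact ⟨_, isComponentOf_reach hjM, hbad, (reach_spec hjM).1⟩
  · intro C hC hbad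
    have hne : C.Nonempty := by
      rw [Finset.nonempty_iff_ne_empty]
      rintro rfl
      exact hbad ((colorableOn_iff hd).2 ⟨fun _ => ⟨0, hd⟩, by simp⟩)
    obtain ⟨j, hj, hmin⟩ := exists_precedes (I := I) i hne
    refine ⟨j, hj, ?_, fun j' hj' => (hmin j' hj').1⟩
    ext j'
    simp only [Finset.mem_inter, Finset.mem_singleton]
    constructor
    · rintro ⟨h1, h2⟩
      obtain ⟨-, -, h3⟩ := Finset.mem_filter.1 h1
      rw [← hC.eq_reach h2] at h3
      exact (h3 j hj).antisymm (hmin j' h2)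
    · rintro rfl
      refine ⟨Finset.mem_filter.2 ⟨hC.subset hj, ?_⟩, hj⟩
      rw [← hC.eq_reach hj, ← colorableOn_iff_validOn hd hdm hdeg]
      exact ⟨hbad, hmin⟩

/-- Removing an item from every component that is not `d`-colourable makes the graph colourable. -/
theorem Problem.IsLeastTransversal.colorableOn (hd : 0 < d) 
    (hdeg : ∀ v, (Finset.univ.filter (I.graph.Adj v)).card ≤ d) {i : Fin n} {M B : Finset (Fin m)}
    (hB : I.IsLeastTransversal d i M B) : ColorableOn I.graph (M \ B) d := by
  have key : ∀ v ∈ M, ∃ f : Fin m → Fin d, ∀ a ∈ reach I.graph M v \ B, ∀ b ∈ reach I.graph M v \ B,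
      I.graph.Adj a b → f a ≠ f b := by
    intro v hv
    by_cases hcol : ColorableOn I.graph (reach I.graph M v) d
    · obtain ⟨f, hf⟩ := (colorableOn_iff hd).1 hcol
      exact ⟨f, fun a ha b hb => hf a (Finset.sdiff_subset ha) b (Finset.sdiff_subset hb)⟩
    · obtain ⟨j, hj, hBj, -⟩ := hB.2 _ (isComponentOf_reach hv) hcol
      have hjB : j ∈ B := by
        have : j ∈ B ∩ reach I.graph M v := by rw [hBj]; simp
        exact (Finset.mem_inter.1 this).1
      -- The component is connected and `T` misses `j`, so some vertex of `T` has a neighbour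
      -- outside `T`, and hence fewer than `d` neighbours inside.
      refine exists_coloring_of_degenerate hd _ fun T hT hne => ?_
      have hjT : j ∉ T := fun h => (Finset.mem_sdiff.1 (hT h)).2 hjB
      obtain ⟨t, htT, u, hu, huT, htu⟩ : ∃ t ∈ T, ∃ u ∈ M, u ∉ T ∧ I.graph.Adj t u := by
        by_contra! hc
        obtain ⟨t, ht⟩ := hne
        have h1 := reach_subset_of_closed (G := I.graph) (S := M) (v := j) (P := M \ T)
          (by simp [hjT, (reach_spec hv).2.1 hj]) (fun u hu w hw huw => by
            rw [Finset.mem_sdiff] at hu ⊢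
            exact ⟨hw, fun hwT => hc w hwT u hu.1 hu.2 huw.symm⟩)
        rw [reach_eq hv hj] at h1
        exact (Finset.mem_sdiff.1 (h1 (Finset.mem_sdiff.1 (hT ht)).1)).2 ht
      refine ⟨t, htT, (Finset.card_lt_card ?_).trans_le (hdeg t)⟩
      exact (Finset.ssubset_iff_of_subset (by intro w; simp +contextual)).2 ⟨u, by simpa using htu, by simp [huT]⟩
  -- The colouring is indexed by the component rather than by a vertex, so that adjacent vertices
  -- are given the same choice.
  have key' : ∀ C, (∃ v ∈ M, C = reach I.graph M v) → ∃ f : Fin m → Fin d, ∀ a ∈ C \ B, ∀ b ∈ C \ B,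
      I.graph.Adj a b → f a ≠ f b := by
    rintro C ⟨v, hv, rfl⟩
    exact key v hv
  have : Nonempty (Fin d) := ⟨⟨0, hd⟩⟩
  choose! F hF using key'
  refine (colorableOn_iff hd).2 ⟨fun a => F (reach I.graph M a) a, fun a ha b hb hab => ?_⟩
  rw [Finset.mem_sdiff] at ha hb
  obtain ⟨h1, -, h3⟩ := reach_spec (G := I.graph) ha.1
  have hb' := h3 a h1 b hb.1 hab
  dsimp only
  rw [reach_eq ha.1 hb']
  exact hF _ ⟨a, ha.1, rfl⟩ a (by simp [h1, ha.2]) b (by simp [hb', hb.2]) hab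

end components

end ConflictAlloc

namespace ConflictAlloc

open Classical

/-! ### A heavy independent set for a single agent -/

section heavy

/-- Iterating a step that decreases a potential until a goal is reached. -/
theorem iterate_of_potential {α : Type*} {f : α → α} {P Q : α → Prop} {φ : α → ℕ}
    (hP : ∀ s, P s → P (f s)) (hφ : ∀ s, P s → ¬ Q s → φ (f s) < φ s) (hQ : ∀ s, Q s → Q (f s))
    {s : α} (hs : P s) {k : ℕ} (hk : φ s ≤ k) : P (f^[k + 1] s) ∧ Q (f^[k + 1] s) := by
  have h : ∀ k, P (f^[k] s) ∧ (Q (f^[k] s) ∨ φ (f^[k] s) + k ≤ φ s) := by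
    intro k
    induction k with
    | zero => exact ⟨hs, .inr le_rfl⟩
    | succ k ih =>
      rw [Function.iterate_succ_apply']
      refine ⟨hP _ ih.1, ?_⟩
      rcases ih.2 with h | h
      · exact .inl (hQ _ h)
      · by_cases hq : Q (f^[k] s)
        · exact .inl (hQ _ hq)
        · have := hφ _ ih.1 hq
          exact .inr (by omega)
  exact ⟨(h _).1, (h _).2.resolve_right (by omega)⟩

variable {m n : ℕ} {I : Problem n m}

/-- At least two neighbours of `v` in `M` are in class `k`. -/
def Crowded (G : SimpleGraph (Fin m)) (M : Finset (Fin m)) (part : Fin m → Fin m) (v k : Fin m) : Prop :=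
  ∃ a, a ∈ M ∧ G.Adj v a ∧ part a = k ∧ ∃ b, b ∈ M ∧ G.Adj v b ∧ part b = k ∧ a ≠ b

/-- Move a vertex out of a class in which it has two neighbours. -/
noncomputable def partStep (G : SimpleGraph (Fin m)) (Δ : ℕ) (M : Finset (Fin m)) (part : Fin m → Fin m) :
    Fin m → Fin m :=
  (first fun v => v ∈ M ∧ Crowded G M part v (part v)).elim part fun v =>
    Function.update part v ((first fun k => k.val + k.val ≤ Δ ∧ ¬ Crowded G M part v k).getD v)

theorem crowded_iff {G : SimpleGraph (Fin m)} {M : Finset (Fin m)} {part : Fin m → Fin m} {v k : Fin m} :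
    Crowded G M part v k ↔ 1 < (M.filter fun a => G.Adj v a ∧ part a = k).card := by
  rw [Finset.one_lt_card]
  simp only [Finset.mem_filter, Crowded]
  constructor
  · rintro ⟨a, ha, hva, hpa, b, hb, hvb, hpb, hab⟩
    exact ⟨a, ⟨ha, hva, hpa⟩, b, ⟨hb, hvb, hpb⟩, hab⟩
  · rintro ⟨a, ⟨ha, hva, hpa⟩, b, ⟨hb, hvb, hpb⟩, hab⟩
    exact ⟨a, ha, hva, hpa, b, hb, hvb, hpb, hab⟩

/-- The classes of a partition with `Δ / 2 + 1` parts. -/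
def halves (m Δ : ℕ) : Finset (Fin m) := Finset.univ.filter fun k => k.val + k.val ≤ Δ

theorem card_halves {Δ : ℕ} (h : Δ < m) : (halves m Δ).card = Δ / 2 + 1 := by
  have : halves m Δ = Finset.univ.map (Fin.castLEEmb (show Δ / 2 + 1 ≤ m by omega)) := by
    ext k
    simp only [halves, Finset.mem_filter, Finset.mem_univ, true_and, Finset.mem_map, Fin.castLEEmb_apply]
    constructor
    · intro hk
      exact ⟨⟨k.val, by omega⟩, Fin.ext rfl⟩
    · rintro ⟨k', rfl⟩
      have := k'.2
      simp only [Fin.val_castLE]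
      omega
  rw [this, Finset.card_map, Finset.card_univ, Fintype.card_fin]

/-- Two neighbours in each of the `Δ / 2 + 1` classes would be more than `Δ` neighbours. The
condition `k ≤ Δ / 2` is written without division, as a sum. -/
theorem exists_not_crowded {G : SimpleGraph (Fin m)} {Δ : ℕ} (hΔ : Δ < m)
    (hdeg : ∀ v, (Finset.univ.filter (G.Adj v)).card ≤ Δ) (M : Finset (Fin m)) (part : Fin m → Fin m)
    (v : Fin m) : ∃ k : Fin m, k.val + k.val ≤ Δ ∧ ¬ Crowded G M part v k := by
  by_contra! hc
  have h1 : ∑ k ∈ halves m Δ, 2 ≤ ∑ k ∈ halves m Δ, (M.filter fun a => G.Adj v a ∧ part a = k).card :=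
    Finset.sum_le_sum fun k hk => crowded_iff.1 (hc k (by simpa [halves] using hk))
  rw [← Finset.card_biUnion] at h1
  · have h2 : ((halves m Δ).biUnion fun k => M.filter fun a => G.Adj v a ∧ part a = k).card ≤
        (Finset.univ.filter (G.Adj v)).card := Finset.card_le_card (by
      intro a
      simp only [Finset.mem_biUnion, Finset.mem_filter, Finset.mem_univ, true_and]
      rintro ⟨k, _, _, h, _⟩
      exact h)
    rw [Finset.sum_const, card_halves hΔ, smul_eq_mul] at h1
    have := hdeg v
    omega
  · intro a _ b _ hab
    rw [Function.onFun, Finset.disjoint_left]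
    simp only [Finset.mem_filter, not_and]
    rintro x ⟨_, _, rfl⟩ _ _
    exact hab

/-- The number of ordered pairs of neighbours in the same class. -/
noncomputable def conflicts (G : SimpleGraph (Fin m)) (M : Finset (Fin m)) (part : Fin m → Fin m) : ℕ :=
  ∑ a ∈ M, ∑ b ∈ M, if G.Adj a b ∧ part b = part a then 1 else 0

theorem conflicts_eq {G : SimpleGraph (Fin m)} {M : Finset (Fin m)} {part : Fin m → Fin m} {v : Fin m}
    (hv : v ∈ M) : conflicts G M part = 2 * (M.filter fun a => G.Adj v a ∧ part a = part v).card +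
      ∑ a ∈ M.erase v, ∑ b ∈ M.erase v, if G.Adj a b ∧ part b = part a then 1 else 0 := by
  unfold conflicts
  rw [← Finset.add_sum_erase _ _ hv]
  have h1 : ∀ a, ∑ b ∈ M, (if G.Adj a b ∧ part b = part a then 1 else 0) =
      (if G.Adj a v ∧ part v = part a then 1 else 0) +
        ∑ b ∈ M.erase v, if G.Adj a b ∧ part b = part a then 1 else 0 := fun a =>
    (Finset.add_sum_erase _ _ hv).symm
  rw [Finset.sum_congr rfl fun a _ => h1 a, Finset.sum_add_distrib, Finset.card_filter, ← add_assoc]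
  congr 1
  have h2 : ∑ a ∈ M.erase v, (if G.Adj a v ∧ part v = part a then 1 else 0) =
      ∑ a ∈ M, if G.Adj v a ∧ part a = part v then 1 else 0 := by
    rw [← Finset.add_sum_erase _ _ hv]
    simp only [SimpleGraph.irrefl, false_and, if_false, zero_add]
    exact Finset.sum_congr rfl fun a _ => by simp only [G.adj_comm, eq_comm]
  rw [h2]
  ring

/-- Only pairs with `v` change. There were at least two neighbours in the old class and there is at
most one in the new class. -/
theorem conflicts_partStep {G : SimpleGraph (Fin m)} {Δ : ℕ} (hΔ : Δ < m)
    (hdeg : ∀ v, (Finset.univ.filter (G.Adj v)).card ≤ Δ) {M : Finset (Fin m)} {part : Fin m → Fin m}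
    (h : ¬ ∀ v ∈ M, ¬ Crowded G M part v (part v)) :
    conflicts G M (partStep G Δ M part) < conflicts G M part := by
  push Not at h
  obtain ⟨v, hv, hvM, hcr⟩ := exists_first h
  obtain ⟨k, hk, hkΔ, hncr⟩ := exists_first (exists_not_crowded hΔ hdeg M part v)
  rw [partStep, hv, Option.elim, hk, Option.getD_some, conflicts_eq hvM, conflicts_eq hvM]
  rw [crowded_iff] at hcr hncr
  have h1 : (M.filter fun a => G.Adj v a ∧ Function.update part v k a = Function.update part v k v) =
      M.filter fun a => G.Adj v a ∧ part a = k := by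
    refine Finset.filter_congr fun a _ => and_congr_right fun hva => ?_
    rw [Function.update_self, Function.update_of_ne hva.ne']
  have h2 : (∑ a ∈ M.erase v, ∑ b ∈ M.erase v,
      if G.Adj a b ∧ Function.update part v k b = Function.update part v k a then 1 else 0) =
      ∑ a ∈ M.erase v, ∑ b ∈ M.erase v, if G.Adj a b ∧ part b = part a then 1 else 0 :=
    Finset.sum_congr rfl fun a ha => Finset.sum_congr rfl fun b hb => by
      rw [Function.update_of_ne (Finset.ne_of_mem_erase ha), Function.update_of_ne (Finset.ne_of_mem_erase hb)]
  rw [h1, h2]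
  omega

/-- A partition into `Δ / 2 + 1` classes within which every vertex has at most one neighbour. -/
noncomputable def sparsePart (G : SimpleGraph (Fin m)) (Δ : ℕ) (M : Finset (Fin m)) (z : Fin m) : Fin m → Fin m :=
  (partStep G Δ M)^[m * m + 1] fun _ => z

theorem sparsePart_spec {G : SimpleGraph (Fin m)} {Δ : ℕ} (hΔ : Δ < m)
    (hdeg : ∀ v, (Finset.univ.filter (G.Adj v)).card ≤ Δ) (M : Finset (Fin m)) {z : Fin m} (hz : z.val = 0) :
    (∀ v, (sparsePart G Δ M z v).val + (sparsePart G Δ M z v).val ≤ Δ) ∧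
      ∀ v ∈ M, ¬ Crowded G M (sparsePart G Δ M z) v (sparsePart G Δ M z v) := by
  -- There are at most `m * m` ordered pairs, so this many strict decreases and one more step
  -- suffice.
  refine iterate_of_potential (f := partStep G Δ M) (P := fun part => ∀ v, (part v).val + (part v).val ≤ Δ)
    (Q := fun part => ∀ v ∈ M, ¬ Crowded G M part v (part v)) (φ := conflicts G M) (s := fun _ => z) (k := m * m)
    ?_ ?_ ?_ ?_ ?_
  · intro part h v
    unfold partStep
    rcases hf : first fun v => v ∈ M ∧ Crowded G M part v (part v) with _ | u
    · exact h v
    · obtain ⟨k, hk, hkΔ, -⟩ := exists_first (exists_not_crowded hΔ hdeg M part u)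
      rw [Option.elim, hk, Option.getD_some]
      by_cases hvu : v = u
      · subst hvu; rwa [Function.update_self]
      · rw [Function.update_of_ne hvu]; exact h v
  · exact fun part _ h => conflicts_partStep hΔ hdeg h
  · intro part h
    have : (first fun v => v ∈ M ∧ Crowded G M part v (part v)) = none :=
      first_eq_none.2 fun v hv => h v hv.1 hv.2
    simpa only [partStep, this, Option.elim] using h
  · simp [hz]
  · calc conflicts G M (fun _ => z) ≤ ∑ a ∈ M, ∑ b ∈ M, 1 :=
          Finset.sum_le_sum fun a _ => Finset.sum_le_sum fun b _ => by split_ifs <;> simp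
      _ = M.card * M.card := by simp
      _ ≤ m * m := Nat.mul_le_mul (by simpa using M.card_le_univ) (by simpa using M.card_le_univ)

/-- The items of class `k` that are not dominated by a neighbour in the class. -/
noncomputable def winners (I : Problem n m) (i : Fin n) (M : Finset (Fin m)) (part : Fin m → Fin m) (k : Fin m) :
    Finset (Fin m) :=
  M.filter fun j => part j = k ∧ ∀ j', j' ∈ M → I.graph.Adj j j' → part j' = k → Precedes I i j' j

theorem winners_isIndepSet (i : Fin n) (M : Finset (Fin m)) (part : Fin m → Fin m) (k : Fin m) :
    I.graph.IsIndepSet (winners I i M part k : Set (Fin m)) := by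
  intro a ha b hb hab hadj
  rw [Finset.mem_coe, winners, Finset.mem_filter] at ha hb
  exact hab ((hb.2.2 a ha.1 hadj.symm ha.2.1).antisymm (ha.2.2 b hb.1 hadj hb.2.1))

/-- Each class induces a matching with isolated vertices, and the winners pick the heavier end of
every edge. An item of `T` that is not a winner is charged to its only neighbour in the class. -/
theorem value_le_winners {i : Fin n} {M : Finset (Fin m)} {part : Fin m → Fin m}
    (h : ∀ v ∈ M, ¬ Crowded I.graph M part v (part v)) {T : Finset (Fin m)} (hTM : T ⊆ M)
    (hT : I.graph.IsIndepSet (T : Set (Fin m))) (k : Fin m) :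
    I.value i (T.filter fun j => part j = k) ≤ I.value i (winners I i M part k) := by
  set T' := T.filter fun j => part j = k
  have hT'T : T' ⊆ T := Finset.filter_subset _ _
  have hex : ∀ j ∈ T', ∃ u, u ∈ winners I i M part k ∧ I.val i j ≤ I.val i u ∧
      (u = j ∨ I.graph.Adj j u) := by
    intro j hj
    obtain ⟨hjT, hjk⟩ := Finset.mem_filter.1 hj
    by_cases hw : j ∈ winners I i M part k
    · exact ⟨j, hw, le_rfl, .inl rfl⟩
    · have : ∃ u, u ∈ M ∧ I.graph.Adj j u ∧ part u = k ∧ ¬ Precedes I i u j := by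
        by_contra! hc
        exact hw (Finset.mem_filter.2 ⟨hTM hjT, hjk, fun u hu hju huk => hc u hu hju huk⟩)
      obtain ⟨u, hu, hju, huk, hnp⟩ := this
      have hp := (precedes_total i u j).resolve_left hnp
      refine ⟨u, Finset.mem_filter.2 ⟨hu, huk, fun j' hj' huj' hj'k => ?_⟩, hp.1, .inr hju⟩
      by_cases hjj' : j' = j
      · subst hjj'; exact hp
      · exact absurd ⟨j, hTM hjT, hju.symm, by rw [hjk, huk], j', hj', huj', by rw [hj'k, huk], Ne.symm hjj'⟩ (h u hu)
  choose! φ hφ hle hadj using hex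
  -- If one of two items with the same image is itself the image, the items are adjacent although
  -- `T` is independent; otherwise both are neighbours of the image in its class, which is then
  -- crowded.
  have hinj : Set.InjOn φ T' := by
    intro a ha b hb hab
    by_contra hne
    have haT := hT'T ha
    have hbT := hT'T hb
    have hw := hφ a ha
    obtain ⟨hwM, hwk, -⟩ := Finset.mem_filter.1 hw
    rcases hadj a ha with h1 | h1 <;> rcases hadj b hb with h2 | h2
    · exact hne (by rw [← h1, ← h2, hab])
    · rw [← hab, h1] at h2
      exact hT hbT haT (Ne.symm hne) h2
    · rw [hab, h2] at h1
      exact hT haT hbT hne h1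
    · rw [← hab] at h2
      have ha' := (Finset.mem_filter.1 (Finset.mem_coe.1 ha)).2
      have hb' := (Finset.mem_filter.1 (Finset.mem_coe.1 hb)).2
      exact h _ hwM ⟨a, hTM haT, h1.symm, by rw [ha', hwk], b, hTM hbT, h2.symm, by rw [hb', hwk], hne⟩
  calc I.value i T' ≤ ∑ j ∈ T', I.val i (φ j) := Finset.sum_le_sum fun j hj => hle j hj
    _ = I.value i (T'.image φ) := (Finset.sum_image hinj).symm
    _ ≤ _ := value_mono i (Finset.image_subset_iff.2 hφ)

/-- An independent set of value at least `1 / (Δ / 2 + 1)` times the maximum. -/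
noncomputable def heavySet (I : Problem n m) (Δ : ℕ) (i : Fin n) (M : Finset (Fin m)) (z : Fin m) : Finset (Fin m) :=
  let part := sparsePart I.graph Δ M z
  winners I i M part ((first fun k => ∀ k', I.value i (winners I i M part k') ≤
    I.value i (winners I i M part k)).getD z)

theorem heavySet_subset (Δ : ℕ) (i : Fin n) (M : Finset (Fin m)) (z : Fin m) : heavySet I Δ i M z ⊆ M :=
  Finset.filter_subset _ _

theorem heavySet_isIndepSet (Δ : ℕ) (i : Fin n) (M : Finset (Fin m)) (z : Fin m) :
    I.graph.IsIndepSet (heavySet I Δ i M z : Set (Fin m)) :=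
  winners_isIndepSet _ _ _ _

/-- For `Δ > 2` this is `Δ / 2 + 1 ≤ (Δ + 2) / 2`, tight for even `Δ`: the single-agent step needs
exactly the ratio `2 / (Δ + 2)`. -/
theorem factor_mul_half_le {Δ : ℕ} (hΔ : 1 ≤ Δ) : factor Δ * ((Δ / 2 + 1 : ℕ) : ℝ) ≤ 1 := by
  have h1 : ((Δ / 2 + 1 : ℕ) : ℝ) ≤ (Δ + 2) / 2 := by
    have : ((Δ / 2 : ℕ) : ℝ) ≤ Δ / 2 := Nat.cast_div_le
    push_cast; linarith
  unfold factor
  split_ifs with h h'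
  · subst h; norm_num
  · subst h'; norm_num
  · refine (mul_le_mul_of_nonneg_left h1 (by positivity)).trans_eq ?_
    field_simp

/-- The classes cut `T` into `Δ / 2 + 1` pieces, each worth no more than the winners of its class,
and so no more than the best winners. -/
theorem factor_mul_value_le_heavySet {Δ : ℕ} (hΔ : 1 ≤ Δ) (hΔm : Δ < m)
    (hdeg : ∀ v, (Finset.univ.filter (I.graph.Adj v)).card ≤ Δ) (i : Fin n) {M T : Finset (Fin m)}
    {z : Fin m} (hz : z.val = 0) (hTM : T ⊆ M) (hT : I.graph.IsIndepSet (T : Set (Fin m))) :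
    factor Δ * I.value i T ≤ I.value i (heavySet I Δ i M z) := by
  obtain ⟨h1, h2⟩ := sparsePart_spec hΔm hdeg M hz
  unfold heavySet
  set part := sparsePart I.graph Δ M z
  have hex : ∃ k, ∀ k', I.value i (winners I i M part k') ≤ I.value i (winners I i M part k) := by
    obtain ⟨k, -, hk⟩ := Finset.exists_max_image Finset.univ (fun k => I.value i (winners I i M part k)) ⟨z, by simp⟩
    exact ⟨k, fun k' => hk k' (by simp)⟩
  obtain ⟨k, hk, hmax⟩ := exists_first hex
  simp only [hk, Option.getD_some]
  have h3 : I.value i T ≤ ((Δ / 2 + 1 : ℕ) : ℝ) * I.value i (winners I i M part k) := by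
    have hT' : T = (halves m Δ).biUnion fun k => T.filter fun j => part j = k := by
      ext j
      simp only [Finset.mem_biUnion, Finset.mem_filter, halves, Finset.mem_univ, true_and]
      exact ⟨fun hj => ⟨part j, h1 j, hj, rfl⟩, fun ⟨_, _, h, _⟩ => h⟩
    rw [hT', value_biUnion]
    · refine (Finset.sum_le_sum fun k' _ => (value_le_winners h2 hTM hT k').trans (hmax k')).trans_eq ?_
      rw [Finset.sum_const, card_halves hΔm, nsmul_eq_mul]
    · intro a _ b _ hab
      rw [Finset.disjoint_left]
      simp only [Finset.mem_filter, not_and]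
      rintro x ⟨_, rfl⟩ _
      exact hab
  have h4 := factor_mul_half_le hΔ
  have h5 := value_nonneg (I := I) i (winners I i M part k)
  calc factor Δ * I.value i T ≤ factor Δ * (((Δ / 2 + 1 : ℕ) : ℝ) * I.value i (winners I i M part k)) :=
        mul_le_mul_of_nonneg_left h3 factor_pos.le
    _ = (factor Δ * ((Δ / 2 + 1 : ℕ) : ℝ)) * I.value i (winners I i M part k) := by ring
    _ ≤ _ := mul_le_of_le_one_left h5 h4

end heavy

end ConflictAlloc

namespace ConflictAlloc

open Classical

/-! ### An explicit execution of the algorithm -/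

section algorithm

variable {n m : ℕ}

/-- The items that nobody owns. -/
noncomputable def unowned (own : Fin m → Option (Fin n)) : Finset (Fin m) :=
  Finset.univ.filter fun j => own j = none

/-- The items owned by an agent. -/
noncomputable def owned (own : Fin m → Option (Fin n)) (i : Fin n) : Finset (Fin m) :=
  Finset.univ.filter fun j => own j = some i

theorem mem_unowned {own : Fin m → Option (Fin n)} {j : Fin m} : j ∈ unowned own ↔ own j = none := by
  rw [unowned, Finset.mem_filter]; simp

theorem mem_owned {own : Fin m → Option (Fin n)} {i : Fin n} {j : Fin m} :
    j ∈ owned own i ↔ own j = some i := by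
  rw [owned, Finset.mem_filter]; simp

/-- The items of `B` are given to `i`. -/
noncomputable def giveTo (own : Fin m → Option (Fin n)) (i : Fin n) (B : Finset (Fin m)) :
    Fin m → Option (Fin n) :=
  fun j => if j ∈ B then some i else own j

/-- The state of the execution is a map from items to owners, from which both the bundles and the
remaining items of `Run` are read off. The correspondence needs that remaining agents own nothing
yet. -/
theorem owned_giveTo {own : Fin m → Option (Fin n)} {i : Fin n} {B : Finset (Fin m)}
    (hi : ∀ j, own j ≠ some i) (hB : B ⊆ unowned own) :
    owned (giveTo own i B) = Function.update (owned own) i B := by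
  funext a
  ext j
  have hj : j ∈ B → own j = none := fun h => mem_unowned.1 (hB h)
  rw [mem_owned]
  by_cases ha : a = i
  · subst ha
    by_cases hjB : j ∈ B <;> simp [giveTo, hjB, hi]
  · rw [Function.update_of_ne ha, mem_owned]
    by_cases hjB : j ∈ B
    · simp [giveTo, hjB, Ne.symm ha, hj]
    · simp [giveTo, hjB]

theorem unowned_giveTo (own : Fin m → Option (Fin n)) (i : Fin n) (B : Finset (Fin m)) :
    unowned (giveTo own i B) = unowned own \ B := by
  ext j
  rw [Finset.mem_sdiff, mem_unowned, mem_unowned]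
  by_cases hjB : j ∈ B <;> simp [giveTo, hjB]

theorem giveTo_ne {own : Fin m → Option (Fin n)} {N : Finset (Fin n)} (h : ∀ i ∈ N, ∀ j, own j ≠ some i)
    (a : Fin n) (B : Finset (Fin m)) : ∀ i ∈ N.erase a, ∀ j, giveTo own a B j ≠ some i := by
  intro i hi j
  rw [Finset.mem_erase] at hi
  unfold giveTo
  split_ifs
  · exact fun he => hi.1 (Option.some.inj he).symm
  · exact h i hi.2 j

/-- Add items of `A` to a bag, as long as it does not satisfy `sat`. -/
noncomputable def fillBag (A : Finset (Fin m)) (sat : Finset (Fin m) → Prop) : Finset (Fin m) :=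
  (List.finRange m).foldl (fun B j => if j ∈ A ∧ ¬ sat B then insert j B else B) ∅

/-- One pass is enough: a bag that satisfies `sat` is no longer changed, and one that never does has
collected all of `A`. -/
theorem fillBag_spec (A : Finset (Fin m)) (sat : Finset (Fin m) → Prop) :
    FillBag A sat (fillBag A sat) ∧ (sat A → sat (fillBag A sat)) := by
  have key : ∀ l : List (Fin m), l.Nodup → ∀ B, FillBag A sat B → (∀ j ∈ l, j ∉ B) →
      ∀ B', B' = l.foldl (fun B j => if j ∈ A ∧ ¬ sat B then insert j B else B) B →
      FillBag A sat B' ∧ (sat B' ∨ B' = B ∪ l.toFinset ∩ A) := by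
    intro l
    induction l with
    | nil => rintro _ B hB _ B' rfl; exact ⟨hB, .inr (by simp)⟩
    | cons j l ih =>
      rintro hnd B hB hl B' rfl
      rw [List.nodup_cons] at hnd
      rw [List.foldl_cons]
      split_ifs with hj
      · obtain ⟨h1, h2⟩ := ih hnd.2 _ (hB.add hj.2 hj.1 (hl j (by simp))) (fun j' hj' => by
          rw [Finset.mem_insert, not_or]
          exact ⟨by rintro rfl; exact hnd.1 hj', hl j' (by simp [hj'])⟩) _ rfl
        refine ⟨h1, h2.imp id fun h => h.trans ?_⟩
        rw [List.toFinset_cons, Finset.insert_inter_of_mem hj.1]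
        simp
      · obtain ⟨h1, h2⟩ := ih hnd.2 _ hB (fun j' hj' => hl j' (by simp [hj'])) _ rfl
        refine ⟨h1, ?_⟩
        by_cases hs : sat B
        · left
          clear ih h1 h2 hl hnd hj
          induction l with
          | nil => exact hs
          | cons j l ih => rw [List.foldl_cons, if_neg (by tauto)]; exact ih
        · refine h2.imp id fun h => h.trans ?_
          rw [List.toFinset_cons, Finset.insert_inter_of_notMem (by tauto)]
  obtain ⟨h1, h2⟩ := key (List.finRange m) (List.nodup_finRange m) ∅ .empty (by simp) _ rfl
  refine ⟨h1, fun hA => ?_⟩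
  rcases h2 with h2 | h2
  · exact h2
  · have : fillBag A sat = A := by rw [fillBag, h2]; simp
    rwa [this]

/-- The unowned items of a colour. -/
noncomputable def colorClass (own : Fin m → Option (Fin n)) (col : Fin m → Option (Fin m)) (k : Fin m) :
    Finset (Fin m) :=
  Finset.univ.filter fun j => own j = none ∧ col j = some k

theorem mem_colorClass {own : Fin m → Option (Fin n)} {col : Fin m → Option (Fin m)} {k j : Fin m} :
    j ∈ colorClass own col k ↔ own j = none ∧ col j = some k := by
  rw [colorClass, Finset.mem_filter]; simp

/-- One step of bag filling on the colours below `l`. -/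
noncomputable def bagStep (I : Problem n m) (x : Fin n → ℝ) (last : Finset (Fin n)) (l : ℕ)
    (col : Fin m → Option (Fin m)) (z : Fin n) (s : Finset (Fin n) × (Fin m → Option (Fin n))) :
    Finset (Fin n) × (Fin m → Option (Fin n)) :=
  (first fun k : Fin m => k.val < l ∧ ∃ a, a ∈ s.1 ∧ x a ≤ I.value a (colorClass s.2 col k)).elim s fun k =>
    let B := fillBag (colorClass s.2 col k) fun B => ∃ a, a ∈ s.1 ∧ x a ≤ I.value a B
    let i := (first fun a => a ∈ s.1 ∧ x a ≤ I.value a B ∧ a ∉ last).getD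
      ((first fun a => a ∈ s.1 ∧ x a ≤ I.value a B).getD z)
    (s.1.erase i, giveTo s.2 i B)

/-- Bag filling on the colours below `l`. -/
noncomputable def bagFill (I : Problem n m) (x : Fin n → ℝ) (last : Finset (Fin n)) (l : ℕ)
    (col : Fin m → Option (Fin m)) (z : Fin n) (s : Finset (Fin n) × (Fin m → Option (Fin n))) :
    Fin m → Option (Fin n) :=
  ((bagStep I x last l col z)^[n] s).2

/-- Sources are the unowned parts of colour classes, so assigning a bag removes it from its source
by itself. Every effective step removes an agent, and a step that finds nothing is stationary; thus
`n` steps suffice. The map `e` names the colours used as sources. -/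
theorem bagFill_spec {I : Problem n m} {x : Fin n → ℝ} {last : Finset (Fin n)} {l : ℕ}
    {col : Fin m → Option (Fin m)} {z : Fin n} {N : Finset (Fin n)} {own : Fin m → Option (Fin n)}
    (hN : ∀ i ∈ N, ∀ j, own j ≠ some i) {e : Fin l → Fin m} (he : Function.Injective e)
    (hel : ∀ k : Fin m, (∃ k', e k' = k) ↔ k.val < l) {A : Fin l → Finset (Fin m)}
    (hA : ∀ k, A k = colorClass own col (e k)) :
    BagFill I x last A N (owned own) (owned (bagFill I x last l col z (N, own))) := by
  have key : ∀ t N own, N.card ≤ t → (∀ i ∈ N, ∀ j, own j ≠ some i) →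
      BagFill I x last (fun k => colorClass own col (e k)) N (owned own)
        (owned ((bagStep I x last l col z)^[t] (N, own)).2) := by
    intro t
    induction t with
    | zero =>
      intro N own hcard _
      rw [Nat.le_zero, Finset.card_eq_zero] at hcard
      subst hcard
      exact .finish (by simp)
    | succ t ih =>
      intro N own hcard hN
      rcases hf : first fun k : Fin m => k.val < l ∧ ∃ a, a ∈ N ∧ x a ≤ I.value a (colorClass own col k) with _ | k
      · have hfix : bagStep I x last l col z (N, own) = (N, own) := by
          simp only [bagStep, hf, Option.elim]
        rw [Function.iterate_fixed hfix]
        refine .finish fun k i hi => ?_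
        have := first_eq_none.1 hf (e k)
        by_contra! hc
        exact this ⟨(hel _).1 ⟨k, rfl⟩, i, hi, hc⟩
      · obtain ⟨hk, hsat⟩ := first_some hf
        obtain ⟨k', rfl⟩ := (hel k).2 hk
        set C := colorClass own col (e k')
        obtain ⟨B, hBdef⟩ : ∃ B, B = fillBag C fun B => ∃ a, a ∈ N ∧ x a ≤ I.value a B := ⟨_, rfl⟩
        obtain ⟨hB, hBsat⟩ := fillBag_spec C fun B => ∃ a, a ∈ N ∧ x a ≤ I.value a B
        rw [← hBdef] at hB hBsat
        obtain ⟨i, hidef⟩ : ∃ i, i = (first fun a => a ∈ N ∧ x a ≤ I.value a B ∧ a ∉ last).getD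
          ((first fun a => a ∈ N ∧ x a ≤ I.value a B).getD z) := ⟨_, rfl⟩
        have hi : (i ∈ N ∧ x i ≤ I.value i B) ∧ (i ∈ last → ∀ a ∈ N, x a ≤ I.value a B → a ∈ last) := by
          rcases hf' : first fun a => a ∈ N ∧ x a ≤ I.value a B ∧ a ∉ last with _ | a
          · obtain ⟨a, ha, ha'⟩ := exists_first (hBsat hsat)
            rw [hf', ha] at hidef
            simp only [Option.getD] at hidef
            subst hidef
            refine ⟨ha', fun _ b hb hxb => ?_⟩
            have := first_eq_none.1 hf' b
            tauto
          · rw [hf'] at hidef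
            simp only [Option.getD] at hidef
            subst hidef
            obtain ⟨h1, h2, h3⟩ := first_some hf'
            exact ⟨⟨h1, h2⟩, fun h => absurd h h3⟩
        have hstep : bagStep I x last l col z (N, own) = (N.erase i, giveTo own i B) := by
          simp only [bagStep, hf, Option.elim]
          rw [← hBdef, ← hidef]
        rw [Function.iterate_succ_apply, hstep]
        have hBun : B ⊆ unowned own := hB.subset.trans fun j hj => mem_unowned.2 (mem_colorClass.1 hj).1
        refine .give k' B i hsat hB hi.1.1 hi.1.2 hi.2 ?_
        rw [← owned_giveTo (hN i hi.1.1) hBun]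
        -- The bag has a single colour and `e` is injective, so the other classes are unaffected.
        have hA' : Function.update (fun k => colorClass own col (e k)) k' (colorClass own col (e k') \ B) =
            fun k => colorClass (giveTo own i B) col (e k) := by
          funext k
          by_cases hkk : k = k'
          · subst hkk
            rw [Function.update_self]
            ext j
            rw [Finset.mem_sdiff, mem_colorClass, mem_colorClass]
            by_cases hj : j ∈ B <;> simp [giveTo, hj]
          · rw [Function.update_of_ne hkk]
            ext j
            rw [mem_colorClass, mem_colorClass]
            by_cases hj : j ∈ B
            · have hjC := hB.subset hj
              have : col j = some (e k') := (mem_colorClass.1 hjC).2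
              have hne : e k' ≠ e k := fun h => hkk (he h).symm
              simp [giveTo, hj, this, hne]
            · simp [giveTo, hj]
        rw [hA']
        exact ih _ _ (by rw [Finset.card_erase_of_mem hi.1.1]; omega) (giveTo_ne hN i B)
  have := key n N own (by simpa using N.card_le_univ) hN
  rw [show A = fun k => colorClass own col (e k) from funext hA]
  exact this

/-- Treatment of the case that at most `Δ` agents remain and the graph is not `Δ`-colourable. -/
noncomputable def splitStep (I : Problem n m) (Δ : ℕ) (zn : Fin n)
    (s : Finset (Fin n) × (Fin m → Option (Fin n))) : Finset (Fin n) × (Fin m → Option (Fin n)) :=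
  let M := unowned s.2
  let i := (first fun i => i ∈ s.1).getD zn
  let B := transversal I Δ i M
  (first fun j => j ∈ M ∧ I.splitLimit (factor Δ) s.1 M B i ≤ I.val i j).elim
    (∅, bagFill I (Function.update (I.limit (factor Δ) s.1 M) i (I.splitLimit (factor Δ) s.1 M B i)) {i} (Δ + 1)
      (fun j => if j ∈ B then first (fun k => k.val ≤ Δ ∧ Δ ≤ k.val) else colorSet I.graph Δ (M \ B) j) zn s)
    fun j => (s.1.erase i, giveTo s.2 i {j})

/-- The second step of the algorithm. -/
noncomputable def fillStep (I : Problem n m) (Δ : ℕ) (zn : Fin n) (zm : Fin m)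
    (s : Finset (Fin n) × (Fin m → Option (Fin n))) : Finset (Fin n) × (Fin m → Option (Fin n)) :=
  let M := unowned s.2
  if s.1.card ≤ 1 then
    (first fun i => i ∈ s.1).elim s fun i => (∅, giveTo s.2 i (heavySet I Δ i M zm))
  else if ValidOn I.graph Δ M (colorSet I.graph Δ M) then
    (∅, bagFill I (I.limit (factor Δ) s.1 M) ∅ Δ (colorSet I.graph Δ M) zn s)
  else if s.1.card ≤ Δ then splitStep I Δ zn s
  else (∅, bagFill I (I.limit (factor Δ) s.1 M) ∅ (Δ + 1) (colorSet I.graph (Δ + 1) M) zn s)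

/-- One round of the algorithm. -/
noncomputable def mainStep (I : Problem n m) (Δ : ℕ) (zn : Fin n) (zm : Fin m)
    (s : Finset (Fin n) × (Fin m → Option (Fin n))) : Finset (Fin n) × (Fin m → Option (Fin n)) :=
  let M := unowned s.2
  (first fun i => i ∈ s.1 ∧ ∃ j, j ∈ M ∧ I.limit (factor Δ) s.1 M i ≤ I.val i j).elim
    (fillStep I Δ zn zm s) fun i =>
      (s.1.erase i, giveTo s.2 i {(first fun j => j ∈ M ∧ I.limit (factor Δ) s.1 M i ≤ I.val i j).getD zm})

theorem mainStep_empty (I : Problem n m) (Δ : ℕ) (zn : Fin n) (zm : Fin m) (own : Fin m → Option (Fin n)) :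
    mainStep I Δ zn zm (∅, own) = (∅, own) := by
  have h1 : ∀ p : Fin n → Prop, (first fun i => i ∈ (∅ : Finset (Fin n)) ∧ p i) = none := fun p =>
    first_eq_none.2 (by simp)
  have h2 : (first fun i => i ∈ (∅ : Finset (Fin n))) = none := first_eq_none.2 (by simp)
  simp only [mainStep, h1, Option.elim, fillStep, Finset.card_empty, zero_le, if_true, h2]

theorem card_adj_le (I : Problem n m) (v : Fin m) :
    (Finset.univ.filter (I.graph.Adj v)).card ≤ I.maxDeg := by
  refine le_trans (le_of_eq ?_) (I.graph.degree_le_maxDegree v)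
  rw [← SimpleGraph.card_neighborFinset_eq_degree, SimpleGraph.neighborFinset_eq_filter]

theorem maxDeg_lt {I : Problem n m} (h : 1 ≤ I.maxDeg) : I.maxDeg < m := by
  have : Nonempty (Fin m) := by
    by_contra hc
    rw [not_nonempty_iff] at hc
    have : I.maxDeg = 0 := by
      unfold Problem.maxDeg
      exact Nat.le_zero.1 (I.graph.maxDegree_le_of_forall_degree_le 0 fun v => (hc.false v).elim)
    omega
  obtain ⟨v, hv⟩ := I.graph.exists_maximal_degree_vertex
  have := I.graph.degree_lt_card_verts v
  rw [Fintype.card_fin] at this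
  unfold Problem.maxDeg
  omega

theorem isColoringOf_colorClass {I : Problem n m} {own : Fin m → Option (Fin n)} {l : ℕ} (hl : l ≤ m)
    {col : Fin m → Option (Fin m)} (h : PartialColoring I.graph l (unowned own) col) :
    IsColoringOf I.graph (unowned own) fun k : Fin l => colorClass own col (Fin.castLE hl k) := by
  refine ⟨fun k a ha b hb hab hadj => ?_, fun k k' hne => ?_, ?_⟩
  · simp only [colorClass, Finset.coe_filter, Finset.mem_univ, true_and, Set.mem_ofPred_eq] at ha hb
    exact (h.1 a _ ha.2).2 b hadj hb.2
  · rw [Finset.disjoint_left]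
    intro j hj hj'
    simp only [colorClass, Finset.mem_filter, Finset.mem_univ, true_and] at hj hj'
    exact hne (Fin.castLE_injective hl (Option.some.inj (hj.2.symm.trans hj'.2)))
  · ext j
    simp only [colorClass, Finset.mem_biUnion, Finset.mem_filter, Finset.mem_univ, true_and, unowned]
    constructor
    · rintro ⟨k, hk, _⟩; exact hk
    · intro hj
      obtain ⟨k, hk⟩ := Option.ne_none_iff_exists'.1 ((h.2 j).2 (by simpa [unowned] using hj))
      exact ⟨⟨k.val, (h.1 j k hk).1⟩, hj, by rw [hk]; rfl⟩

theorem exists_castLE_iff {l : ℕ} (hl : l ≤ m) (k : Fin m) : (∃ k', Fin.castLE hl k' = k) ↔ k.val < l :=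
  ⟨fun ⟨k', h⟩ => h ▸ k'.2, fun h => ⟨⟨k.val, h⟩, rfl⟩⟩

/-- A round applies one rule of `Run`. The conclusion says that every run from the new state extends
to one from the old state, so rounds can be chained; since the number of agents drops, `n` rounds
are enough. -/
theorem mainStep_spec {I : Problem n m} (hΔ : 1 ≤ I.maxDeg) (zn : Fin n) {zm : Fin m} (hzm : zm.val = 0)
    {N : Finset (Fin n)} {own : Fin m → Option (Fin n)} (hN : ∀ i ∈ N, ∀ j, own j ≠ some i)
    (hne : N.Nonempty) :
    ∃ N' own', mainStep I I.maxDeg zn zm (N, own) = (N', own') ∧ N'.card < N.card ∧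
      (∀ i ∈ N', ∀ j, own' j ≠ some i) ∧
      ∀ Q, Problem.Run I (factor I.maxDeg) N' (unowned own') (owned own') Q →
        Problem.Run I (factor I.maxDeg) N (unowned own) (owned own) Q := by
  have hdeg := card_adj_le I
  have hΔm := maxDeg_lt hΔ
  -- A round that ends the run reports no remaining agents, and from there a run cannot change any
  -- bundle.
  have hterm : ∀ own' : Fin m → Option (Fin n),
      Problem.Run I (factor I.maxDeg) N (unowned own) (owned own) (owned own') →
      ∃ N'' own'', ((∅ : Finset (Fin n)), own') = (N'', own'') ∧ N''.card < N.card ∧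
      (∀ i ∈ N'', ∀ j, own'' j ≠ some i) ∧
      ∀ Q, Problem.Run I (factor I.maxDeg) N'' (unowned own'') (owned own'') Q →
        Problem.Run I (factor I.maxDeg) N (unowned own) (owned own) Q := by
    intro own' h
    refine ⟨∅, own', rfl, by simpa using hne, by simp, fun Q hQ => ?_⟩
    have : Q = owned own' := funext fun i => hQ.eq_of_notMem (by simp)
    rwa [this]
  unfold mainStep
  dsimp only
  set M := unowned own
  rcases hf : first fun i => i ∈ N ∧ ∃ j, j ∈ M ∧ I.limit (factor I.maxDeg) N M i ≤ I.val i j with _ | i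
  swap
  · obtain ⟨hi, hj⟩ := first_some hf
    obtain ⟨j, hj, hjM, hlim⟩ := exists_first hj
    rw [Option.elim, hj, Option.getD_some]
    refine ⟨_, _, rfl, Finset.card_erase_lt_of_mem hi, giveTo_ne hN i _, fun Q hQ => ?_⟩
    rw [owned_giveTo (hN i hi) (by simpa using hjM), unowned_giveTo, Finset.sdiff_singleton_eq_erase] at hQ
    exact .reduce i j hi hjM hlim hQ
  have hred : I.Reduced (factor I.maxDeg) N M := by
    intro i hi j hj
    by_contra! hc
    exact first_eq_none.1 hf i ⟨hi, j, hj, hc⟩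
  rw [Option.elim]
  unfold fillStep
  dsimp only
  split_ifs with h1 hcol h2
  · obtain ⟨i, hi⟩ := hne
    obtain rfl : N = {i} := (Finset.card_eq_one.1 (le_antisymm h1 (Finset.card_pos.2 ⟨i, hi⟩))).elim
      fun a ha => by subst ha; simp at hi; rw [hi]
    obtain ⟨a, ha, ha'⟩ := exists_first (p := fun a => a ∈ ({i} : Finset (Fin n))) ⟨i, hi⟩
    obtain rfl := Finset.mem_singleton.1 ha'
    rw [ha]
    refine hterm _ ?_
    rw [owned_giveTo (hN _ hi) (heavySet_subset _ _ _ _)]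
    exact .single _ _ hred (heavySet_subset _ _ _ _) (heavySet_isIndepSet _ _ _ _)
      fun T hT hTi => factor_mul_value_le_heavySet hΔ hΔm hdeg _ hzm hT hTi
  · have hcol' := hcol.colorableOn hΔ
    have hpc := partialColoring_colorSet (G := I.graph) hΔm.le hdeg (.inr ((colorableOn_iff hΔ).1 hcol'))
    exact hterm _ (.colorable _ hred (by omega) hcol' (isColoringOf_colorClass hΔm.le hpc)
      (bagFill_spec hN (Fin.castLE_injective hΔm.le) (exists_castLE_iff _) fun _ => rfl))
  · rw [← colorableOn_iff_validOn hΔ hΔm.le hdeg] at hcol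
    unfold splitStep
    dsimp only
    obtain ⟨i, hif, hi⟩ := exists_first hne
    rw [hif, Option.getD_some]
    have hB := isLeastTransversal_transversal hΔ hΔm.le hdeg i M (I := I)
    set B := transversal I I.maxDeg i M
    rcases hf' : first fun j => j ∈ M ∧ I.splitLimit (factor I.maxDeg) N M B i ≤ I.val i j with _ | j
    · rw [Option.elim]
      refine hterm _ ?_
      have hcolB := Problem.IsLeastTransversal.colorableOn hΔ hdeg hB
      have hBM := Problem.IsLeastTransversal.subset hB
      have hpc := partialColoring_colorSet (G := I.graph) hΔm.le hdeg (.inr ((colorableOn_iff hΔ).1 hcolB))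
      -- `top` is the colour `Δ`, which the `Δ`-colouring of `M \ B` does not use; giving it to `B`
      -- makes `B` one more class.
      obtain ⟨top, htop, htop'⟩ := exists_first (p := fun k : Fin m => k.val ≤ I.maxDeg ∧ I.maxDeg ≤ k.val)
        ⟨⟨I.maxDeg, hΔm⟩, le_rfl, le_rfl⟩
      rw [htop]
      have htop'' : top.val = I.maxDeg := le_antisymm htop'.1 htop'.2
      set colB := colorSet I.graph I.maxDeg (M \ B)
      set col : Fin m → Option (Fin m) := fun j => if j ∈ B then some top else colB j
      have hcolBtop : ∀ j k, colB j = some k → k.val < I.maxDeg := fun j k h => (hpc.1 j k h).1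
      have hcolor : IsColoringOf I.graph (M \ B) fun k : Fin I.maxDeg => colorClass own col (Fin.castLE hΔm.le k) := by
        have e : ∀ k : Fin I.maxDeg, ∀ j, j ∈ colorClass own col (Fin.castLE hΔm.le k) ↔
            colB j = some (Fin.castLE hΔm.le k) := by
          intro k j
          simp only [colorClass, Finset.mem_filter, Finset.mem_univ, true_and, col]
          constructor
          · rintro ⟨_, h⟩
            split_ifs at h
            · have := congrArg Fin.val (Option.some.inj h)
              simp only [Fin.val_castLE] at this
              omega
            · exact h
          · intro h
            have hj := Finset.mem_sdiff.1 ((hpc.2 j).1 (by rw [h]; simp))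
            rw [if_neg hj.2]
            exact ⟨by simpa [M, unowned] using hj.1, h⟩
        refine ⟨fun k a ha b hb _ hadj => ?_, fun k k' hkk => ?_, ?_⟩
        · rw [Finset.mem_coe, e] at ha hb
          exact (hpc.1 a _ ha).2 b hadj hb
        · rw [Finset.disjoint_left]
          intro j hj hj'
          rw [e] at hj hj'
          exact hkk (Fin.castLE_injective hΔm.le (Option.some.inj (hj.symm.trans hj')))
        · ext j
          simp only [Finset.mem_biUnion, Finset.mem_univ, true_and, e]
          rw [← hpc.2]
          constructor
          · rintro ⟨k, hk⟩; rw [hk]; simp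
          · intro h
            obtain ⟨k, hk⟩ := Option.ne_none_iff_exists'.1 h
            exact ⟨⟨k.val, hcolBtop j k hk⟩, hk⟩
      refine .splitFill i B _ hred (by omega) h2 hcol hi hB (fun j hj => ?_) hcolor ?_
      · by_contra! hc
        exact first_eq_none.1 hf' j ⟨hj, hc⟩
      · refine bagFill_spec hN (e := Fin.cons top (Fin.castLE hΔm.le)) ?_ ?_ ?_
        · rw [Fin.cons_injective_iff]
          refine ⟨?_, Fin.castLE_injective _⟩
          rintro ⟨k, hk⟩
          have := congrArg Fin.val hk
          simp only [Fin.val_castLE] at this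
          omega
        · intro k
          rw [Fin.exists_fin_succ]
          simp only [Fin.cons_zero, Fin.cons_succ, exists_castLE_iff]
          rw [Fin.ext_iff, htop'']
          omega
        · intro k
          refine Fin.cases ?_ (fun k => ?_) k
          · simp only [Fin.cons_zero]
            ext j
            simp only [colorClass, Finset.mem_filter, Finset.mem_univ, true_and, col]
            constructor
            · intro hj
              rw [if_pos hj]
              exact ⟨by simpa [M, unowned] using hBM hj, rfl⟩
            · rintro ⟨_, h⟩
              split_ifs at h with hjB
              · exact hjB
              · have := hcolBtop j top h
                omega
          · simp only [Fin.cons_succ]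
    · obtain ⟨hjM, hlim⟩ := first_some hf'
      rw [Option.elim]
      refine ⟨_, _, rfl, Finset.card_erase_lt_of_mem hi, giveTo_ne hN i _, fun Q hQ => ?_⟩
      rw [owned_giveTo (hN i hi) (by simpa using hjM), unowned_giveTo, Finset.sdiff_singleton_eq_erase] at hQ
      exact .splitReduce i B j hred (by omega) h2 hcol hi hB hjM hlim hQ
  · rw [← colorableOn_iff_validOn hΔ hΔm.le hdeg] at hcol
    -- With `Δ + 1` colours all degrees are below the number of colours, so no colourability
    -- assumption is needed.
    have hpc := partialColoring_colorSet (G := I.graph) (d := I.maxDeg + 1) (S := M) hΔm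
      (fun v => (hdeg v).trans (Nat.le_succ _)) (.inl fun v => Nat.lt_succ_of_le (hdeg v))
    exact hterm _ (.many _ hred (by omega) (by omega) hcol (isColoringOf_colorClass hΔm hpc)
      (bagFill_spec hN (Fin.castLE_injective hΔm) (exists_castLE_iff _) fun _ => rfl))

/-- The owners after the rounds of the algorithm. -/
noncomputable def mainLoop (I : Problem n m) (Δ : ℕ) (zn : Fin n) (zm : Fin m) : Fin m → Option (Fin n) :=
  ((mainStep I Δ zn zm)^[n] (Finset.univ, fun _ => none)).2

theorem run_mainLoop {I : Problem n m} (hΔ : 1 ≤ I.maxDeg) (zn : Fin n) {zm : Fin m} (hzm : zm.val = 0) :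
    Problem.Run I (factor I.maxDeg) Finset.univ Finset.univ (fun _ => ∅) (owned (mainLoop I I.maxDeg zn zm)) := by
  have key : ∀ t N own, N.card ≤ t → (∀ i ∈ N, ∀ j, own j ≠ some i) →
      Problem.Run I (factor I.maxDeg) N (unowned own) (owned own)
        (owned ((mainStep I I.maxDeg zn zm)^[t] (N, own)).2) := by
    intro t
    induction t with
    | zero =>
      intro N own hcard _
      rw [Nat.le_zero, Finset.card_eq_zero] at hcard
      subst hcard
      exact .done
    | succ t ih =>
      intro N own hcard hN
      rcases N.eq_empty_or_nonempty with rfl | hne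
      · rw [Function.iterate_fixed (mainStep_empty ..)]
        exact .done
      · obtain ⟨N', own', he, hlt, hN', hrun⟩ := mainStep_spec hΔ zn hzm hN hne
        rw [Function.iterate_succ_apply, he]
        exact hrun _ (ih _ _ (by omega) hN')
  have := key n Finset.univ (fun _ => none) (by simp) (by simp)
  convert this using 1
  · simp [unowned]
  · funext i; simp [owned]
  · rfl

/-- Give the unowned items to agents without conflicts, one after the other. -/
noncomputable def distribute (G : SimpleGraph (Fin m)) (own : Fin m → Option (Fin n)) : Fin m → Option (Fin n) :=
  (List.finRange m).foldl (fun own j => if own j = none then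
    Function.update own j (first fun i => ∀ j', G.Adj j j' → own j' ≠ some i) else own) own

/-- The neighbours of an unowned item have at most `Δ < n` owners, so some agent can take the item
without a conflict. -/
theorem distribute_spec {I : Problem n m} (hn : I.maxDeg < n) {own : Fin m → Option (Fin n)}
    (h : ∀ i, I.graph.IsIndepSet (owned own i : Set (Fin m))) :
    (∀ i, I.graph.IsIndepSet (owned (distribute I.graph own) i : Set (Fin m))) ∧
      (∀ j i, own j = some i → distribute I.graph own j = some i) ∧
      ∀ j, distribute I.graph own j ≠ none := by
  have key : ∀ l : List (Fin m), ∀ own : Fin m → Option (Fin n),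
      (∀ i, I.graph.IsIndepSet (owned own i : Set (Fin m))) →
      ∀ own', own' = l.foldl (fun own j => if own j = none then
        Function.update own j (first fun i => ∀ j', I.graph.Adj j j' → own j' ≠ some i) else own) own →
      (∀ i, I.graph.IsIndepSet (owned own' i : Set (Fin m))) ∧
      (∀ j i, own j = some i → own' j = some i) ∧ ∀ j ∈ l, own' j ≠ none := by
    intro l
    induction l with
    | nil => rintro own h own' rfl; exact ⟨h, fun _ _ h => h, by simp⟩
    | cons j l ih =>
      rintro own h own' rfl
      rw [List.foldl_cons]
      split_ifs with hj
      · have hex : ∃ i, ∀ j', I.graph.Adj j j' → own j' ≠ some i := by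
          by_contra! hc
          have h1 : (Finset.univ.image (fun i : Fin n => some i)) ⊆ (Finset.univ.filter (I.graph.Adj j)).image own := by
            intro o ho
            obtain ⟨i, _, rfl⟩ := Finset.mem_image.1 ho
            obtain ⟨j', hj', he⟩ := hc i
            exact Finset.mem_image.2 ⟨j', by simpa using hj', he⟩
          have h2 := (Finset.card_le_card h1).trans Finset.card_image_le
          rw [Finset.card_image_of_injective _ (Option.some_injective _), Finset.card_univ, Fintype.card_fin] at h2
          have := card_adj_le I j
          omega
        obtain ⟨i, hi, hfree⟩ := exists_first hex
        rw [hi]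
        obtain ⟨h1, h2, h3⟩ := ih (Function.update own j (some i)) (fun a => by
          intro b hb b' hb' hne hadj
          simp only [owned, Finset.coe_filter, Finset.mem_univ, true_and, Set.mem_ofPred_eq] at hb hb'
          by_cases hbj : b = j
          · subst hbj
            rw [Function.update_self] at hb
            rw [Function.update_of_ne (Ne.symm hne)] at hb'
            exact hfree b' hadj (hb'.trans hb.symm)
          · rw [Function.update_of_ne hbj] at hb
            by_cases hbj' : b' = j
            · subst hbj'
              rw [Function.update_self] at hb'
              exact hfree b hadj.symm (hb.trans hb'.symm)
            · rw [Function.update_of_ne hbj'] at hb'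
              exact h a (by simpa [owned] using hb) (by simpa [owned] using hb') hne hadj) _ rfl
        refine ⟨h1, fun j' a hj' => h2 j' a ?_, fun j' hj' => ?_⟩
        · rw [Function.update_of_ne]
          · exact hj'
          · rintro rfl; rw [hj] at hj'; cases hj'
        · rcases List.mem_cons.1 hj' with rfl | hj'
          · rw [h2 j' i (by simp)]; simp
          · exact h3 j' hj'
      · obtain ⟨h1, h2, h3⟩ := ih own h _ rfl
        refine ⟨h1, h2, fun j' hj' => ?_⟩
        rcases List.mem_cons.1 hj' with rfl | hj'
        · obtain ⟨a, ha⟩ := Option.ne_none_iff_exists'.1 hj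
          rw [h2 j' a ha]; simp
        · exact h3 j' hj'
  obtain ⟨h1, h2, h3⟩ := key (List.finRange m) own h _ rfl
  exact ⟨h1, h2, fun j => h3 j (by simp)⟩

theorem BagFill.isIndepSet {I : Problem n m} {x : Fin n → ℝ} {last N : Finset (Fin n)} {l : ℕ}
    {A : Fin l → Finset (Fin m)} {P Q : Fin n → Finset (Fin m)} (h : BagFill I x last A N P Q)
    (hA : ∀ k, I.graph.IsIndepSet (A k : Set (Fin m))) (hP : ∀ i, I.graph.IsIndepSet (P i : Set (Fin m))) :
    ∀ i, I.graph.IsIndepSet (Q i : Set (Fin m)) := by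
  induction h with
  | finish => exact hP
  | @give A N P Q k B a _ hB _ _ _ _ ih =>
    refine ih (fun k' => ?_) (fun i => ?_)
    · by_cases hk : k' = k
      · subst hk
        rw [Function.update_self]
        exact (hA k').mono (by simp)
      · rw [Function.update_of_ne hk]; exact hA k'
    · by_cases hi : i = a
      · subst hi
        rw [Function.update_self]
        exact (hA k).mono (by simpa using hB.subset)
      · rw [Function.update_of_ne hi]; exact hP i

/-- Adjacent items would share a component, from which `B` contains only one item. -/
theorem Problem.IsLeastTransversal.isIndepSet {I : Problem n m} {l : ℕ} {i : Fin n} {M B : Finset (Fin m)}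
    (h : I.IsLeastTransversal l i M B) : I.graph.IsIndepSet (B : Set (Fin m)) := by
  intro a ha b hb hab hadj
  obtain ⟨C, hC, hbad, haC⟩ := h.1 a ha
  obtain ⟨j, _, hBj, _⟩ := h.2 C hC hbad
  have hbC : b ∈ C := by
    rw [hC.eq_reach haC]
    have := reach_spec (G := I.graph) (hC.subset haC)
    exact this.2.2 a this.1 b (Problem.IsLeastTransversal.subset h hb) hadj
  have h1 : a ∈ B ∩ C := Finset.mem_inter.2 ⟨ha, haC⟩
  have h2 : b ∈ B ∩ C := Finset.mem_inter.2 ⟨hb, hbC⟩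
  rw [hBj, Finset.mem_singleton] at h1 h2
  exact hab (h1.trans h2.symm)

theorem Problem.Run.isIndepSet {I : Problem n m} {α : ℝ} {N : Finset (Fin n)} {M : Finset (Fin m)}
    {P Q : Fin n → Finset (Fin m)} (h : Problem.Run I α N M P Q)
    (hP : ∀ i, I.graph.IsIndepSet (P i : Set (Fin m))) : ∀ i, I.graph.IsIndepSet (Q i : Set (Fin m)) := by
  have hup : ∀ {P : Fin n → Finset (Fin m)} {a : Fin n} {S : Finset (Fin m)},
      (∀ i, I.graph.IsIndepSet (P i : Set (Fin m))) → I.graph.IsIndepSet (S : Set (Fin m)) →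
      ∀ i, I.graph.IsIndepSet (Function.update P a S i : Set (Fin m)) := by
    intro P a S hP hS i
    by_cases hi : i = a
    · subst hi; rwa [Function.update_self]
    · rw [Function.update_of_ne hi]; exact hP i
  have hsingle : ∀ j : Fin m, I.graph.IsIndepSet (({j} : Finset (Fin m)) : Set (Fin m)) := by
    intro j a ha b hb hab
    simp only [Finset.coe_singleton, Set.mem_singleton_iff] at ha hb
    exact absurd (ha.trans hb.symm) hab
  induction h with
  | reduce a j _ _ _ _ ih => exact ih (hup hP (hsingle j))
  | done => exact hP
  | single a S _ _ hS _ => exact hup hP hS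
  | colorable A _ _ _ hA hB => exact hB.isIndepSet hA.1 hP
  | splitReduce a B j _ _ _ _ _ _ _ _ _ ih => exact ih (hup hP (hsingle j))
  | splitFill a B A _ _ _ _ _ hB _ hA hfill =>
    refine hfill.isIndepSet (fun k => ?_) hP
    refine Fin.cases ?_ (fun k => ?_) k
    · exact Problem.IsLeastTransversal.isIndepSet hB
    · exact hA.1 k
  | many A _ _ _ _ hA hB => exact hB.isIndepSet hA.1 hP

/-- The allocation computed by the algorithm. -/
noncomputable def allocate (I : Problem n m) (Δ : ℕ) (zn : Fin n) (zm : Fin m) : Fin m → Fin n :=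
  fun j => (distribute I.graph (mainLoop I Δ zn zm) j).getD zn

theorem output_allocate {I : Problem n m} (hΔ : 1 ≤ I.maxDeg) (hn : I.maxDeg < n) (zn : Fin n) {zm : Fin m}
    (hzm : zm.val = 0) : I.Output (factor I.maxDeg) (allocate I I.maxDeg zn zm) := by
  have hrun := run_mainLoop hΔ zn hzm
  obtain ⟨h1, h2, h3⟩ := distribute_spec hn (hrun.isIndepSet (by simp))
  have he : ∀ i, bundle (allocate I I.maxDeg zn zm) i = owned (distribute I.graph (mainLoop I I.maxDeg zn zm)) i := by
    intro i
    ext j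
    obtain ⟨a, ha⟩ := Option.ne_none_iff_exists'.1 (h3 j)
    rw [mem_owned, bundle, Finset.mem_filter, allocate, ha]
    simp
  refine ⟨_, hrun, fun i => by rw [he]; exact h1 i, fun i j hj => ?_⟩
  rw [he]
  simp only [owned, Finset.mem_filter, Finset.mem_univ, true_and] at hj ⊢
  exact h2 j i hj

end algorithm

end ConflictAlloc

namespace ConflictAlloc

open Classical Enc

section bound

variable {X : Inst → Type} {l : ∀ c, X c → List (Fin c.m)}

theorem PBound.takeWhile {p : ∀ c, X c → Fin c.m → Bool} (hb : PBound fun c s => (l c s).length) :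
    PBound fun c s => ((l c s).takeWhile (p c s)).length :=
  hb.mono fun _ _ => (List.takeWhile_sublist _).length_le

theorem PBound.dropWhile {p : ∀ c, X c → Fin c.m → Bool} (hb : PBound fun c s => (l c s).length) :
    PBound fun c s => ((l c s).dropWhile (p c s)).length :=
  hb.mono fun _ _ => (List.dropWhile_sublist _).length_le

theorem PBound.reverse (hb : PBound fun c s => (l c s).length) :
    PBound fun c s => (l c s).reverse.length :=
  hb.mono fun _ _ => (List.length_reverse).le

theorem PBound.tail (hb : PBound fun c s => (l c s).length) :
    PBound fun c s => (l c s).tail.length :=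
  hb.mono fun _ _ => by simp

end bound

section evaluation

variable {X Y : Inst → Type} [∀ c, Enc (X c)] [∀ c, Enc (Y c)]

/-! ### Colouring in polynomial time -/

/-- Expresses the maximum degree as a cardinality, so that it is computed by counting and bounded
quantifiers alone. -/
theorem card_val_lt_degree {n m : ℕ} (I : Problem n m) (h : 1 ≤ I.maxDeg) :
    (Finset.univ.filter fun k : Fin m => ∃ v, k.val < (Finset.univ.filter (I.graph.Adj v)).card).card =
      I.maxDeg := by
  have hm := maxDeg_lt h
  have : Nonempty (Fin m) := ⟨⟨0, by omega⟩⟩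
  have : (Finset.univ.filter fun k : Fin m => ∃ v, k.val < (Finset.univ.filter (I.graph.Adj v)).card) =
      Finset.univ.map (Fin.castLEEmb hm.le) := by
    ext k
    simp only [Finset.mem_filter, Finset.mem_univ, true_and, Finset.mem_map, Fin.castLEEmb_apply]
    constructor
    · rintro ⟨v, hv⟩
      exact ⟨⟨k.val, hv.trans_le (card_adj_le I v)⟩, Fin.ext rfl⟩
    · rintro ⟨k', rfl⟩
      obtain ⟨v, hv⟩ := I.graph.exists_maximal_degree_vertex
      refine ⟨v, k'.2.trans_eq ?_⟩
      rw [Problem.maxDeg, hv, SimpleGraph.degree, SimpleGraph.neighborFinset_eq_filter]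
  rw [this, Finset.card_map, Finset.card_univ, Fintype.card_fin]

theorem PT.maxDeg : PT (fun c (_ : X c) => c.I.maxDeg) :=
  (PT.card (k := Inst.m) (S := fun c (_ : X c) => Finset.univ.filter fun k : Fin c.m =>
      ∃ v, k.val < (Finset.univ.filter (c.I.graph.Adj v)).card)
    (PT.filter (PTp.exists_fin (PTp.natLt PT.id.fst.snd.finVal
      (PT.card (PT.filter (PTp.adj PT.id.fst.snd PT.id.snd))) PBound.card)))).congr
    fun c _ => card_val_lt_degree c.I c.deg_pos

/-- Computable numbers of colours. -/
class Colors (d : Inst → ℕ) : Prop where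
  pt : PT (X := fun _ => Unit) (fun c _ => d c)
  le : ∀ c, d c ≤ c.m

instance : Colors Inst.m := ⟨(PT.card (k := Inst.m) PT.univ).congr fun c _ => by simp, fun _ => le_rfl⟩
instance : Colors (fun c => c.I.maxDeg) := ⟨PT.maxDeg, fun c => (maxDeg_lt c.deg_pos).le⟩
instance : Colors (fun c => c.I.maxDeg + 1) := ⟨PT.maxDeg.natSucc, fun c => maxDeg_lt c.deg_pos⟩

variable {d : Inst → ℕ} [Colors d]

theorem PT.colors : PT (fun c (_ : X c) => d c) := (Colors.pt (d := d)).comp PT.unit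

omit [∀ c, Enc (X c)] in
theorem PBound.colors : PBound (fun c (_ : X c) => d c) := PBound.m.mono fun c _ => Colors.le c

theorem PTp.valLt {k : ∀ c, X c → Fin c.m} (hk : PT k) : PTp (fun c x => (k c x).val < d c) :=
  PTp.natLt hk.finVal PT.colors PBound.colors

variable {col : ∀ c, X c → Fin c.m → Option (Fin c.m)} {v x y : ∀ c, X c → Fin c.m}
  {l : ∀ c, X c → List (Fin c.m)}

/-- Here and below, a proof mirrors the body of the definition, with each operation replaced by its
closure property. -/
theorem PT.freeColor (hc : PT col) (hv : PT v) :
    PT (fun c s => freeColor c.I.graph (d c) (col c s) (v c s)) :=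
  PT.firstFin ((PTp.valLt PT.id.snd).and (PTp.forall_fin ((PTp.adj (hv.comp PT.id.fst.fst) PT.id.snd).imp
    (PTp.someEq (PT.app (hc.comp PT.id.fst.fst) PT.id.snd) PT.id.fst.snd).not)))

theorem PT.paint (hc : PT col) (hv : PT v) :
    PT (fun c s => paint c.I.graph (d c) (col c s) (v c s)) :=
  PT.update hc hv (PT.freeColor hc hv)

theorem PT.paintAll (hc : PT col) (hl : PT l) (hb : PBound fun c s => (l c s).length) :
    PT (fun c s => paintAll c.I.graph (d c) (col c s) (l c s)) :=
  PT.foldl hl hc (g := fun c _ => ConflictAlloc.paint c.I.graph (d c)) (PT.paint PT.id.snd.snd PT.id.snd.fst) hb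

theorem PT.paintCycle {out : ∀ c, X c → Fin c.m → Fin c.m → Prop} (hc : PT col) (hl : PT l)
    (hb : PBound fun c s => (l c s).length)
    (ho : PTp fun c (q : (X c × Fin c.m) × Fin c.m) => out c q.1.1 q.1.2 q.2) (hv : PT v) :
    PT (fun c s => paintCycle c.I.graph (d c) (col c s) (l c s) (out c s) (v c s)) := by
  have hp : PTp fun c (q : X c × Fin c.m) => ¬ ∃ u, out c q.1 q.2 u := (PTp.exists_fin ho).not
  have ha := PT.takeWhile (p := fun c s w => ¬ ∃ u, out c s w u) hl hp hb
  have hd := PT.dropWhile (p := fun c s w => ¬ ∃ u, out c s w u) hl hp hb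
  have hx := PT.list_headD hd hv
  have hoo := PT.append (PT.reverse ha hb.takeWhile) (PT.reverse hd.list_tail hb.dropWhile.tail)
    hb.takeWhile.reverse
  have hfirst := fun (x : ∀ c, X c → Fin c.m) (hx : PT x) =>
    show PT fun c s => (first (out c s (x c s))).getD (v c s) from
    PT.getD (PT.firstFin (PTp.comp ho ((PT.id.fst.pair (hx.comp PT.id.fst)).pair PT.id.snd))) hv
  exact PT.paint (PT.paintAll (PT.update hc (PT.list_headD hoo hv) (PT.app hc (hfirst _ hx))) hoo.list_tail
    ((hb.add hb).mono fun c s => by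
      have h1 := (List.takeWhile_sublist (fun w => decide ¬ ∃ u, out c s w u) (l := l c s)).length_le
      have h2 := (List.dropWhile_sublist (fun w => decide ¬ ∃ u, out c s w u) (l := l c s)).length_le
      simp only [List.length_tail, List.length_append, List.length_reverse]
      omega)) hx

theorem PT.paintClosed (hc : PT col) (hl : PT l) (hb : PBound fun c s => (l c s).length) (hv : PT v)
    (hx : PT x) (hy : PT y) :
    PT (fun c s => paintClosed c.I.graph (d c) (col c s) (l c s) (v c s) (x c s) (y c s)) := by
  have hp : PTp fun c (q : X c × Fin c.m) => ¬ c.I.graph.Adj (v c q.1) q.2 :=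
    (PTp.adj (hv.comp PT.id.fst) PT.id.snd).not
  have h1 := PT.paint (d := d) hc hx
  exact PT.paint (PT.paintAll (PT.paintAll (PT.update h1 hy (PT.app h1 hx)) (PT.takeWhile (p := fun c s w => ¬ c.I.graph.Adj (v c s) w) hl hp hb) hb.takeWhile)
    (PT.reverse (PT.dropWhile (p := fun c s w => ¬ c.I.graph.Adj (v c s) w) hl hp hb) hb.dropWhile) hb.dropWhile.reverse) hv

/-- Running times must be bounded on all arguments, including those for which the list is not a
path; hence a bound that only counts the steps. -/
theorem length_growPath {m : ℕ} (G : SimpleGraph (Fin m)) (T : Finset (Fin m)) (v x y : Fin m) :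
    (growPath G T v x y).1.length ≤ m + 3 := by
  have key : ∀ k, ((growStep G T v)^[k] ([y, v, x], {y, v, x})).1.length ≤ k + 3 := by
    intro k
    induction k with
    | zero => simp
    | succ k ih =>
      rw [Function.iterate_succ_apply']
      generalize (growStep G T v)^[k] ([y, v, x], {y, v, x}) = s at ih ⊢
      rw [growStep]
      rcases first fun w => w ∈ T ∧ w ∉ s.2 ∧ G.Adj (s.1.headD v) w with _ | w <;> simp <;> omega
  exact key m

theorem PT.growPath {T : ∀ c, X c → Finset (Fin c.m)} (hT : PT T) (hv : PT v) (hx : PT x) (hy : PT y) :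
    PT (fun c s => growPath c.I.graph (T c s) (v c s) (x c s) (y c s)) :=
  PT.iterate (g := fun c s => growStep c.I.graph (T c s) (v c s)) (Colors.pt (d := Inst.m) |>.comp PT.unit)
    (PT.pair (PT.cons hy (PT.cons hv (PT.cons hx PT.nil))) (PT.insert (PT.insert (PT.singleton hx) hv) hy))
    (PT.elim (PT.firstFin (((PTp.mem (hT.comp PT.id.fst.fst) PT.id.snd).and
      ((PTp.mem PT.id.fst.snd.snd PT.id.snd).not.and
        (PTp.adj (PT.list_headD PT.id.fst.snd.fst (hv.comp PT.id.fst.fst)) PT.id.snd))))) PT.id.snd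
      (PT.pair (PT.cons PT.id.snd PT.id.fst.snd.fst) (PT.insert PT.id.fst.snd.snd PT.id.snd)))
    PBound.m

theorem PTp.list_exists {p : ∀ c, X c → Fin c.m → Prop} (hl : PT l) (hb : PBound fun c s => (l c s).length)
    (hp : PTp fun c (q : X c × Fin c.m) => p c q.1 q.2) : PTp (fun c s => ∃ w, w ∈ l c s ∧ p c s w) := by
  refine (PTp.of_bool (PT.foldr (Z := fun _ => Bool) hl PT.mkFalse
    (g := fun c s w b => decide (p c s w ∨ b = true))
    ((hp.comp (PT.id.fst.pair PT.id.snd.fst)).or (PTp.of_bool PT.id.snd.snd)).toBool hb)).congr fun c s => ?_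
  induction l c s with
  | nil => simp
  | cons a r ih => rw [List.foldr_cons, decide_eq_true_eq, ih]; simp

/-- The body of `reroute` for an arbitrary computable `σ` of bounded length in place of the path;
nothing else about the path matters for the running time. -/
theorem PT.rerouteAlong {σ : ∀ c, X c → List (Fin c.m) × Finset (Fin c.m)} (hs : PT σ)
    (hsb : PBound fun c s => (σ c s).1.length) (hc : PT col) (hv : PT v) (hx : PT x) (hy : PT y) :
    PT (fun c s =>
      let G := c.I.graph
      let h := (σ c s).1.headD (v c s)
      let r := (σ c s).1.reverse
      let lead := r.takeWhile fun w => decide ¬ G.Adj h w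
      let cyc := (r.dropWhile fun w => decide ¬ G.Adj h w).reverse
      let col₁ := fun w => if w ∈ (σ c s).2 then none else col c s w
      let col₂ := ConflictAlloc.paintAll G (d c) col₁ lead
      if ∃ w, w ∈ cyc ∧ ∃ u, G.Adj w u ∧ col₂ u ≠ none then
        ConflictAlloc.paintCycle G (d c) col₂ cyc (fun w u => G.Adj w u ∧ col₂ u ≠ none) (v c s)
      else ConflictAlloc.paintClosed G (d c) col₁ r.tail.tail.tail (v c s) (x c s) (y c s)) := by
  have hh := PT.list_headD hs.fst hv
  have hr := PT.reverse hs.fst hsb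
  have hrb := hsb.reverse
  have hp : PTp fun c (q : X c × Fin c.m) => ¬ c.I.graph.Adj ((σ c q.1).1.headD (v c q.1)) q.2 :=
    (PTp.adj (hh.comp PT.id.fst) PT.id.snd).not
  have hlead := PT.takeWhile (p := fun c s w => ¬ c.I.graph.Adj ((σ c s).1.headD (v c s)) w) hr hp hrb
  have hcyc := PT.reverse (PT.dropWhile (p := fun c s w => ¬ c.I.graph.Adj ((σ c s).1.headD (v c s)) w) hr hp hrb)
    hrb.dropWhile
  have hcol₁ := PT.tabulate (g := fun c s w => if w ∈ (σ c s).2 then none else col c s w)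
    (PT.ite (PTp.mem (hs.snd.comp PT.id.fst) PT.id.snd) PT.mkNone (PT.app (hc.comp PT.id.fst) PT.id.snd))
  have hcol₂ := PT.paintAll (d := d) hcol₁ hlead hrb.takeWhile
  have hout := (PTp.adj PT.id.fst.snd PT.id.snd).and
    (PTp.isNone (PT.app (hcol₂.comp PT.id.fst.fst) PT.id.snd)).not
  exact PT.ite (PTp.list_exists hcyc hrb.dropWhile.reverse (PTp.exists_fin hout))
    (PT.paintCycle hcol₂ hcyc hrb.dropWhile.reverse hout hv)
    (PT.paintClosed hcol₁ hr.list_tail.list_tail.list_tail hrb.tail.tail.tail hv hx hy)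

theorem PT.reroute (hc : PT col) (hv : PT v) (hx : PT x) (hy : PT y) :
    PT (fun c s => reroute c.I.graph (d c) (col c s) (v c s) (x c s) (y c s)) :=
  PT.rerouteAlong (PT.growPath (T := fun c s => Finset.univ.filter fun w => w = v c s ∨ col c s w ≠ none)
    (PT.filter ((PTp.finEq PT.id.snd (hv.comp PT.id.fst)).or
      (PTp.isNone (PT.app (hc.comp PT.id.fst) PT.id.snd)).not)) hv hx hy)
    ((PBound.m.add (PBound.const 3)).mono fun _ _ => length_growPath ..) hc hv hx hy

theorem PT.extendColoring (hc : PT col) (hv : PT v) :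
    PT (fun c s => extendColoring c.I.graph (d c) (col c s) (v c s)) := by
  have hx : PT fun c s => (first fun x => c.I.graph.Adj (v c s) x ∧
      ∃ y, c.I.graph.Adj (v c s) y ∧ x ≠ y ∧ ¬ c.I.graph.Adj x y).getD (v c s) :=
    PT.getD (PT.firstFin ((PTp.adj (hv.comp PT.id.fst) PT.id.snd).and
      (PTp.exists_fin ((PTp.adj (hv.comp PT.id.fst.fst) PT.id.snd).and
        ((PTp.finEq PT.id.fst.snd PT.id.snd).not.and (PTp.adj PT.id.fst.snd PT.id.snd).not))))) hv
  have hy := fun (x : ∀ c, X c → Fin c.m) (hx : PT x) =>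
    show PT fun c s => (first fun y => c.I.graph.Adj (v c s) y ∧ x c s ≠ y ∧ ¬ c.I.graph.Adj (x c s) y).getD (v c s) from
    PT.getD (PT.firstFin ((PTp.adj (hv.comp PT.id.fst) PT.id.snd).and
      ((PTp.finEq (hx.comp PT.id.fst) PT.id.snd).not.and (PTp.adj (hx.comp PT.id.fst) PT.id.snd).not))) hv
  exact PT.ite (PTp.isNone (PT.freeColor hc hv)) (PT.reroute hc hv hx (hy _ hx)) (PT.paint hc hv)

theorem PT.colorSet {S : ∀ c, X c → Finset (Fin c.m)} (hS : PT S) :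
    PT (fun c s => colorSet c.I.graph (d c) (S c s)) :=
  PT.foldl (g := fun c s col v => if v ∈ S c s then ConflictAlloc.extendColoring c.I.graph (d c) col v else col)
    PT.finRange (PT.tabulate PT.mkNone)
    (PT.ite (PTp.mem (hS.comp PT.id.fst) PT.id.snd.fst) (PT.extendColoring PT.id.snd.snd PT.id.snd.fst)
      PT.id.snd.snd) PBound.finRange

theorem PTp.validOn {S : ∀ c, X c → Finset (Fin c.m)} (hS : PT S) (hc : PT col) :
    PTp (fun c s => ValidOn c.I.graph (d c) (S c s) (col c s)) :=
  PTp.forall_fin ((PTp.mem (hS.comp PT.id.fst) PT.id.snd).imp (PTp.exists_fin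
    ((PTp.someEq (PT.app (hc.comp PT.id.fst.fst) PT.id.fst.snd) PT.id.snd).and ((PTp.valLt PT.id.snd).and
      (PTp.forall_fin ((PTp.mem (hS.comp PT.id.fst.fst.fst) PT.id.snd).imp
        ((PTp.adj PT.id.fst.fst.snd PT.id.snd).imp
          (PTp.someEq (PT.app (hc.comp PT.id.fst.fst.fst) PT.id.snd) PT.id.fst.snd).not)))))))

theorem PT.filterOn {k : Inst → ℕ} [Idx k] {S : ∀ c, X c → Finset (Fin (k c))} {p : ∀ c, X c → Fin (k c) → Prop}
    [∀ c x, DecidablePred (p c x)] (hS : PT S) (hp : PTp fun c (q : X c × Fin (k c)) => p c q.1 q.2) :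
    PT (fun c x => (S c x).filter (p c x)) :=
  PT.finset (((PTp.mem (hS.comp PT.id.fst) PT.id.snd).and hp).congr fun _ _ => Finset.mem_filter.symm)

theorem PT.reach {S : ∀ c, X c → Finset (Fin c.m)} (hS : PT S) (hv : PT v) :
    PT (fun c s => reach c.I.graph (S c s) (v c s)) :=
  PT.iterate (g := fun c s R => (S c s).filter fun w => w ∈ R ∨ ∃ u ∈ R, c.I.graph.Adj u w)
    (PT.colors (d := Inst.m)) (PT.singleton hv)
    (PT.filterOn (hS.comp PT.id.fst) ((PTp.mem PT.id.fst.snd PT.id.snd).or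
      (PTp.exists_fin ((PTp.mem PT.id.fst.fst.snd PT.id.snd).and (PTp.adj PT.id.snd PT.id.fst.snd))))) PBound.m

/-! ### The algorithm in polynomial time -/

theorem PTp.precedes {i : ∀ c, X c → Fin c.n} (hi : PT i) (hx : PT x) (hy : PT y) :
    PTp (fun c s => Precedes c.I (i c s) (x c s) (y c s)) :=
  (PTp.realLe (PT.itemVal hi hx) (PT.itemVal hi hy)).and
    ((PTp.realLe (PT.itemVal hi hy) (PT.itemVal hi hx)).imp (PTp.finLe hx hy))

theorem PT.transversal {i : ∀ c, X c → Fin c.n} {M : ∀ c, X c → Finset (Fin c.m)} (hi : PT i) (hM : PT M) :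
    PT (fun c s => transversal c.I (d c) (i c s) (M c s)) := by
  have hr := PT.reach (X := fun c => X c × Fin c.m) (hM.comp PT.id.fst) PT.id.snd
  exact PT.filterOn hM ((PTp.validOn (d := d) hr (PT.colorSet (d := d) hr)).not.and
    (PTp.forall_fin ((PTp.mem (hr.comp PT.id.fst) PT.id.snd).imp
      (PTp.precedes (hi.comp PT.id.fst.fst) PT.id.fst.snd PT.id.snd))))

end evaluation

end ConflictAlloc

namespace ConflictAlloc

open Classical Enc

/-! ### Comparison with the limits without multiplying or dividing reals -/

section limits

/-- The numerator of the approximation factor. -/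
def factorNum (Δ : ℕ) : ℕ := if Δ = 1 then 1 else if Δ = 2 then 3 else 2

/-- The denominator of the approximation factor. -/
def factorDen (Δ : ℕ) : ℕ := if Δ = 1 then 2 else if Δ = 2 then 7 else Δ + 2

theorem factorDen_pos (Δ : ℕ) : 0 < factorDen Δ := by unfold factorDen; split_ifs <;> omega

theorem factor_eq_div (Δ : ℕ) : factor Δ = factorNum Δ / factorDen Δ := by
  unfold factor factorNum factorDen
  split_ifs <;> simp

/-- Clearing denominators leaves integer multiples, which the machine forms by repeated addition.
For `k = 0` the quotient is `0` by convention. -/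
theorem factor_mul_div_le_iff {Δ k : ℕ} {x y : ℝ} :
    factor Δ * (x / k) ≤ y ↔
      if k = 0 then 0 ≤ y else (factorNum Δ : ℝ) * x ≤ (factorDen Δ : ℝ) * (k * y) := by
  have h : (0 : ℝ) < factorDen Δ := Nat.cast_pos.2 (factorDen_pos Δ)
  split_ifs with hk
  · simp [hk]
  · have hk' : (0 : ℝ) < k := Nat.cast_pos.2 (Nat.pos_of_ne_zero hk)
    rw [factor_eq_div, div_mul_div_comm, div_le_iff₀ (mul_pos h hk')]
    exact iff_of_eq (congrArg _ (by ring))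

theorem splitLimit_le_iff {n m : ℕ} {I : Problem n m} {Δ : ℕ} {N : Finset (Fin n)} {M B : Finset (Fin m)}
    {i : Fin n} {y : ℝ} : I.splitLimit (factor Δ) N M B i ≤ y ↔
      factor Δ * (I.value i (M \ B) / N.card) ≤ y ∧ factor Δ * (I.value i M / ((N.card + 1 : ℕ) : ℝ)) ≤ y := by
  have h : 0 ≤ factor Δ := by rw [factor_eq_div]; positivity
  rw [Problem.splitLimit, mul_max_of_nonneg _ _ h, max_le_iff, Nat.cast_add, Nat.cast_one]

end limits

section evaluation

variable {X Y : Inst → Type} [∀ c, Enc (X c)] [∀ c, Enc (Y c)]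

theorem PT.natConst : ∀ k : ℕ, PT (fun c (_ : X c) => k)
  | 0 => PT.natZero
  | k + 1 => PT.natSucc (PT.natConst k)

theorem PTp.maxDegEq (k : ℕ) : PTp (fun c (_ : X c) => c.I.maxDeg = k) :=
  ((PTp.natLe PT.maxDeg (PT.natConst k) (.const k)).and
    (PTp.natLe (PT.natConst k) PT.maxDeg (PBound.colors (d := fun c => c.I.maxDeg)))).congr
    fun _ _ => le_antisymm_iff.symm

theorem PT.factorNum : PT (fun c (_ : X c) => factorNum c.I.maxDeg) :=
  PT.ite (PTp.maxDegEq 1) (PT.natConst 1) (PT.ite (PTp.maxDegEq 2) (PT.natConst 3) (PT.natConst 2))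

theorem PT.factorDen : PT (fun c (_ : X c) => factorDen c.I.maxDeg) :=
  PT.ite (PTp.maxDegEq 1) (PT.natConst 2) (PT.ite (PTp.maxDegEq 2) (PT.natConst 7) PT.maxDeg.natSucc.natSucc)

theorem PTp.factorLe {f g : ∀ c, X c → ℝ} {k : ∀ c, X c → ℕ} (hf : PT f) (hk : PT k) (hb : PBound k)
    (hg : PT g) : PTp (fun c s => factor c.I.maxDeg * (f c s / k c s) ≤ g c s) :=
  (PTp.ite (PTp.natEqZero hk) (PTp.realLe PT.realZero hg)
    (PTp.realLe (PT.natMulReal PT.factorNum hf ((PBound.const 3).mono fun c _ => by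
        unfold ConflictAlloc.factorNum; split_ifs <;> omega))
      (PT.natMulReal PT.factorDen (PT.natMulReal hk hg hb)
        (((PBound.colors (d := fun c => c.I.maxDeg)).add (.const 7)).mono fun c _ => by
          unfold ConflictAlloc.factorDen; split_ifs <;> omega)))).congr
    fun _ _ => factor_mul_div_le_iff.symm

variable {N : ∀ c, X c → Finset (Fin c.n)} {M B : ∀ c, X c → Finset (Fin c.m)} {i : ∀ c, X c → Fin c.n}

theorem PTp.limitLe {g : ∀ c, X c → ℝ} (hN : PT N) (hM : PT M) (hi : PT i) (hg : PT g) :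
    PTp (fun c s => c.I.limit (factor c.I.maxDeg) (N c s) (M c s) (i c s) ≤ g c s) :=
  PTp.factorLe (PT.value hi hM) (PT.card hN) PBound.card hg

theorem PTp.splitLimitLe {g : ∀ c, X c → ℝ} (hN : PT N) (hM : PT M) (hB : PT B) (hi : PT i) (hg : PT g) :
    PTp (fun c s => c.I.splitLimit (factor c.I.maxDeg) (N c s) (M c s) (B c s) (i c s) ≤ g c s) :=
  ((PTp.factorLe (PT.value hi (PT.sdiff hM hB)) (PT.card hN) PBound.card hg).and
    (PTp.factorLe (PT.value hi hM) (PT.card hN).natSucc (PBound.card.add (.const 1)) hg)).congr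
    fun _ _ => splitLimit_le_iff.symm

/-! ### Heavy independent sets -/

variable {part : ∀ c, X c → Fin c.m → Fin c.m} {v w : ∀ c, X c → Fin c.m}

theorem PTp.crowded (hM : PT M) (hp : PT part) (hv : PT v) (hw : PT w) :
    PTp (fun c s => Crowded c.I.graph (M c s) (part c s) (v c s) (w c s)) :=
  PTp.exists_fin ((PTp.mem (hM.comp PT.id.fst) PT.id.snd).and ((PTp.adj (hv.comp PT.id.fst) PT.id.snd).and
    ((PTp.finEq (PT.app (hp.comp PT.id.fst) PT.id.snd) (hw.comp PT.id.fst)).and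
      (PTp.exists_fin ((PTp.mem (hM.comp PT.id.fst.fst) PT.id.snd).and
        ((PTp.adj (hv.comp PT.id.fst.fst) PT.id.snd).and
          ((PTp.finEq (PT.app (hp.comp PT.id.fst.fst) PT.id.snd) (hw.comp PT.id.fst.fst)).and
            (PTp.finEq PT.id.fst.snd PT.id.snd).not)))))))

theorem PT.partStep (hM : PT M) (hp : PT part) :
    PT (fun c s => partStep c.I.graph c.I.maxDeg (M c s) (part c s)) :=
  PT.elim (PT.firstFin ((PTp.mem (hM.comp PT.id.fst) PT.id.snd).and
      (PTp.crowded (hM.comp PT.id.fst) (hp.comp PT.id.fst) PT.id.snd (PT.app (hp.comp PT.id.fst) PT.id.snd)))) hp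
    (PT.update (hp.comp PT.id.fst) PT.id.snd (PT.getD (PT.firstFin
      ((PTp.natLe (PT.natAdd PT.id.snd.finVal PT.id.snd.finVal PBound.fin) PT.maxDeg
        (PBound.colors (d := fun c => c.I.maxDeg))).and
        (PTp.crowded (hM.comp PT.id.fst.fst) (hp.comp PT.id.fst.fst) PT.id.fst.snd PT.id.snd).not)) PT.id.snd))

theorem PT.natMul {f g : ∀ c, X c → ℕ} (hf : PT f) (hg : PT g) (hfb : PBound f) (hgb : PBound g) :
    PT (fun c x => f c x * g c x) :=
  (PT.iterate hf PT.natZero (g := fun c x r => r + g c x)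
    (PT.natAdd PT.id.snd (hg.comp PT.id.fst) (hgb.comp _)) hfb).congr fun c x => by simp

theorem PT.sparsePart (hM : PT M) (hv : PT v) :
    PT (fun c s => sparsePart c.I.graph c.I.maxDeg (M c s) (v c s)) :=
  PT.iterate (g := fun c s => ConflictAlloc.partStep c.I.graph c.I.maxDeg (M c s))
    (PT.natMul (PT.colors (d := Inst.m)) (PT.colors (d := Inst.m)) PBound.m PBound.m).natSucc
    (PT.tabulate (hv.comp PT.id.fst)) (PT.partStep (hM.comp PT.id.fst) PT.id.snd)
    ((PBound.m.mul PBound.m).add (.const 1))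

theorem PT.winners (hi : PT i) (hM : PT M) (hp : PT part) (hv : PT v) :
    PT (fun c s => winners c.I (i c s) (M c s) (part c s) (v c s)) :=
  PT.filterOn hM ((PTp.finEq (PT.app (hp.comp PT.id.fst) PT.id.snd) (hv.comp PT.id.fst)).and
    (PTp.forall_fin ((PTp.mem (hM.comp PT.id.fst.fst) PT.id.snd).imp ((PTp.adj PT.id.fst.snd PT.id.snd).imp
      ((PTp.finEq (PT.app (hp.comp PT.id.fst.fst) PT.id.snd) (hv.comp PT.id.fst.fst)).imp
        (PTp.precedes (hi.comp PT.id.fst.fst) PT.id.snd PT.id.fst.snd))))))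

theorem PT.heavySet (hi : PT i) (hM : PT M) (hv : PT v) :
    PT (fun c s => heavySet c.I c.I.maxDeg (i c s) (M c s) (v c s)) := by
  have hp := PT.sparsePart hM hv
  have hw := PT.winners (X := fun c => (X c × Fin c.m) × Fin c.m) (hi.comp PT.id.fst.fst) (hM.comp PT.id.fst.fst)
    (hp.comp PT.id.fst.fst) PT.id.snd
  have hw' := PT.winners (X := fun c => (X c × Fin c.m) × Fin c.m) (hi.comp PT.id.fst.fst) (hM.comp PT.id.fst.fst)
    (hp.comp PT.id.fst.fst) PT.id.fst.snd
  exact PT.winners hi hM hp (PT.getD (PT.firstFin (PTp.forall_fin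
    (PTp.realLe (PT.value (hi.comp PT.id.fst.fst) hw) (PT.value (hi.comp PT.id.fst.fst) hw')))) hv)

/-! ### Bag filling -/

variable {own : ∀ c, X c → Fin c.m → Option (Fin c.n)} {col : ∀ c, X c → Fin c.m → Option (Fin c.m)}

theorem PT.unowned (ho : PT own) : PT (fun c s => unowned (own c s)) :=
  PT.filter (PTp.isNone (PT.app (ho.comp PT.id.fst) PT.id.snd))

theorem PT.giveTo (ho : PT own) (hi : PT i) (hB : PT B) : PT (fun c s => giveTo (own c s) (i c s) (B c s)) :=
  PT.tabulate (PT.ite (PTp.mem (hB.comp PT.id.fst) PT.id.snd) (PT.mkSome (hi.comp PT.id.fst))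
    (PT.app (ho.comp PT.id.fst) PT.id.snd))

theorem PT.fillBag {sat : ∀ c, X c → Finset (Fin c.m) → Prop} (hB : PT B)
    (hs : PTp fun c (q : X c × Finset (Fin c.m)) => sat c q.1 q.2) :
    PT (fun c s => fillBag (B c s) (sat c s)) :=
  PT.foldl (g := fun c s R j => if j ∈ B c s ∧ ¬ sat c s R then Insert.insert j R else R) PT.finRange PT.empty
    (PT.ite ((PTp.mem (hB.comp PT.id.fst) PT.id.snd.fst).and (hs.comp (PT.id.fst.pair PT.id.snd.snd)).not)
      (PT.insert PT.id.snd.snd PT.id.snd.fst) PT.id.snd.snd) PBound.finRange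

theorem PT.colorClass (ho : PT own) (hc : PT col) (hv : PT v) :
    PT (fun c s => colorClass (own c s) (col c s) (v c s)) :=
  PT.filter ((PTp.isNone (PT.app (ho.comp PT.id.fst) PT.id.snd)).and
    (PTp.someEq (PT.app (hc.comp PT.id.fst) PT.id.snd) (hv.comp PT.id.fst)))

variable {d : Inst → ℕ} [Colors d] {x : ∀ c, X c → Fin c.n → ℝ} {last : ∀ c, X c → Finset (Fin c.n)}

/-- A limit involves a quotient and is never computed as a number. As `hx` expresses, it is enough
to decide whether it is at most a given real. -/
theorem PT.giveBag (hx : PTp fun c (q : (X c × Fin c.n) × ℝ) => x c q.1.1 q.1.2 ≤ q.2) (hl : PT last)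
    (hN : PT N) (ho : PT own) (hB : PT B) (hi : PT i) :
    PT (fun c s =>
      let a := (first fun a => a ∈ N c s ∧ x c s a ≤ c.I.value a (B c s) ∧ a ∉ last c s).getD
        ((first fun a => a ∈ N c s ∧ x c s a ≤ c.I.value a (B c s)).getD (i c s))
      ((N c s).erase a, ConflictAlloc.giveTo (own c s) a (B c s))) := by
  have hv := PTp.comp hx (PT.id.pair (PT.value (X := fun c => X c × Fin c.n) PT.id.snd (hB.comp PT.id.fst)))
  have hm := PTp.mem (X := fun c => X c × Fin c.n) (hN.comp PT.id.fst) PT.id.snd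
  have ha : PT fun c s => (first fun a => a ∈ N c s ∧ x c s a ≤ c.I.value a (B c s) ∧ a ∉ last c s).getD
      ((first fun a => a ∈ N c s ∧ x c s a ≤ c.I.value a (B c s)).getD (i c s)) :=
    PT.getD (PT.firstFin (hm.and (hv.and (PTp.mem (hl.comp PT.id.fst) PT.id.snd).not)))
      (PT.getD (PT.firstFin (hm.and hv)) hi)
  exact PT.pair (PT.erase hN ha) (PT.giveTo ho ha hB)

theorem PTp.acceptable (hx : PTp fun c (q : (X c × Fin c.n) × ℝ) => x c q.1.1 q.1.2 ≤ q.2)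
    (hN : PT N) (hB : PT B) : PTp (fun c s => ∃ a, a ∈ N c s ∧ x c s a ≤ c.I.value a (B c s)) :=
  PTp.exists_fin ((PTp.mem (hN.comp PT.id.fst) PT.id.snd).and
    (PTp.comp hx (PT.id.pair (PT.value PT.id.snd (hB.comp PT.id.fst)))))

theorem PT.bagStep (hx : PTp fun c (q : (X c × Fin c.n) × ℝ) => x c q.1.1 q.1.2 ≤ q.2) (hl : PT last)
    (hc : PT col) (hi : PT i) (hN : PT N) (ho : PT own) :
    PT (fun c s => bagStep c.I (x c s) (last c s) (d c) (col c s) (i c s) (N c s, own c s)) := by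
  have hx' : PTp fun c (q : ((X c × Fin c.m) × Fin c.n) × ℝ) => x c q.1.1.1 q.1.2 ≤ q.2 :=
    hx.comp ((PT.id.fst.fst.fst.pair PT.id.fst.snd).pair PT.id.snd)
  have hx'' : PTp fun c (q : (((X c × Fin c.m) × Finset (Fin c.m)) × Fin c.n) × ℝ) => x c q.1.1.1.1 q.1.2 ≤ q.2 :=
    hx.comp ((PT.id.fst.fst.fst.fst.pair PT.id.fst.snd).pair PT.id.snd)
  have hC := PT.colorClass (X := fun c => X c × Fin c.m) (ho.comp PT.id.fst) (hc.comp PT.id.fst) PT.id.snd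
  exact PT.elim (PT.firstFin ((PTp.valLt PT.id.snd).and (PTp.acceptable hx' (hN.comp PT.id.fst) hC)))
    (hN.pair ho) (PT.giveBag hx' (hl.comp PT.id.fst) (hN.comp PT.id.fst) (ho.comp PT.id.fst)
      (PT.fillBag hC (PTp.acceptable hx'' (hN.comp PT.id.fst.fst) PT.id.snd)) (hi.comp PT.id.fst))

theorem PT.bagFill (hx : PTp fun c (q : (X c × Fin c.n) × ℝ) => x c q.1.1 q.1.2 ≤ q.2) (hl : PT last)
    (hc : PT col) (hi : PT i) (hN : PT N) (ho : PT own) :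
    PT (fun c s => bagFill c.I (x c s) (last c s) (d c) (col c s) (i c s) (N c s, own c s)) :=
  PT.snd (PT.iterate (g := fun c s => ConflictAlloc.bagStep c.I (x c s) (last c s) (d c) (col c s) (i c s))
    ((PT.card (k := Inst.n) PT.univ).congr fun c _ => by simp) (hN.pair ho)
    (PT.bagStep (hx.comp ((PT.id.fst.fst.fst.pair PT.id.fst.snd).pair PT.id.snd)) (hl.comp PT.id.fst)
      (hc.comp PT.id.fst) (hi.comp PT.id.fst) PT.id.snd.fst PT.id.snd.snd) PBound.n)

end evaluation

end ConflictAlloc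

namespace ConflictAlloc

open Classical Enc

/-! ### The rounds and the whole algorithm as a program -/

section evaluation

variable {X : Inst → Type} [∀ c, Enc (X c)] {N : ∀ c, X c → Finset (Fin c.n)} {M B : ∀ c, X c → Finset (Fin c.m)}
  {i z : ∀ c, X c → Fin c.n} {y : ∀ c, X c → Fin c.m} {own : ∀ c, X c → Fin c.m → Option (Fin c.n)}

theorem PT.splitWith (hN : PT N) (ho : PT own) (hM : PT M) (hB : PT B) (hi : PT i) (hz : PT z) :
    PT (fun c s => (first fun j => j ∈ M c s ∧
        c.I.splitLimit (factor c.I.maxDeg) (N c s) (M c s) (B c s) (i c s) ≤ c.I.val (i c s) j).elim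
      (∅, ConflictAlloc.bagFill c.I (Function.update (c.I.limit (factor c.I.maxDeg) (N c s) (M c s)) (i c s)
          (c.I.splitLimit (factor c.I.maxDeg) (N c s) (M c s) (B c s) (i c s))) {i c s} (c.I.maxDeg + 1)
        (fun j => if j ∈ B c s then first (fun k => k.val ≤ c.I.maxDeg ∧ c.I.maxDeg ≤ k.val)
          else ConflictAlloc.colorSet c.I.graph c.I.maxDeg (M c s \ B c s) j) (z c s) (N c s, own c s))
      fun j => ((N c s).erase (i c s), ConflictAlloc.giveTo (own c s) (i c s) {j})) := by
  have h₁ : PTp fun c (q : (X c × Fin c.n) × ℝ) => q.1.2 = i c q.1.1 :=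
    PTp.finEq PT.id.fst.snd (hi.comp PT.id.fst.fst)
  have h₂ : PTp fun c (q : (X c × Fin c.n) × ℝ) =>
      c.I.splitLimit (factor c.I.maxDeg) (N c q.1.1) (M c q.1.1) (B c q.1.1) (i c q.1.1) ≤ q.2 :=
    PTp.splitLimitLe (hN.comp PT.id.fst.fst) (hM.comp PT.id.fst.fst) (hB.comp PT.id.fst.fst)
      (hi.comp PT.id.fst.fst) PT.id.snd
  have h₃ : PTp fun c (q : (X c × Fin c.n) × ℝ) =>
      c.I.limit (factor c.I.maxDeg) (N c q.1.1) (M c q.1.1) q.1.2 ≤ q.2 :=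
    PTp.limitLe (hN.comp PT.id.fst.fst) (hM.comp PT.id.fst.fst) PT.id.fst.snd PT.id.snd
  have hx : PTp fun c (q : (X c × Fin c.n) × ℝ) =>
      Function.update (c.I.limit (factor c.I.maxDeg) (N c q.1.1) (M c q.1.1)) (i c q.1.1)
        (c.I.splitLimit (factor c.I.maxDeg) (N c q.1.1) (M c q.1.1) (B c q.1.1) (i c q.1.1)) q.1.2 ≤ q.2 := by
    -- The limit of the selected agent is replaced inside the comparison, by distinguishing whether
    -- the agent in question is the selected one.
    refine (h₁.ite h₂ h₃).congr fun c q => ?_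
    by_cases h : q.1.2 = i c q.1.1
    · rw [if_pos h, h, Function.update_self]
    · rw [if_neg h, Function.update_of_ne h]
  have hcol : PT fun c s => fun j => if j ∈ B c s then first (fun k => k.val ≤ c.I.maxDeg ∧ c.I.maxDeg ≤ k.val)
      else ConflictAlloc.colorSet c.I.graph c.I.maxDeg (M c s \ B c s) j :=
    PT.tabulate (PT.ite (PTp.mem (hB.comp PT.id.fst) PT.id.snd)
      (PT.firstFin ((PTp.natLe PT.id.snd.finVal PT.maxDeg (PBound.colors (d := fun c => c.I.maxDeg))).and (PTp.natLe PT.maxDeg PT.id.snd.finVal PBound.fin)))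
      (PT.app (PT.colorSet (d := fun c => c.I.maxDeg) ((PT.sdiff hM hB).comp PT.id.fst)) PT.id.snd))
  exact PT.elim (PT.firstFin ((PTp.mem (hM.comp PT.id.fst) PT.id.snd).and
      (PTp.splitLimitLe (hN.comp PT.id.fst) (hM.comp PT.id.fst) (hB.comp PT.id.fst) (hi.comp PT.id.fst)
        (PT.itemVal (hi.comp PT.id.fst) PT.id.snd))))
    (PT.pair PT.empty (PT.bagFill (d := fun c => c.I.maxDeg + 1) hx (PT.singleton hi) hcol hz hN ho))
    (PT.pair (PT.erase (hN.comp PT.id.fst) (hi.comp PT.id.fst))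
      (PT.giveTo (ho.comp PT.id.fst) (hi.comp PT.id.fst) (PT.singleton PT.id.snd)))

theorem PT.splitStep (hN : PT N) (ho : PT own) (hz : PT z) :
    PT (fun c s => splitStep c.I c.I.maxDeg (z c s) (N c s, own c s)) := by
  have hi := PT.getD (PT.firstFin (p := fun c s i => i ∈ N c s) (PTp.mem (hN.comp PT.id.fst) PT.id.snd)) hz
  exact PT.splitWith hN ho (PT.unowned ho)
    (PT.transversal (d := fun c => c.I.maxDeg) hi (PT.unowned ho)) hi hz

theorem PT.fillStep (hN : PT N) (ho : PT own) (hz : PT z) (hy : PT y) :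
    PT (fun c s => fillStep c.I c.I.maxDeg (z c s) (y c s) (N c s, own c s)) := by
  have hM := PT.unowned ho
  have hx : PTp fun c (q : (X c × Fin c.n) × ℝ) =>
      c.I.limit (factor c.I.maxDeg) (N c q.1.1) (ConflictAlloc.unowned (own c q.1.1)) q.1.2 ≤ q.2 :=
    PTp.limitLe (hN.comp PT.id.fst.fst) (hM.comp PT.id.fst.fst) PT.id.fst.snd PT.id.snd
  have hcol := PT.colorSet (d := fun c => c.I.maxDeg) hM
  exact PT.ite (PTp.natLe (PT.card hN) (PT.natConst 1) (.const 1))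
    (PT.elim (PT.firstFin (PTp.mem (hN.comp PT.id.fst) PT.id.snd)) (hN.pair ho)
      (PT.pair PT.empty (PT.giveTo (ho.comp PT.id.fst) PT.id.snd
        (PT.heavySet PT.id.snd (hM.comp PT.id.fst) (hy.comp PT.id.fst)))))
    (PT.ite (PTp.validOn (d := fun c => c.I.maxDeg) hM hcol)
      (PT.pair PT.empty (PT.bagFill (d := fun c => c.I.maxDeg) hx PT.empty hcol hz hN ho))
      (PT.ite (PTp.natLe (PT.card hN) PT.maxDeg (PBound.colors (d := fun c => c.I.maxDeg)))
        (PT.splitStep hN ho hz)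
        (PT.pair PT.empty (PT.bagFill (d := fun c => c.I.maxDeg + 1) hx PT.empty
          (PT.colorSet (d := fun c => c.I.maxDeg + 1) hM) hz hN ho))))

theorem PT.mainStep (hN : PT N) (ho : PT own) (hz : PT z) (hy : PT y) :
    PT (fun c s => mainStep c.I c.I.maxDeg (z c s) (y c s) (N c s, own c s)) := by
  have hM := PT.unowned ho
  have hlim : PTp fun c (q : (X c × Fin c.n) × Fin c.m) => q.2 ∈ ConflictAlloc.unowned (own c q.1.1) ∧
      c.I.limit (factor c.I.maxDeg) (N c q.1.1) (ConflictAlloc.unowned (own c q.1.1)) q.1.2 ≤ c.I.val q.1.2 q.2 :=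
    (PTp.mem (hM.comp PT.id.fst.fst) PT.id.snd).and (PTp.limitLe (hN.comp PT.id.fst.fst) (hM.comp PT.id.fst.fst)
      PT.id.fst.snd (PT.itemVal PT.id.fst.snd PT.id.snd))
  exact PT.elim (PT.firstFin ((PTp.mem (hN.comp PT.id.fst) PT.id.snd).and (PTp.exists_fin hlim)))
    (PT.fillStep hN ho hz hy)
    (PT.pair (PT.erase (hN.comp PT.id.fst) PT.id.snd) (PT.giveTo (ho.comp PT.id.fst) PT.id.snd
      (PT.singleton (PT.getD (PT.firstFin hlim) (hy.comp PT.id.fst)))))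

theorem PT.mainLoop (hz : PT z) (hy : PT y) :
    PT (fun c s => mainLoop c.I c.I.maxDeg (z c s) (y c s)) :=
  PT.snd (PT.iterate (g := fun c s => ConflictAlloc.mainStep c.I c.I.maxDeg (z c s) (y c s))
    ((PT.card (k := Inst.n) PT.univ).congr fun c _ => by simp) (PT.pair PT.univ (PT.tabulate PT.mkNone))
    (PT.mainStep PT.id.snd.fst PT.id.snd.snd (hz.comp PT.id.fst) (hy.comp PT.id.fst)) PBound.n)

theorem PT.distribute (ho : PT own) : PT (fun c s => distribute c.I.graph (own c s)) :=
  PT.foldl (Z := fun c => Fin c.m → Option (Fin c.n)) (b := own)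
    (g := fun c _ own j => if own j = none then
      Function.update own j (first fun i => ∀ j', c.I.graph.Adj j j' → own j' ≠ some i) else own)
    PT.finRange ho (PT.ite (PTp.isNone (PT.app PT.id.snd.snd PT.id.snd.fst))
      (PT.update PT.id.snd.snd PT.id.snd.fst (PT.firstFin (PTp.forall_fin
        ((PTp.adj PT.id.fst.fst.snd.fst PT.id.snd).imp
          (PTp.someEq (PT.app PT.id.fst.fst.snd.snd PT.id.snd) PT.id.fst.snd).not)))) PT.id.snd.snd)
    PBound.finRange

theorem PT.allocate (hz : PT z) (hy : PT y) :
    PT (fun c s => allocate c.I c.I.maxDeg (z c s) (y c s)) :=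
  PT.tabulate (PT.getD (PT.app ((PT.distribute (PT.mainLoop hz hy)).comp PT.id.fst) PT.id.snd) (hz.comp PT.id.fst))

theorem PT.finZero {k : Inst → ℕ} (h : ∀ c, 0 < k c) : PT (fun c (_ : X c) => (⟨0, h c⟩ : Fin (k c))) :=
  PT.natZero.congr_enc fun _ _ => rfl

end evaluation

open Polynomial in
/-- An output of the algorithm is computable in polynomial time. -/
theorem exists_prog : ∃ (prog : Prog) (time : Polynomial ℕ), ∀ (n m : ℕ) (I : Problem n m),
    1 ≤ I.maxDeg → I.maxDeg < n → ∃ (A : Fin m → Fin n) (t : ℕ),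
      Eval prog I.encode (encodeAllocation A) t ∧ t ≤ time.eval (n + m) ∧ I.Output (factor I.maxDeg) A := by
  obtain ⟨p, q, h⟩ := PT.allocate (X := fun _ => Unit)
    (PT.finZero (k := Inst.n) fun c => (Nat.zero_le _).trans_lt c.deg_lt)
    (PT.finZero (k := Inst.m) fun c => (Nat.zero_le _).trans_lt (maxDeg_lt c.deg_pos))
  -- The program `p` expects the instance paired with an argument; `nil` is the encoding of the
  -- trivial one.
  refine ⟨.seq (.cons .input .nil) p, q + 4, fun n m I hΔ hn => ?_⟩
  obtain ⟨t, ht, hq⟩ := h ⟨n, m, I, hΔ, hn⟩ ()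
  refine ⟨_, _, .seq (.cons (.input _) (.nil _)) ht, ?_, output_allocate hΔ hn _ rfl⟩
  simp only [eval_add, eval_ofNat]
  exact (Nat.add_le_add_right (Nat.add_le_add_left hq _) _).trans (by simp only []; omega)

end ConflictAlloc

open ConflictAlloc in
theorem mainTheorem2 :
    ∃ (prog : Prog) (time : Polynomial ℕ),
      ∀ (n m : ℕ) (I : Problem n m), 1 ≤ I.maxDeg → I.maxDeg < n →
        (∃ (A : Fin m → Fin n) (t : ℕ),
          Eval prog I.encode (encodeAllocation A) t ∧ t ≤ time.eval (n + m) ∧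
            I.Output (factor I.maxDeg) A) ∧
        (∀ A : Fin m → Fin n,
          I.Output (factor I.maxDeg) A → I.IsApproxMMS (factor I.maxDeg) A) ∧
        (2 < I.maxDeg → 1 / (I.maxDeg : ℝ) < factor I.maxDeg) := by
  obtain ⟨prog, time, h⟩ := exists_prog
  exact ⟨prog, time, fun n m I hΔ hn => ⟨h n m I hΔ hn, fun _ => Problem.Output.isApproxMMS hΔ, one_div_lt_factor⟩⟩
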